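/- \textbf{Setting.} A JB*-triple is a complex Banach space $Z$ with a continuous triple product $\{x,y,z\}$, complex linear and symmetric in the outer variables and conjugate linear in the middle one, such that $\|\{x,x,x\}\|=\|x\|^3$, the operator $i\,x\Box x$ is a derivation of the triple product, and $x\Box x$ has non-negative spectrum and generates a one-parameter group of isometries $\exp(it\,x\Box x)$, where $(x\Box y)(z)=\{x,y,z\}$. A JB*-morphism is a continuous linear map respecting triple products. A finite-dimensional JB*-triple is called principal if it is isomorphic to a finite direct sum of factors from the following list, each with the product $\{a,b,c\}=\frac12(ab^*c+cb^*a)$: all complex $m\times n$ matrices ($m,n\ge 2$), the skew-symmetric complex $n\times n$ matrices ($n\ge 5$), and the symmetric complex $n\times n$ matrices ($n\ge 2$). A TRO is a closed subspace $T$ of a C*-algebra with $xy^*z\in T$ for $x,y,z\in T$; TRO-morphisms are the continuous linear maps respecting $xy^*z$, and a TRO carries the triple product $\frac12(xy^*z+zy^*x)$. Let $\mathcal L(T)$ and $\mathcal R(T)$ be the C*-algebras generated by the products $xy^*$ and $x^*y$ ($x,y\in T$), and let $\mathrm{Li}(T)=\begin{pmatrix}\mathcal R(T)&T^*\\T&\mathcal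 L(T)\end{pmatrix}$ be the linking algebra, with inclusions $\iota_{\mathcal L},\iota_{\mathcal R}$ of $\mathcal L(T)$ and $\mathcal R(T)$. A TRO-morphism $\varphi:T\to S$ induces a *-homomorphism $\mathcal L(\varphi):\mathcal L(T)\to\mathcal L(S)$, $xy^*\mapsto\varphi(x)\varphi(y)^*$. A universal TRO of $Z$ is a TRO $\tau(Z)$ with a JB*-morphism $\rho_Z:Z\to\tau(Z)$ such that every JB*-morphism from $Z$ to a TRO factors as $\varphi\circ\rho_Z$ for exactly one TRO-morphism $\varphi$; a JB*-morphism $\phi:Z\to W$ thus extends uniquely to a TRO-morphism $\tau(\phi):\tau(Z)\to\tau(W)$. Put $K_0(Z)=K_0(\mathcal L(\tau(Z)))$ and $K_0(\phi)=K_0(\mathcal L(\tau(\phi)))$. Let $\tau(Z)^{\mathrm{op}}$ be $\tau(Z)$ with the ternary product $[x,y,z]^{\mathrm{op}}=zy^*x$, and let $\Phi:\tau(Z)\to\tau(Z)^{\mathrm{op}}$ be the TRO-morphism that is the identity on $\rho_Z(Z)$. Define: \begin{itemize} \item the scale $\Sigma(Z)\subseteq K_0(Z)$: the set of the classes of projections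 in $\mathcal L(\tau(Z))$; \item $\Delta^+(Z)$: the set of the classes $[\rho_Z(u)\rho_Z(u)^*]$ for $u\in Z$ with $\{u,u,u\}=u$; \item $\Delta^-(Z)$: the set of the classes $[ww^*]$ for $w\in\tau(Z)$ with $\Phi(w)=-w$ and $ww^*w=w$; \item the canonical involution $\sigma_Z=K_0(\iota_{\mathcal L})^{-1}\circ K_0(\iota_{\mathcal R})\circ K_0(\mathcal L(\Phi)):K_0(Z)\to K_0(Z)$, where $\mathcal L(\tau(Z)^{\mathrm{op}})$ is identified with the opposite algebra of $\mathcal R(\tau(Z))$, and $K_0$ of an algebra with $K_0$ of its opposite. \end{itemize} JB*-morphisms $\phi,\psi:Z\to W$ are unitarily equivalent if there are unitaries $V\in\mathcal L(\tau(W))$ and $U\in\mathcal R(\tau(W))$ with $\tau(\phi)(x)=V\,\tau(\psi)(x)\,U$ for all $x\in\tau(Z)$. \textbf{Theorem.} Let $Z_1$ and $Z_2$ be finite-dimensional principal JB*-triples. Then $Z_1$ and $Z_2$ have universal TROs. Let $\gamma:K_0(Z_1)\to K_0(Z_2)$ be a group homomorphism such that \begin{enumerate} \item[(i)] $\gamma(\Sigma(Z_1))\subseteq\Sigma(Z_2)$,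 $\gamma(\Delta^+(Z_1))\subseteq\Delta^+(Z_2)$ and $\gamma(\Delta^-(Z_1))\subseteq\Delta^-(Z_2)$; \item[(ii)] $\gamma\circ\sigma_{Z_1}=\sigma_{Z_2}\circ\gamma$. \end{enumerate} Then there is a JB*-morphism $\phi:Z_1\to Z_2$ with $K_0(\phi)=\gamma$, and any two such morphisms are unitarily equivalent. -/

import Mathlib

open scoped Matrix

noncomputable section

/-! ### JB*-triples and their morphisms -/

/-- The data of a triple product `{x, y, z}`. -/
class TripleProduct (Z : Type*) where
  triple : Z → Z → Z → Z

open TripleProduct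

/-- A continuous triple product, complex linear and symmetric in the outer variables and conjugate
linear in the middle variable. -/
class ContinuousTripleProduct (Z : Type*) [NormedAddCommGroup Z] [NormedSpace ℂ Z]
    extends TripleProduct Z where
  triple_add_left : ∀ x x' y z : Z, triple (x + x') y z = triple x y z + triple x' y z
  triple_smul_left : ∀ (c : ℂ) (x y z : Z), triple (c • x) y z = c • triple x y z
  triple_add_middle : ∀ x y y' z : Z, triple x (y + y') z = triple x y z + triple x y' z
  triple_smul_middle : ∀ (c : ℂ) (x y z : Z),
    triple x (c • y) z = (starRingEnd ℂ c) • triple x y z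
  triple_comm : ∀ x y z : Z, triple x y z = triple z y x
  continuous_triple : Continuous fun p : Z × Z × Z => triple p.1 p.2.1 p.2.2

/-- The operator `x □ y`, given by `(x □ y) z = {x, y, z}`. -/
def boxOp {Z : Type*} [NormedAddCommGroup Z] [NormedSpace ℂ Z] [ContinuousTripleProduct Z]
    (x y : Z) : Z →L[ℂ] Z where
  toFun z := triple x y z
  map_add' z z' := by
    rw [ContinuousTripleProduct.triple_comm x y (z + z'),
      ContinuousTripleProduct.triple_add_left, ContinuousTripleProduct.triple_comm z,
      ContinuousTripleProduct.triple_comm z']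
  map_smul' c z := by
    rw [ContinuousTripleProduct.triple_comm x y (c • z),
      ContinuousTripleProduct.triple_smul_left, ContinuousTripleProduct.triple_comm z]
    rfl
  cont := ContinuousTripleProduct.continuous_triple.comp
    (continuous_const.prodMk (continuous_const.prodMk continuous_id))

/-- A JB*-triple: a complex Banach space with a continuous triple product such that
`‖{x, x, x}‖ = ‖x‖ ^ 3`, each `i x □ x` is a derivation of the triple product, and each `x □ x` has
non-negative spectrum and generates a one-parameter group of isometries `exp (i t (x □ x))`. -/
class JBStarTriple (Z : Type*) [NormedAddCommGroup Z] [NormedSpace ℂ Z]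
    extends ContinuousTripleProduct Z where
  complete : CompleteSpace Z
  norm_triple_self : ∀ x : Z, ‖triple x x x‖ = ‖x‖ ^ 3
  derivation : ∀ x a b c : Z,
    boxOp (Complex.I • x) x (triple a b c) =
      triple (boxOp (Complex.I • x) x a) b c + triple a (boxOp (Complex.I • x) x b) c +
        triple a b (boxOp (Complex.I • x) x c)
  spectrum_nonneg : ∀ x : Z, ∀ r ∈ spectrum ℂ (boxOp x x), 0 ≤ r.re ∧ r.im = 0
  isometry_exp : ∀ (x : Z) (t : ℝ),
    Isometry (NormedSpace.exp ((Complex.I * (t : ℂ)) • boxOp x x) : Z →L[ℂ] Z)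

/-- A JB*-morphism: a continuous linear map which respects triple products.
(Between JB*-triples continuity is automatic.) -/
structure JBHom (Z W : Type*) [NormedAddCommGroup Z] [NormedSpace ℂ Z] [TripleProduct Z]
    [NormedAddCommGroup W] [NormedSpace ℂ W] [TripleProduct W] extends Z →L[ℂ] W where
  map_triple' : ∀ x y z : Z, toFun (triple x y z) = triple (toFun x) (toFun y) (toFun z)

/-- Composition of JB*-morphisms. -/
def JBHom.comp {Z W V : Type*} [NormedAddCommGroup Z] [NormedSpace ℂ Z] [TripleProduct Z]
    [NormedAddCommGroup W] [NormedSpace ℂ W] [TripleProduct W]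
    [NormedAddCommGroup V] [NormedSpace ℂ V] [TripleProduct V]
    (g : JBHom W V) (f : JBHom Z W) : JBHom Z V where
  toContinuousLinearMap := g.toContinuousLinearMap.comp f.toContinuousLinearMap
  map_triple' x y z :=
    (congrArg g.toFun (f.map_triple' x y z)).trans (g.map_triple' _ _ _)

/-! ### Principal JB*-triples -/

/-- The skew-symmetric complex `n × n` matrices. -/
def skewMatrices (n : ℕ) : Submodule ℂ (Matrix (Fin n) (Fin n) ℂ) where
  carrier := {a | aᵀ = -a}
  add_mem' {a b} ha hb := by
    simp only [Set.mem_ofPred_eq] at ha hb ⊢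
    rw [Matrix.transpose_add, ha, hb, neg_add]
  zero_mem' := by simp
  smul_mem' c a ha := by
    simp only [Set.mem_ofPred_eq] at ha ⊢
    rw [Matrix.transpose_smul, ha, smul_neg]

/-- The symmetric complex `n × n` matrices. -/
def symmetricMatrices (n : ℕ) : Submodule ℂ (Matrix (Fin n) (Fin n) ℂ) where
  carrier := {a | aᵀ = a}
  add_mem' {a b} ha hb := by
    simp only [Set.mem_ofPred_eq] at ha hb ⊢
    rw [Matrix.transpose_add, ha, hb]
  zero_mem' := by simp
  smul_mem' c a ha := by
    simp only [Set.mem_ofPred_eq] at ha ⊢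
    rw [Matrix.transpose_smul, ha]

/-- The factors that occur in principal triples: the rectangular factors which are not Hilbert
spaces, the symplectic factors of order at least `5`, and the hermitian factors of order at least
`2`. (The skew-symmetric matrices of order `4` form a spin factor which is not universally
reversible.) -/
inductive PrincipalFactor : Type
  | rect (m n : ℕ) (hm : 2 ≤ m) (hn : 2 ≤ n)
  | symp (n : ℕ) (hn : 5 ≤ n)
  | herm (n : ℕ) (hn : 2 ≤ n)

namespace PrincipalFactor

/-- The number of rows of the matrices in a factor. -/
def rows : PrincipalFactor → ℕ
  | rect m _ _ _ => m
  | symp n _ => n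
  | herm n _ => n

/-- The number of columns of the matrices in a factor. -/
def cols : PrincipalFactor → ℕ
  | rect _ n _ _ => n
  | symp n _ => n
  | herm n _ => n

/-- The matrices that make up a factor: all, the skew-symmetric, and the symmetric ones. -/
def space : (F : PrincipalFactor) → Submodule ℂ (Matrix (Fin F.rows) (Fin F.cols) ℂ)
  | rect _ _ _ _ => ⊤
  | symp n _ => skewMatrices n
  | herm n _ => symmetricMatrices n

end PrincipalFactor

/-- The triple product `(a b* c + c b* a) / 2` of matrices. -/
def matrixTriple {m n : ℕ} (a b c : Matrix (Fin m) (Fin n) ℂ) : Matrix (Fin m) (Fin n) ℂ :=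
  (1 / 2 : ℂ) • (a * bᴴ * c + c * bᴴ * a)

/-- A JB*-triple is principal if it is isomorphic, as a triple, to a finite direct sum of
non-Hilbertian rectangular, symplectic and hermitian factors. -/
def IsPrincipal (Z : Type*) [NormedAddCommGroup Z] [NormedSpace ℂ Z] [JBStarTriple Z] : Prop :=
  ∃ (k : ℕ) (F : Fin k → PrincipalFactor) (e : Z ≃ₗ[ℂ] ((i : Fin k) → (F i).space)),
    ∀ (x y z : Z) (i : Fin k),
      (e (triple x y z) i : Matrix (Fin (F i).rows) (Fin (F i).cols) ℂ) =
        matrixTriple (e x i : Matrix (Fin (F i).rows) (Fin (F i).cols) ℂ) (e y i) (e z i)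

/-! ### Ternary rings of operators -/

/-- A ternary ring of operators: a closed subspace of a C*-algebra which is closed under the
product `[x, y, z] = x y* z`. -/
structure TRO (A : Type*) [NonUnitalCStarAlgebra A] extends Submodule ℂ A where
  isClosed' : IsClosed carrier
  tern_mem' : ∀ x ∈ carrier, ∀ y ∈ carrier, ∀ z ∈ carrier, x * star y * z ∈ carrier

namespace TRO

variable {A B : Type*} [NonUnitalCStarAlgebra A] [NonUnitalCStarAlgebra B]

instance : CoeSort (TRO A) (Type _) := ⟨fun T => T.toSubmodule⟩

theorem tern_mem (T : TRO A) {x y z : A} (hx : x ∈ T.toSubmodule) (hy : y ∈ T.toSubmodule)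
    (hz : z ∈ T.toSubmodule) : x * star y * z ∈ T.toSubmodule := T.tern_mem' x hx y hy z hz

/-- The ternary product of a TRO. -/
def tern (T : TRO A) (x y z : T) : T :=
  ⟨(x : A) * star (y : A) * (z : A), T.tern_mem x.2 y.2 z.2⟩

/-- A TRO is a triple with respect to `{x, y, z} = (x y* z + z y* x) / 2`. -/
instance (T : TRO A) : TripleProduct T where
  triple x y z := (1 / 2 : ℂ) • (T.tern x y z + T.tern z y x)

/-- The conjugate TRO `T* = {x* | x ∈ T}`. -/
def conj (T : TRO A) : TRO A where
  carrier := {a | star a ∈ T.toSubmodule}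
  add_mem' {a b} ha hb := by
    simpa using T.toSubmodule.add_mem (show star a ∈ T.toSubmodule from ha) hb
  zero_mem' := by simp
  smul_mem' c a ha := by
    simpa using T.toSubmodule.smul_mem (star c) (show star a ∈ T.toSubmodule from ha)
  isClosed' := T.isClosed'.preimage continuous_star
  tern_mem' x hx y hy z hz := by
    have h := T.tern_mem (show star z ∈ T.toSubmodule from hz)
      (show star y ∈ T.toSubmodule from hy) (show star x ∈ T.toSubmodule from hx)
    simpa [mul_assoc] using h

/-- The opposite TRO `T^op`, realized in the opposite C*-algebra. It has the same elements as `T`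
and the ternary product `[x, y, z]^op = [z, y, x]`. -/
def op (T : TRO A) : TRO Aᵐᵒᵖ where
  carrier := {a | a.unop ∈ T.toSubmodule}
  add_mem' {a b} ha hb := T.toSubmodule.add_mem (show a.unop ∈ T.toSubmodule from ha) hb
  zero_mem' := T.toSubmodule.zero_mem
  smul_mem' c a ha := T.toSubmodule.smul_mem c (show a.unop ∈ T.toSubmodule from ha)
  isClosed' := T.isClosed'.preimage MulOpposite.continuous_unop
  tern_mem' x hx y hy z hz := by
    have h := T.tern_mem (show z.unop ∈ T.toSubmodule from hz)
      (show y.unop ∈ T.toSubmodule from hy) (show x.unop ∈ T.toSubmodule from hx)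
    simpa [mul_assoc] using h

theorem op_coe_triple (T : TRO A) (x y z : T) :
    MulOpposite.op ((triple x y z : T) : A) =
      ((triple (⟨MulOpposite.op (x : A), x.2⟩ : T.op) ⟨MulOpposite.op (y : A), y.2⟩
        ⟨MulOpposite.op (z : A), z.2⟩ : T.op) : Aᵐᵒᵖ) := by
  change MulOpposite.op ((1 / 2 : ℂ) • ((x : A) * star (y : A) * z + z * star (y : A) * x)) =
    (1 / 2 : ℂ) • (MulOpposite.op (x : A) * star (MulOpposite.op (y : A)) * MulOpposite.op (z : A) +
      MulOpposite.op (z : A) * star (MulOpposite.op (y : A)) * MulOpposite.op (x : A))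
  apply MulOpposite.unop_injective
  simp only [MulOpposite.unop_op, MulOpposite.unop_smul, MulOpposite.unop_add,
    MulOpposite.unop_mul, MulOpposite.unop_star, mul_assoc]
  rw [add_comm]

/-- The left C*-algebra of a TRO, the closed subalgebra generated by the products `x y*`. -/
def left (T : TRO A) : NonUnitalStarSubalgebra ℂ A :=
  (NonUnitalStarAlgebra.adjoin ℂ
    {a : A | ∃ x ∈ T.toSubmodule, ∃ y ∈ T.toSubmodule, x * star y = a}).topologicalClosure

/-- The right C*-algebra of a TRO, the closed subalgebra generated by the products `x* y`.
It is the left C*-algebra of the conjugate TRO. -/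
def right (T : TRO A) : NonUnitalStarSubalgebra ℂ A := T.conj.left

theorem isClosed_left (T : TRO A) : IsClosed (T.left : Set A) :=
  NonUnitalStarSubalgebra.isClosed_topologicalClosure _

theorem mul_star_mem_left (T : TRO A) {x y : A} (hx : x ∈ T.toSubmodule)
    (hy : y ∈ T.toSubmodule) : x * star y ∈ T.left :=
  NonUnitalStarSubalgebra.le_topologicalClosure _
    (NonUnitalStarAlgebra.subset_adjoin ℂ _ ⟨x, hx, y, hy, rfl⟩)

theorem star_mul_mem_right (T : TRO A) {x y : A} (hx : x ∈ T.toSubmodule)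
    (hy : y ∈ T.toSubmodule) : star x * y ∈ T.right := by
  have h := T.conj.mul_star_mem_left (x := star x) (y := star y)
    (show star (star x) ∈ T.toSubmodule by simpa using hx)
    (show star (star y) ∈ T.toSubmodule by simpa using hy)
  simpa [right] using h

theorem left_induction (T : TRO A) {p : A → Prop} (hc : IsClosed {a | p a})
    (hgen : ∀ x ∈ T.toSubmodule, ∀ y ∈ T.toSubmodule, p (x * star y)) (h0 : p 0)
    (hadd : ∀ a b, p a → p b → p (a + b)) (hmul : ∀ a b, p a → p b → p (a * b))
    (hsmul : ∀ (c : ℂ) a, p a → p (c • a)) : ∀ a ∈ T.left, p a := by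
  have key : ∀ a ∈ NonUnitalStarAlgebra.adjoin ℂ
      {a : A | ∃ x ∈ T.toSubmodule, ∃ y ∈ T.toSubmodule, x * star y = a},
      p a ∧ p (star a) := by
    intro a ha
    induction ha using NonUnitalStarAlgebra.adjoin_induction with
    | mem a ha =>
      obtain ⟨x, hx, y, hy, rfl⟩ := ha
      exact ⟨hgen x hx y hy, by simpa using hgen y hy x hx⟩
    | add a b _ _ iha ihb => exact ⟨hadd _ _ iha.1 ihb.1, by simpa using hadd _ _ iha.2 ihb.2⟩
    | zero => exact ⟨h0, by simpa using h0⟩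
    | mul a b _ _ iha ihb => exact ⟨hmul _ _ iha.1 ihb.1, by simpa using hmul _ _ ihb.2 iha.2⟩
    | smul c a _ iha => exact ⟨hsmul _ _ iha.1, by simpa using hsmul (star c) _ iha.2⟩
    | star a _ iha => exact ⟨iha.2, by simpa using iha.1⟩
  intro a ha
  have hsub : closure ((NonUnitalStarAlgebra.adjoin ℂ
      {a : A | ∃ x ∈ T.toSubmodule, ∃ y ∈ T.toSubmodule, x * star y = a} :
        NonUnitalStarSubalgebra ℂ A) : Set A) ⊆ {a | p a} :=
    closure_minimal (fun b hb => (key b hb).1) hc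
  exact hsub ha

theorem left_mul_mem (T : TRO A) {a x : A} (ha : a ∈ T.left) (hx : x ∈ T.toSubmodule) :
    a * x ∈ T.toSubmodule := by
  have h : ∀ a ∈ T.left, ∀ x ∈ T.toSubmodule, a * x ∈ T.toSubmodule := by
    refine T.left_induction (p := fun a => ∀ x ∈ T.toSubmodule, a * x ∈ T.toSubmodule)
      ?_ ?_ ?_ ?_ ?_ ?_
    · have : {a : A | ∀ x ∈ T.toSubmodule, a * x ∈ T.toSubmodule} =
          ⋂ x ∈ T.toSubmodule, (fun a : A => a * x) ⁻¹' (T.toSubmodule : Set A) := by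
        ext a; simp
      rw [this]
      exact isClosed_biInter fun x _ => T.isClosed'.preimage (continuous_mul_const x)
    · intro y hy z hz x hx
      exact T.tern_mem hy hz hx
    · intro x _; simp
    · intro a b ha hb x hx
      rw [add_mul]; exact T.toSubmodule.add_mem (ha x hx) (hb x hx)
    · intro a b ha hb x hx
      rw [mul_assoc]; exact ha _ (hb x hx)
    · intro c a ha x hx
      rw [smul_mul_assoc]; exact T.toSubmodule.smul_mem c (ha x hx)
  exact h a ha x hx

theorem mul_right_mem (T : TRO A) {x b : A} (hx : x ∈ T.toSubmodule) (hb : b ∈ T.right) :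
    x * b ∈ T.toSubmodule := by
  have h := T.conj.left_mul_mem (a := star b) (x := star x) (star_mem hb)
    (show star (star x) ∈ T.toSubmodule by simpa using hx)
  have h' : star (star b * star x) ∈ T.toSubmodule := h
  simpa using h'

/-- The linking algebra of `T`, the `2 × 2` matrices with entries in the right C*-algebra and
`T*` in the first row, and in `T` and the left C*-algebra in the second row. -/
def linking (T : TRO A) : NonUnitalStarSubalgebra ℂ (Matrix (Fin 2) (Fin 2) A) where
  carrier := {M | M 0 0 ∈ T.right ∧ star (M 0 1) ∈ T.toSubmodule ∧ M 1 0 ∈ T.toSubmodule ∧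
    M 1 1 ∈ T.left}
  add_mem' {M N} hM hN :=
    ⟨add_mem hM.1 hN.1, by simpa using add_mem hM.2.1 hN.2.1, add_mem hM.2.2.1 hN.2.2.1,
      add_mem hM.2.2.2 hN.2.2.2⟩
  zero_mem' := ⟨zero_mem _, by simp, by simp, zero_mem _⟩
  smul_mem' c M hM :=
    ⟨SMulMemClass.smul_mem c hM.1, by simpa using T.toSubmodule.smul_mem (star c) hM.2.1,
      T.toSubmodule.smul_mem c hM.2.2.1, SMulMemClass.smul_mem c hM.2.2.2⟩
  mul_mem' {M N} hM hN := by
    obtain ⟨hM1, hM2, hM3, hM4⟩ := hM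
    obtain ⟨hN1, hN2, hN3, hN4⟩ := hN
    refine ⟨?_, ?_, ?_, ?_⟩
    · rw [Matrix.mul_apply, Fin.sum_univ_two]
      refine add_mem (mul_mem hM1 hN1) ?_
      simpa using T.star_mul_mem_right hM2 hN3
    · rw [Matrix.mul_apply, Fin.sum_univ_two, star_add, star_mul, star_mul]
      exact add_mem (T.mul_right_mem hN2 (star_mem hM1)) (T.left_mul_mem (star_mem hN4) hM2)
    · rw [Matrix.mul_apply, Fin.sum_univ_two]
      exact add_mem (T.mul_right_mem hM3 hN1) (T.left_mul_mem hM4 hN3)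
    · rw [Matrix.mul_apply, Fin.sum_univ_two]
      refine add_mem ?_ (mul_mem hM4 hN4)
      simpa using T.mul_star_mem_left hM3 hN2
  star_mem' {M} hM :=
    ⟨star_mem hM.1, by simpa [Matrix.star_apply] using hM.2.2.1,
      by simpa [Matrix.star_apply] using hM.2.1, star_mem hM.2.2.2⟩

/-- The canonical embedding of the left C*-algebra into the linking algebra. -/
def leftIncl (T : TRO A) : T.left →⋆ₙₐ[ℂ] T.linking where
  toFun a := ⟨!![0, 0; 0, (a : A)], zero_mem _, by simp, by simp, a.2⟩
  map_smul' c a := by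
    apply Subtype.ext; ext i j; fin_cases i <;> fin_cases j <;> simp
  map_zero' := by
    apply Subtype.ext; ext i j; fin_cases i <;> fin_cases j <;> simp
  map_add' a b := by
    apply Subtype.ext; ext i j; fin_cases i <;> fin_cases j <;> simp
  map_mul' a b := by
    apply Subtype.ext; ext i j; fin_cases i <;> fin_cases j <;> simp [Matrix.mul_apply]
  map_star' a := by
    apply Subtype.ext; ext i j; fin_cases i <;> fin_cases j <;> simp [Matrix.star_apply]

/-- The canonical embedding of the right C*-algebra into the linking algebra. -/
def rightIncl (T : TRO A) : T.right →⋆ₙₐ[ℂ] T.linking where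
  toFun a := ⟨!![(a : A), 0; 0, 0], a.2, by simp, by simp, zero_mem _⟩
  map_smul' c a := by
    apply Subtype.ext; ext i j; fin_cases i <;> fin_cases j <;> simp
  map_zero' := by
    apply Subtype.ext; ext i j; fin_cases i <;> fin_cases j <;> simp
  map_add' a b := by
    apply Subtype.ext; ext i j; fin_cases i <;> fin_cases j <;> simp
  map_mul' a b := by
    apply Subtype.ext; ext i j; fin_cases i <;> fin_cases j <;> simp [Matrix.mul_apply]
  map_star' a := by
    apply Subtype.ext; ext i j; fin_cases i <;> fin_cases j <;> simp [Matrix.star_apply]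

theorem unop_mem_right (T : TRO A) : ∀ a ∈ T.op.left, a.unop ∈ T.right := by
  refine T.op.left_induction (p := fun a => a.unop ∈ T.right) ?_ ?_ ?_ ?_ ?_ ?_
  · exact T.conj.isClosed_left.preimage MulOpposite.continuous_unop
  · intro x hx y hy
    simpa using T.star_mul_mem_right (show y.unop ∈ T.toSubmodule from hy)
      (show x.unop ∈ T.toSubmodule from hx)
  · simp
  · intro a b ha hb; simpa using add_mem ha hb
  · intro a b ha hb; simpa using mul_mem hb ha
  · intro c a ha; simpa using SMulMemClass.smul_mem c ha

/-- The canonical identification of the left C*-algebra of `T^op` with the opposite of the right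
C*-algebra of `T`. -/
def opLeft (T : TRO A) : T.op.left →⋆ₙₐ[ℂ] (T.right)ᵐᵒᵖ where
  toFun a := MulOpposite.op ⟨(a : Aᵐᵒᵖ).unop, T.unop_mem_right a a.2⟩
  map_smul' _ _ := rfl
  map_zero' := rfl
  map_add' _ _ := rfl
  map_mul' _ _ := rfl
  map_star' _ := rfl

end TRO

/-- A TRO-morphism: a continuous linear map which respects the ternary products.
(Continuity is automatic.) -/
structure TROHom {A B : Type*} [NonUnitalCStarAlgebra A] [NonUnitalCStarAlgebra B]
    (T : TRO A) (S : TRO B) extends T →L[ℂ] S where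
  map_tern' : ∀ x y z : T, toFun (T.tern x y z) = S.tern (toFun x) (toFun y) (toFun z)

namespace TROHom

variable {A B : Type*} [NonUnitalCStarAlgebra A] [NonUnitalCStarAlgebra B]
  {T : TRO A} {S : TRO B}

instance : CoeFun (TROHom T S) (fun _ => T → S) := ⟨fun φ => φ.toContinuousLinearMap⟩

theorem map_tern (φ : TROHom T S) (x y z : T) : φ (T.tern x y z) = S.tern (φ x) (φ y) (φ z) :=
  φ.map_tern' x y z

/-- The graph of a TRO-morphism, a TRO in the product of the two C*-algebras. -/
def graph (φ : TROHom T S) : TRO (A × B) where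
  carrier := {p | ∃ x : T, (x : A) = p.1 ∧ (φ x : B) = p.2}
  add_mem' := by
    rintro p q ⟨x, hx, hx'⟩ ⟨y, hy, hy'⟩
    exact ⟨x + y, by simp [hx, hy], by simp [hx', hy']⟩
  zero_mem' := ⟨0, by simp, by simp⟩
  smul_mem' := by
    rintro c p ⟨x, hx, hx'⟩
    exact ⟨c • x, by simp [hx], by simp [hx']⟩
  isClosed' := by
    have h1 : IsClosed {q : T × B | (φ q.1 : B) = q.2} :=
      isClosed_eq (continuous_subtype_val.comp
        (φ.toContinuousLinearMap.continuous.comp continuous_fst)) continuous_snd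
    have h2 : Topology.IsClosedEmbedding (fun q : T × B => ((q.1 : A), q.2)) :=
      (T.isClosed'.isClosedEmbedding_subtypeVal).prodMap Topology.IsClosedEmbedding.id
    have h3 := h2.isClosedMap _ h1
    refine (congrArg IsClosed ?_).mpr h3
    ext p
    constructor
    · rintro ⟨x, hx, hx'⟩
      exact ⟨(x, p.2), hx', Prod.ext hx rfl⟩
    · rintro ⟨⟨x, b⟩, h, rfl⟩
      exact ⟨x, rfl, h⟩
  tern_mem' := by
    rintro p ⟨x, hx, hx'⟩ q ⟨y, hy, hy'⟩ r ⟨z, hz, hz'⟩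
    refine ⟨T.tern x y z, ?_, ?_⟩
    · simp [TRO.tern, hx, hy, hz]
    · rw [φ.map_tern]; simp [TRO.tern, hx', hy', hz']

theorem graph_fst_mem (φ : TROHom T S) : ∀ g ∈ φ.graph.left, g.1 ∈ T.left := by
  refine φ.graph.left_induction (p := fun g => g.1 ∈ T.left) ?_ ?_ ?_ ?_ ?_ ?_
  · exact T.isClosed_left.preimage continuous_fst
  · rintro p ⟨x, hx, -⟩ q ⟨y, hy, -⟩
    simpa [hx, hy] using T.mul_star_mem_left x.2 y.2
  · exact zero_mem _
  · intro a b ha hb; exact add_mem ha hb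
  · intro a b ha hb; exact mul_mem ha hb
  · intro c a ha; exact SMulMemClass.smul_mem c ha

theorem graph_snd_mem (φ : TROHom T S) : ∀ g ∈ φ.graph.left, g.2 ∈ S.left := by
  refine φ.graph.left_induction (p := fun g => g.2 ∈ S.left) ?_ ?_ ?_ ?_ ?_ ?_
  · exact S.isClosed_left.preimage continuous_snd
  · rintro p ⟨x, -, hx⟩ q ⟨y, -, hy⟩
    simpa [hx, hy] using S.mul_star_mem_left (φ x).2 (φ y).2
  · exact zero_mem _
  · intro a b ha hb; exact add_mem ha hb
  · intro a b ha hb; exact mul_mem ha hb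
  · intro c a ha; exact SMulMemClass.smul_mem c ha

theorem graph_eq_zero (φ : TROHom T S) {g : A × B} (hg : g ∈ φ.graph.left) (h : g.1 = 0) :
    g = 0 := by
  have hk : ∀ k ∈ φ.graph.left, g * k = 0 := by
    refine φ.graph.left_induction (p := fun k => g * k = 0) ?_ ?_ ?_ ?_ ?_ ?_
    · exact isClosed_eq (continuous_const_mul g) continuous_const
    · intro p hp q _
      have h0 : g * p = 0 := by
        obtain ⟨x, hx, hx'⟩ := φ.graph.left_mul_mem hg hp
        have hx0 : x = 0 := by
          apply Subtype.ext
          rw [hx, Prod.fst_mul, h, zero_mul]; rfl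
        refine Prod.ext ?_ ?_
        · rw [Prod.fst_mul, h, zero_mul]; rfl
        · rw [← hx', hx0]; simp
      rw [← mul_assoc, h0, zero_mul]
    · exact mul_zero g
    · intro a b ha hb; rw [mul_add, ha, hb, add_zero]
    · intro a b ha _; rw [← mul_assoc, ha, zero_mul]
    · intro c a ha; rw [mul_smul_comm, ha, smul_zero]
  exact CStarRing.mul_star_self_eq_zero_iff g |>.mp (hk _ (star_mem hg))

theorem exists_graph (φ : TROHom T S) : ∀ a ∈ T.left, ∃ g ∈ φ.graph.left, g.1 = a := by
  have : IsClosed (φ.graph.left : Set (A × B)) := φ.graph.isClosed_left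
  let π : φ.graph.left →⋆ₙₐ[ℂ] A :=
    (NonUnitalStarAlgHom.fst ℂ A B).comp (NonUnitalStarSubalgebraClass.subtype φ.graph.left)
  have hπ : ∀ g, π g = (g : A × B).1 := fun _ => rfl
  have hinj : Function.Injective π := by
    intro g k hgk
    rw [hπ, hπ] at hgk
    have := φ.graph_eq_zero (sub_mem g.2 k.2) (by rw [Prod.fst_sub, hgk, sub_self])
    exact Subtype.ext (sub_eq_zero.mp this)
  have hcl : IsClosed (Set.range π) :=
    (NonUnitalStarAlgHom.isometry π hinj).isClosedEmbedding.isClosed_range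
  suffices h : ∀ a ∈ T.left, a ∈ Set.range π by
    intro a ha
    obtain ⟨g, hg⟩ := h a ha
    exact ⟨g, g.2, hg⟩
  refine T.left_induction (p := fun a => a ∈ Set.range π) hcl ?_ ?_ ?_ ?_ ?_
  · intro x hx y hy
    exact ⟨⟨((x, (φ ⟨x, hx⟩ : B)) : A × B) * star ((y, (φ ⟨y, hy⟩ : B)) : A × B),
      φ.graph.mul_star_mem_left ⟨⟨x, hx⟩, rfl, rfl⟩ ⟨⟨y, hy⟩, rfl, rfl⟩⟩, rfl⟩
  · exact ⟨0, map_zero π⟩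
  · rintro _ _ ⟨g, rfl⟩ ⟨k, rfl⟩; exact ⟨g + k, map_add π g k⟩
  · rintro _ _ ⟨g, rfl⟩ ⟨k, rfl⟩; exact ⟨g * k, map_mul π g k⟩
  · rintro c _ ⟨g, rfl⟩; exact ⟨c • g, map_smul π c g⟩

/-- The second coordinate of the element of `L(graph φ)` over `a`. -/
def leftFun (φ : TROHom T S) (a : T.left) : S.left :=
  ⟨(φ.exists_graph a a.2).choose.2, φ.graph_snd_mem _ (φ.exists_graph a a.2).choose_spec.1⟩

theorem leftFun_eq (φ : TROHom T S) {g : A × B} (hg : g ∈ φ.graph.left) (a : T.left)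
    (h : g.1 = a) : (φ.leftFun a : B) = g.2 := by
  obtain ⟨h1, h2⟩ := (φ.exists_graph a a.2).choose_spec
  have := φ.graph_eq_zero (sub_mem h1 hg) (by rw [Prod.fst_sub, h2, h, sub_self])
  exact congrArg Prod.snd (sub_eq_zero.mp this)

theorem leftFun_mem (φ : TROHom T S) (a : T.left) :
    ((a : A), (φ.leftFun a : B)) ∈ φ.graph.left := by
  obtain ⟨h1, h2⟩ := (φ.exists_graph a a.2).choose_spec
  have : ((a : A), (φ.leftFun a : B)) = (φ.exists_graph a a.2).choose := Prod.ext h2.symm rfl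
  rw [this]; exact h1

/-- The *-homomorphism `L(φ) : L(T) → L(S)` with `L(φ) (x y*) = φ x (φ y)*`. -/
def left (φ : TROHom T S) : T.left →⋆ₙₐ[ℂ] S.left where
  toFun := φ.leftFun
  map_smul' c a := Subtype.ext
    (φ.leftFun_eq (SMulMemClass.smul_mem c (φ.leftFun_mem a)) (c • a) rfl)
  map_zero' := Subtype.ext (φ.leftFun_eq (zero_mem _) 0 rfl)
  map_add' a b := Subtype.ext
    (φ.leftFun_eq (add_mem (φ.leftFun_mem a) (φ.leftFun_mem b)) (a + b) rfl)
  map_mul' a b := Subtype.ext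
    (φ.leftFun_eq (mul_mem (φ.leftFun_mem a) (φ.leftFun_mem b)) (a * b) rfl)
  map_star' a := Subtype.ext
    (φ.leftFun_eq (star_mem (φ.leftFun_mem a)) (star a) rfl)

theorem left_mul_star (φ : TROHom T S) (x y : T) :
    (φ.left ⟨(x : A) * star (y : A), T.mul_star_mem_left x.2 y.2⟩ : B) =
      (φ x : B) * star (φ y : B) :=
  φ.leftFun_eq (φ.graph.mul_star_mem_left (x := ((x : A), (φ x : B))) (y := ((y : A), (φ y : B)))
    ⟨x, rfl, rfl⟩ ⟨y, rfl, rfl⟩) _ rfl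

end TROHom

/-! ### The group `K₀` -/

/-- A self-adjoint idempotent matrix with entries in `R`. -/
structure MatrixProjection (R : Type*) [NonUnitalRing R] [StarRing R] where
  size : ℕ
  mat : Matrix (Fin size) (Fin size) R
  mul_self : mat * mat = mat
  adjoint : matᴴ = mat

theorem MatrixProjection.unop_mul {R l m n : Type*} [NonUnitalRing R] [Fintype m] (v : Matrix l m Rᵐᵒᵖ) (w : Matrix m n Rᵐᵒᵖ) :
    ((v * w).map MulOpposite.unop)ᵀ = (w.map MulOpposite.unop)ᵀ * (v.map MulOpposite.unop)ᵀ := by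
  ext i j
  simp [Matrix.mul_apply]

namespace MatrixProjection

variable {R S : Type*} [NonUnitalRing R] [StarRing R] [NonUnitalRing S] [StarRing S]

/-- Murray-von Neumann equivalence: `p = v v*` and `q = v* v` for some rectangular matrix `v`. -/
def Equivalent (p q : MatrixProjection R) : Prop :=
  ∃ v : Matrix (Fin p.size) (Fin q.size) R, v * vᴴ = p.mat ∧ vᴴ * v = q.mat

instance setoid (R : Type*) [NonUnitalRing R] [StarRing R] : Setoid (MatrixProjection R) where
  r := Equivalent
  iseqv :=
    { refl := fun p => ⟨p.mat, by rw [p.adjoint, p.mul_self], by rw [p.adjoint, p.mul_self]⟩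
      symm := by
        rintro p q ⟨v, h1, h2⟩
        exact ⟨vᴴ, by rw [Matrix.conjTranspose_conjTranspose, h2],
          by rw [Matrix.conjTranspose_conjTranspose, h1]⟩
      trans := by
        rintro p q r ⟨v, h1, h2⟩ ⟨w, h3, h4⟩
        refine ⟨v * w, ?_, ?_⟩
        · calc v * w * (v * w)ᴴ = v * (w * wᴴ) * vᴴ := by
                rw [Matrix.conjTranspose_mul]; simp only [Matrix.mul_assoc]
            _ = (v * vᴴ) * (v * vᴴ) := by rw [h3, ← h2]; simp only [Matrix.mul_assoc]
            _ = p.mat := by rw [h1, p.mul_self]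
        · calc (v * w)ᴴ * (v * w) = wᴴ * (vᴴ * v) * w := by
                rw [Matrix.conjTranspose_mul]; simp only [Matrix.mul_assoc]
            _ = (wᴴ * w) * (wᴴ * w) := by rw [h2, ← h3]; simp only [Matrix.mul_assoc]
            _ = r.mat := by rw [h4, r.mul_self] }

/-- A projection in `R` as a `1 × 1` matrix. -/
def single (p : R) (h : p * p = p) (h' : star p = p) : MatrixProjection R where
  size := 1
  mat := Matrix.of fun _ _ => p
  mul_self := by ext i j; simp [Matrix.mul_apply, h]
  adjoint := by ext i j; simp [h']

/-- The block diagonal sum of two projections. -/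
def sum (p q : MatrixProjection R) : MatrixProjection R where
  size := p.size + q.size
  mat := (Matrix.fromBlocks p.mat 0 0 q.mat).submatrix finSumFinEquiv.symm finSumFinEquiv.symm
  mul_self := by
    rw [Matrix.submatrix_mul_equiv, Matrix.fromBlocks_multiply]
    simp [p.mul_self, q.mul_self]
  adjoint := by
    rw [Matrix.conjTranspose_submatrix, Matrix.fromBlocks_conjTranspose]
    simp [p.adjoint, q.adjoint]

/-- The projection of size zero. -/
def zero : MatrixProjection R where
  size := 0
  mat := 0
  mul_self := by simp
  adjoint := by simp

/-- The image of a projection under a *-homomorphism. -/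
def map [Module ℂ R] [Module ℂ S] (ψ : R →⋆ₙₐ[ℂ] S) (p : MatrixProjection R) :
    MatrixProjection S where
  size := p.size
  mat := p.mat.map ψ
  mul_self := by
    conv_rhs => rw [← p.mul_self]
    ext i j; simp [Matrix.mul_apply, map_sum]
  adjoint := by
    conv_rhs => rw [← p.adjoint]
    ext i j; simp [map_star]

/-- The projection over `R` which corresponds to a projection over the opposite algebra under the
identification of `Mₙ(R^op)` with `Mₙ(R)^op` by transposition. -/
def unop (p : MatrixProjection Rᵐᵒᵖ) : MatrixProjection R where
  size := p.size
  mat := (p.mat.map MulOpposite.unop)ᵀ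
  mul_self := by
    ext i j
    have h := congrArg MulOpposite.unop (congrFun (congrFun p.mul_self j) i)
    simpa [Matrix.mul_apply] using h
  adjoint := by
    ext i j
    have h := congrArg MulOpposite.unop (congrFun (congrFun p.adjoint j) i)
    simpa using h

theorem equivalent_of_matrix {p q : MatrixProjection R} {ι κ : Type*} [Fintype ι] [Fintype κ]
    (e : ι ≃ Fin p.size) (f : κ ≃ Fin q.size) (v : Matrix ι κ R)
    (h : v * vᴴ = p.mat.submatrix e e) (h' : vᴴ * v = q.mat.submatrix f f) : p ≈ q := by
  refine ⟨v.submatrix e.symm f.symm, ?_, ?_⟩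
  · rw [Matrix.conjTranspose_submatrix, Matrix.submatrix_mul_equiv, h]
    simp
  · rw [Matrix.conjTranspose_submatrix, Matrix.submatrix_mul_equiv, h']
    simp

theorem equivalent_of_reindex {p q : MatrixProjection R} {ι : Type*} [Fintype ι]
    (e : ι ≃ Fin p.size) (f : ι ≃ Fin q.size)
    (h : p.mat.submatrix e e = q.mat.submatrix f f) : p ≈ q := by
  have hq : q.mat.submatrix f f * (q.mat.submatrix f f)ᴴ = q.mat.submatrix f f := by
    rw [Matrix.conjTranspose_submatrix, Matrix.submatrix_mul_equiv, q.adjoint, q.mul_self]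
  have hq' : (q.mat.submatrix f f)ᴴ * q.mat.submatrix f f = q.mat.submatrix f f := by
    rw [Matrix.conjTranspose_submatrix, Matrix.submatrix_mul_equiv, q.adjoint, q.mul_self]
  exact equivalent_of_matrix e f (q.mat.submatrix f f) (hq.trans h.symm) hq'

/-- The index bijection of the block diagonal sum. -/
def sumIndex (p q : MatrixProjection R) : Fin p.size ⊕ Fin q.size ≃ Fin (p.sum q).size :=
  finSumFinEquiv

theorem sum_submatrix (p q : MatrixProjection R) :
    (p.sum q).mat.submatrix (sumIndex p q) (sumIndex p q) =
      Matrix.fromBlocks p.mat 0 0 q.mat := by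
  ext i j
  exact congrArg₂ (Matrix.fromBlocks p.mat 0 0 q.mat) (finSumFinEquiv.symm_apply_apply i)
    (finSumFinEquiv.symm_apply_apply j)

theorem sum_congr {p p' q q' : MatrixProjection R} (h : p ≈ p') (h' : q ≈ q') :
    p.sum q ≈ p'.sum q' := by
  obtain ⟨v, h1, h2⟩ := h
  obtain ⟨w, h3, h4⟩ := h'
  refine equivalent_of_matrix (sumIndex p q) (sumIndex p' q') (Matrix.fromBlocks v 0 0 w) ?_ ?_
  · rw [sum_submatrix, Matrix.fromBlocks_conjTranspose, Matrix.fromBlocks_multiply]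
    simp [h1, h3]
  · rw [sum_submatrix, Matrix.fromBlocks_conjTranspose, Matrix.fromBlocks_multiply]
    simp [h2, h4]

theorem sum_comm (p q : MatrixProjection R) : p.sum q ≈ q.sum p := by
  refine equivalent_of_matrix (sumIndex p q) (sumIndex q p)
    (Matrix.fromBlocks 0 p.mat q.mat 0) ?_ ?_
  · rw [sum_submatrix, Matrix.fromBlocks_conjTranspose, Matrix.fromBlocks_multiply]
    simp [p.adjoint, q.adjoint, p.mul_self, q.mul_self]
  · rw [sum_submatrix, Matrix.fromBlocks_conjTranspose, Matrix.fromBlocks_multiply]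
    simp [p.adjoint, q.adjoint, p.mul_self, q.mul_self]

theorem zero_sum (p : MatrixProjection R) : zero.sum p ≈ p := by
  refine equivalent_of_reindex (sumIndex zero p) (Equiv.emptySum (Fin 0) (Fin p.size)) ?_
  rw [sum_submatrix]
  ext (i | i) (j | j)
  · exact i.elim0
  · exact i.elim0
  · exact j.elim0
  · simp only [Matrix.fromBlocks_apply₂₂, Matrix.submatrix_apply]
    rfl

theorem sum_assoc (p q r : MatrixProjection R) : (p.sum q).sum r ≈ p.sum (q.sum r) := by
  refine equivalent_of_reindex
    ((Equiv.sumCongr (sumIndex p q) (Equiv.refl (Fin r.size))).trans (sumIndex (p.sum q) r))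
    ((Equiv.sumAssoc _ _ _).trans
      ((Equiv.sumCongr (Equiv.refl (Fin p.size)) (sumIndex q r)).trans (sumIndex p (q.sum r)))) ?_
  have h1 := sum_submatrix (p.sum q) r
  have h2 := sum_submatrix p (q.sum r)
  have h3 := sum_submatrix p q
  have h4 := sum_submatrix q r
  simp only [← Matrix.ext_iff, Matrix.submatrix_apply] at h1 h2 h3 h4
  ext i j
  simp only [Matrix.submatrix_apply, Equiv.trans_apply, h1, h2]
  rcases i with (i | i) | i <;> rcases j with (j | j) | j <;> simp [h3, h4]

theorem map_sum [Module ℂ R] [Module ℂ S] (ψ : R →⋆ₙₐ[ℂ] S) (p q : MatrixProjection R) :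
    (p.sum q).map ψ ≈ (p.map ψ).sum (q.map ψ) := by
  refine equivalent_of_reindex (p := (p.sum q).map ψ) (sumIndex p q)
    (sumIndex (p.map ψ) (q.map ψ)) (Eq.trans ?_ (sum_submatrix (p.map ψ) (q.map ψ)).symm)
  refine Eq.trans (congrArg (fun M => M.map ψ) (sum_submatrix p q)) ?_
  rw [Matrix.fromBlocks_map, Matrix.map_zero ψ (map_zero ψ), Matrix.map_zero ψ (map_zero ψ)]
  rfl

theorem unop_sum (p q : MatrixProjection Rᵐᵒᵖ) : (p.sum q).unop ≈ p.unop.sum q.unop := by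
  refine equivalent_of_reindex (p := (p.sum q).unop) (sumIndex p q)
    (sumIndex p.unop q.unop) (Eq.trans ?_ (sum_submatrix p.unop q.unop).symm)
  refine Eq.trans (congrArg (fun M : Matrix (Fin p.size ⊕ Fin q.size) (Fin p.size ⊕ Fin q.size) Rᵐᵒᵖ =>
    (M.map MulOpposite.unop)ᵀ) (sum_submatrix p q)) ?_
  rw [Matrix.fromBlocks_map, Matrix.fromBlocks_transpose]
  rfl

end MatrixProjection

/-- The monoid `V(R)` of Murray-von Neumann classes of projections in matrices over `R`. -/
def ProjectionClass (R : Type*) [NonUnitalRing R] [StarRing R] : Type _ :=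
  Quotient (MatrixProjection.setoid R)

namespace ProjectionClass

variable {R S : Type*} [NonUnitalRing R] [StarRing R] [NonUnitalRing S] [StarRing S]

instance : Zero (ProjectionClass R) := ⟨Quotient.mk _ MatrixProjection.zero⟩

instance : Add (ProjectionClass R) :=
  ⟨Quotient.map₂ MatrixProjection.sum fun _ _ h _ _ h' => MatrixProjection.sum_congr h h'⟩

instance : AddCommMonoid (ProjectionClass R) where
  add_assoc a b c := by
    induction a, b, c using Quotient.inductionOn₃ with
    | _ p q r => exact Quotient.sound (MatrixProjection.sum_assoc p q r)
  zero_add a := by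
    induction a using Quotient.inductionOn with
    | _ p => exact Quotient.sound (MatrixProjection.zero_sum p)
  add_zero a := by
    induction a using Quotient.inductionOn with
    | _ p => exact Quotient.sound (Setoid.trans (MatrixProjection.sum_comm p
        MatrixProjection.zero) (MatrixProjection.zero_sum p))
  add_comm a b := by
    induction a, b using Quotient.inductionOn₂ with
    | _ p q => exact Quotient.sound (MatrixProjection.sum_comm p q)
  nsmul := nsmulRec

/-- A *-homomorphism induces an additive map between the monoids of projection classes. -/
def map [Module ℂ R] [Module ℂ S] (ψ : R →⋆ₙₐ[ℂ] S) :
    ProjectionClass R →+ ProjectionClass S where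
  toFun := Quotient.map (MatrixProjection.map ψ) (by
    rintro p q ⟨v, h1, h2⟩
    refine ⟨v.map ψ, ?_, ?_⟩
    · change _ = p.mat.map ψ
      rw [← h1, Matrix.map_mul, Matrix.conjTranspose_map ψ (fun a => map_star ψ a)]
      rfl
    · change _ = q.mat.map ψ
      rw [← h2, Matrix.map_mul, Matrix.conjTranspose_map ψ (fun a => map_star ψ a)]
      rfl)
  map_zero' := Quotient.sound (MatrixProjection.equivalent_of_reindex (Equiv.refl (Fin 0))
    (Equiv.refl (Fin 0)) (by ext i; exact i.elim0))
  map_add' a b := by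
    induction a, b using Quotient.inductionOn₂ with
    | _ p q => exact Quotient.sound (MatrixProjection.map_sum ψ p q)

/-- The additive map between projection classes of the opposite algebra and of the algebra. -/
def unop : ProjectionClass Rᵐᵒᵖ →+ ProjectionClass R where
  toFun := Quotient.map MatrixProjection.unop (by
    rintro p q ⟨v, h1, h2⟩
    have h : ((vᴴ.map MulOpposite.unop)ᵀ)ᴴ = (v.map MulOpposite.unop)ᵀ := by
      ext i j; simp
    have h3 : (vᴴ.map MulOpposite.unop)ᵀ * ((vᴴ.map MulOpposite.unop)ᵀ)ᴴ =
        (p.mat.map MulOpposite.unop)ᵀ := by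
      rw [h, ← h1, MatrixProjection.unop_mul]
    have h4 : ((vᴴ.map MulOpposite.unop)ᵀ)ᴴ * (vᴴ.map MulOpposite.unop)ᵀ =
        (q.mat.map MulOpposite.unop)ᵀ := by
      rw [h, ← h2, MatrixProjection.unop_mul]
    exact ⟨(vᴴ.map MulOpposite.unop)ᵀ, h3, h4⟩)
  map_zero' := Quotient.sound (MatrixProjection.equivalent_of_reindex (Equiv.refl (Fin 0))
    (Equiv.refl (Fin 0)) (by ext i; exact i.elim0))
  map_add' a b := by
    induction a, b using Quotient.inductionOn₂ with
    | _ p q => exact Quotient.sound (MatrixProjection.unop_sum p q)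

end ProjectionClass

/-- The group `K₀` of a C*-algebra with unit (in particular, of a finite dimensional one), the
Grothendieck group of its monoid of projection classes. *-Homomorphisms need not be unital. -/
abbrev KZero (R : Type*) [NonUnitalRing R] [StarRing R] : Type _ :=
  Algebra.GrothendieckAddGroup (ProjectionClass R)

namespace KZero

variable {R S : Type*} [NonUnitalRing R] [StarRing R] [NonUnitalRing S] [StarRing S]

/-- The class in `K₀(R)` of a projection in `R`. -/
def ofProjection (p : R) (h : p * p = p) (h' : star p = p) : KZero R :=
  Algebra.GrothendieckAddGroup.of
    (Quotient.mk _ (MatrixProjection.single p h h') : ProjectionClass R)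

/-- The homomorphism `K₀(ψ)`. -/
def map [Module ℂ R] [Module ℂ S] (ψ : R →⋆ₙₐ[ℂ] S) : KZero R →+ KZero S :=
  Algebra.GrothendieckAddGroup.lift
    (Algebra.GrothendieckAddGroup.of.comp (ProjectionClass.map ψ))

/-- The canonical homomorphism from `K₀(R^op)` to `K₀(R)`. -/
def unop : KZero Rᵐᵒᵖ →+ KZero R :=
  Algebra.GrothendieckAddGroup.lift
    (Algebra.GrothendieckAddGroup.of.comp ProjectionClass.unop)

end KZero

/-! ### Universal TROs and the invariant -/

/-- A universal TRO `(τ(Z), ρ)` of a triple `Z`: every JB*-morphism from `Z` to a TRO lifts uniquely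
to a TRO-morphism defined on `τ(Z)`. -/
structure UniversalTRO.{u, v} (Z : Type v) [NormedAddCommGroup Z] [NormedSpace ℂ Z]
    [TripleProduct Z] where
  Ambient : Type u
  [cstar : NonUnitalCStarAlgebra Ambient]
  tro : TRO Ambient
  ρ : JBHom Z tro
  existsUnique_lift : ∀ (B : Type u) [NonUnitalCStarAlgebra B] (S : TRO B) (π : JBHom Z S),
    ∃! φ : TROHom tro S, ∀ z : Z, φ (ρ.toFun z) = π.toFun z

namespace UniversalTRO

universe u v w

attribute [instance] UniversalTRO.cstar

variable {Z : Type v} [NormedAddCommGroup Z] [NormedSpace ℂ Z] [TripleProduct Z]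
  {W : Type w} [NormedAddCommGroup W] [NormedSpace ℂ W] [TripleProduct W]

/-- The lift of a JB*-morphism `Z → S` to a TRO-morphism `τ(Z) → S`. -/
def lift (U : UniversalTRO.{u} Z) {B : Type u} [NonUnitalCStarAlgebra B] {S : TRO B}
    (π : JBHom Z S) : TROHom U.tro S :=
  (U.existsUnique_lift B S π).choose

/-- The TRO-morphism `τ(φ) : τ(Z) → τ(W)` which extends a JB*-morphism `φ : Z → W`. -/
def map (U : UniversalTRO.{u} Z) (V : UniversalTRO.{u} W) (φ : JBHom Z W) :
    TROHom U.tro V.tro :=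
  U.lift (V.ρ.comp φ)

/-- The group `K₀(Z)`, the `K₀`-group of the left C*-algebra of the universal TRO. -/
abbrev K (U : UniversalTRO.{u} Z) : Type _ := KZero U.tro.left

/-- The homomorphism `K₀(φ) : K₀(Z) → K₀(W)` induced by a JB*-morphism `φ : Z → W`. -/
def mapK (U : UniversalTRO.{u} Z) (V : UniversalTRO.{u} W) (φ : JBHom Z W) : U.K →+ V.K :=
  KZero.map (U.map V φ).left

/-- The canonical embedding of `Z` into `τ(Z)^op`. -/
def ρop (U : UniversalTRO.{u} Z) : JBHom Z U.tro.op where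
  toFun z := ⟨MulOpposite.op (U.ρ.toFun z : U.Ambient), (U.ρ.toFun z).2⟩
  map_add' x y := Subtype.ext
    (congrArg (fun t : U.tro => MulOpposite.op (t : U.Ambient)) (U.ρ.map_add' x y))
  map_smul' c x := Subtype.ext
    (congrArg (fun t : U.tro => MulOpposite.op (t : U.Ambient)) (U.ρ.map_smul' c x))
  cont := (MulOpposite.continuous_op.comp
    (continuous_subtype_val.comp U.ρ.cont)).subtype_mk _
  map_triple' x y z := by
    have h := congrArg (fun t : U.tro => MulOpposite.op (t : U.Ambient)) (U.ρ.map_triple' x y z)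
    exact Subtype.ext (h.trans (U.tro.op_coe_triple _ _ _))

/-- The canonical isomorphism `Φ₀ : τ(Z) → τ(Z)^op`, the extension of the embedding of `Z`. -/
def opIso (U : UniversalTRO.{u} Z) : TROHom U.tro U.tro.op := U.lift U.ρop

/-- The canonical antiautomorphism `Φ : τ(Z) → τ(Z)`. -/
def anti (U : UniversalTRO.{u} Z) (w : U.tro) : U.tro :=
  ⟨(U.opIso w : (U.Ambient)ᵐᵒᵖ).unop, (U.opIso w).2⟩

/-- The Morita isomorphism `η = K₀(ι_L)⁻¹ ∘ K₀(ι_R) : K₀(R(T)) → K₀(L(T))`. -/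
def _root_.TRO.morita {A : Type*} [NonUnitalCStarAlgebra A] (T : TRO A) (x : KZero T.right) :
    KZero T.left :=
  Function.invFun (KZero.map T.leftIncl) (KZero.map T.rightIncl x)

/-- The canonical involution `σ = η ∘ K₀(L(Φ))` of `K₀(Z)`, where the left C*-algebra of `τ(Z)^op`
is identified with the opposite of the right C*-algebra of `τ(Z)`. -/
def σ (U : UniversalTRO.{u} Z) (x : U.K) : U.K :=
  U.tro.morita (KZero.unop (KZero.map U.tro.opLeft (KZero.map U.opIso.left x)))

/-- The scale, the set of the classes in `K₀(Z)` of projections in `L(τ(Z))`. -/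
def scale (U : UniversalTRO.{u} Z) : Set U.K :=
  {g | ∃ (p : U.tro.left) (h : p * p = p) (h' : star p = p), g = KZero.ofProjection p h h'}

/-- The set `Δ⁺(Z)` of the classes in `K₀(Z)` of the projections `ρ(u) ρ(u)*`, for the tripotents
`u` of `Z`. -/
def deltaPlus (U : UniversalTRO.{u} Z) : Set U.K :=
  {g | ∃ (p : U.tro.left) (h : p * p = p) (h' : star p = p), g = KZero.ofProjection p h h' ∧
    ∃ u : Z, triple u u u = u ∧
      (p : U.Ambient) = (U.ρ.toFun u : U.Ambient) * star (U.ρ.toFun u : U.Ambient)}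

/-- The set `Δ⁻(Z)` of the classes in `K₀(Z)` of the projections `w w*`, for the tripotents `w` of
`Z⁻ = {w ∈ τ(Z) | Φ w = -w}`. -/
def deltaMinus (U : UniversalTRO.{u} Z) : Set U.K :=
  {g | ∃ (p : U.tro.left) (h : p * p = p) (h' : star p = p), g = KZero.ofProjection p h h' ∧
    ∃ w : U.tro, U.anti w = -w ∧ triple w w w = w ∧
      (p : U.Ambient) = (w : U.Ambient) * star (w : U.Ambient)}

end UniversalTRO

/-! ### Unitary equivalence -/

/-- `u` is a unitary element of the algebra `R` (which then has the unit `u* u = u u*`). -/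
def IsUnitaryElement {R : Type*} [NonUnitalRing R] [StarRing R] (u : R) : Prop :=
  ∀ b : R, star u * u * b = b ∧ u * star u * b = b ∧ b * (star u * u) = b ∧ b * (u * star u) = b

/-- TRO-morphisms `φ, ψ : T → S` are unitarily equivalent if `φ x = V (ψ x) U` for some unitaries
`U` of `R(S)` and `V` of `L(S)`. -/
def TROHom.UnitarilyEquivalent {A B : Type*} [NonUnitalCStarAlgebra A] [NonUnitalCStarAlgebra B]
    {T : TRO A} {S : TRO B} (φ ψ : TROHom T S) : Prop :=
  ∃ (U : S.right) (V : S.left), IsUnitaryElement U ∧ IsUnitaryElement V ∧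
    ∀ x : T, (φ x : B) = (V : B) * (ψ x : B) * (U : B)

end

universe u v w

/-!
The three kinds of factors are treated at once. Divide a finite index set `R` into blocks, let
`swap` be an involution on the set of blocks and let `sign = ±1` be a function on it which is
invariant under `swap`. These data form a `Pattern`. The matrices over `R` which map, for every
block `i`, the block `swap i` to the block `i` form a TRO, and the conditions
`X b a = sign (blk a) * X a b` cut out a triple in it. A block that is fixed by `swap` contributes a
hermitian or a symplectic factor, according to its sign, and two blocks exchanged by `swap`
contribute a rectangular factor, in which `a` is encoded by the symmetric matrix with the corners
`a` and `aᵀ`. Every principal triple has this form (`Pattern.exists_model`).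

*Universality.* The TRO of all patterned matrices is a universal TRO of the triple
(`Pattern.Model.universal`). The images `u a b` of the symmetrized matrix units
`E a b + sign • E b a` under a triple morphism satisfy the relations of a `Grid`. For
`d ≠ a, b` the Peirce component `u a d * star (u a d) * u a b` of `u a b` is the candidate for the
image of `E a b` itself. It does not depend on `d`, because it can also be described by a right
multiplication (`Grid.quadrangle`), which needs symplectic factors of order at least `5` and
rectangular factors that are not Hilbert spaces; in a hermitian factor the images of the diagonal
matrix units take over the role of `u a d`. The components multiply like matrix units
(`Grid.unit_tern`, `Grid.unit_tern_of_herm`), so that they define a TRO-morphism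
(`Grid.exists_hom`). It is unique since the triple generates the TRO.

*Coordinates.* The left C*-algebra of the TRO of patterned matrices is the algebra of block diagonal
matrices. Since projections of equal trace are equivalent, `K₀` embeds by the traces of the blocks
(`BlockCoordinates.eq_of_dim_eq`), and the classes of the matrix units form a basis of `K₀` dual to
these traces. A pair of traces which agree on `x x*` and `x* x` extends to the linking algebra, and
this shows that the canonical involution permutes the traces of the blocks by `swap`
(`Pattern.Model.dim_σ`).

*Existence.* In these coordinates `γ` is a matrix `c j i` of integers. The scale being preserved,
they are non-negative and `∑ i, c j i * card (block i) ≤ card (block j)`, and compatibility with the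
canonical involutions says that `c` is invariant under `swap`. If the blocks `i` and `j` are fixed
by `swap` and have opposite signs, then `c j i` is the rank of a skew-symmetric partial isometry,
because `Δ⁺` and `Δ⁻` are preserved; hence it is even (`Matrix.exists_trace_eq_two_mul_of_skew`).
Conversely, such a matrix is realized by `X ↦ ∑ ω κ • H κ * X * (H (τ κ))ᴴ`, where `c j i` of the
partial isometries `H κ` embed the block `i` into the block `j`, and where `τ` is an involution on
the set of all the `κ` which lies over `swap`. The parity is what allows `τ` to have no fixed points
where the signs are opposite, so that signs `ω` can be chosen for which this morphism commutes with
the canonical involutions (`Pattern.exists_amplification`) and restricts to the triples.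

*Uniqueness.* Two morphisms with the same map on `K₀` send matrix units to partial isometries with
the same ranks in every block. The left supports of the images of one matrix unit for each block are
therefore equivalent. Transporting these equivalences along the matrix units produces partial
unitaries between the supports of the two images, and these extend to block diagonal unitaries by
finite dimension (`Pattern.exists_unitary_of_blockTrace_eq`).
-/

/-! ### Morphisms of TROs and of their left and right algebras -/

noncomputable section

open TripleProduct

theorem TRO.star_mem_conj {A : Type*} [NonUnitalCStarAlgebra A] (T : TRO A) {x : A}
    (hx : x ∈ T.toSubmodule) : star x ∈ T.conj.toSubmodule :=
  (congrArg (· ∈ T.toSubmodule) (star_star x)).mpr hx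

namespace TROHom

variable {A B C : Type*} [NonUnitalCStarAlgebra A] [NonUnitalCStarAlgebra B]
  [NonUnitalCStarAlgebra C] {T : TRO A} {S : TRO B} {W : TRO C}

theorem coe_map_tern (φ : TROHom T S) (x y z : T) :
    (φ (T.tern x y z) : B) = (φ x : B) * star (φ y : B) * (φ z : B) :=
  congrArg Subtype.val (φ.map_tern x y z)

@[ext] theorem ext' {φ ψ : TROHom T S} (h : ∀ x, φ x = ψ x) : φ = ψ := by
  cases φ; cases ψ
  congr
  exact ContinuousLinearMap.ext h

/-- The identity morphism of a TRO. -/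
def id (T : TRO A) : TROHom T T where
  toContinuousLinearMap := ContinuousLinearMap.id ℂ T
  map_tern' _ _ _ := rfl

/-- Composition of TRO-morphisms. -/
def comp (g : TROHom S W) (f : TROHom T S) : TROHom T W where
  toContinuousLinearMap := g.toContinuousLinearMap.comp f.toContinuousLinearMap
  map_tern' x y z := (congrArg g (f.map_tern x y z)).trans (g.map_tern _ _ _)

theorem map_triple (φ : TROHom T S) (x y z : T) :
    φ (triple x y z) = triple (φ x) (φ y) (φ z) := by
  change φ ((1 / 2 : ℂ) • (T.tern x y z + T.tern z y x)) =
    (1 / 2 : ℂ) • (S.tern _ _ _ + S.tern _ _ _)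
  rw [map_smul, map_add, φ.map_tern, φ.map_tern]

/-- A TRO-morphism, viewed as a JB*-morphism. -/
def toJBHom (φ : TROHom T S) : JBHom T S where
  toContinuousLinearMap := φ.toContinuousLinearMap
  map_triple' := φ.map_triple

/-- The TRO-morphism `x* ↦ φ(x)*` between the conjugate TROs. -/
def conj (φ : TROHom T S) : TROHom T.conj S.conj where
  toFun x := ⟨star (φ ⟨star (x : A), x.2⟩ : B), S.star_mem_conj (φ _).2⟩
  map_add' x y := by
    apply Subtype.ext
    change star (φ _ : B) = star (φ _ : B) + star (φ _ : B)
    rw [← star_add]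
    congr 1
    rw [← Submodule.coe_add, ← map_add]
    congr 2
    exact Subtype.ext (star_add _ _)
  map_smul' c x := by
    apply Subtype.ext
    change star (φ _ : B) = c • star (φ _ : B)
    rw [← star_star c, ← star_smul]
    congr 1
    rw [← Submodule.coe_smul, ← map_smul]
    congr 2
    apply Subtype.ext
    change star (star (star c) • (x : A)) = star c • star (x : A)
    rw [star_smul, star_star]
  cont := by
    refine Continuous.subtype_mk ?_ _
    exact continuous_star.comp (continuous_subtype_val.comp
      (φ.toContinuousLinearMap.continuous.comp
        ((continuous_star.comp continuous_subtype_val).subtype_mk _)))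
  map_tern' x y z := by
    apply Subtype.ext
    change star (φ _ : B) = star (φ _ : B) * star (star (φ _ : B)) * star (φ _ : B)
    rw [← star_mul, ← star_mul, ← mul_assoc, ← coe_map_tern]
    congr 3
    apply Subtype.ext
    change star ((x : A) * star (y : A) * (z : A)) = star (z : A) * star (star (y : A)) * star (x : A)
    simp [mul_assoc]

theorem coe_conj (φ : TROHom T S) {x : A} (hx : x ∈ T.toSubmodule) (hx' : star x ∈ T.conj.toSubmodule) :
    (φ.conj ⟨star x, hx'⟩ : B) = star (φ ⟨x, hx⟩ : B) := by
  change star (φ _ : B) = _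
  congr 3
  exact Subtype.ext (star_star x)

/-- The TRO-morphism between opposite TROs with the same underlying map. -/
def op (φ : TROHom T S) : TROHom T.op S.op where
  toFun x := ⟨MulOpposite.op (φ ⟨(x : Aᵐᵒᵖ).unop, x.2⟩ : B), (φ ⟨(x : Aᵐᵒᵖ).unop, x.2⟩).2⟩
  map_add' x y := Subtype.ext (congrArg (fun t : S => MulOpposite.op (t : B))
    (map_add φ.toContinuousLinearMap ⟨(x : Aᵐᵒᵖ).unop, x.2⟩ ⟨(y : Aᵐᵒᵖ).unop, y.2⟩))
  map_smul' c x := Subtype.ext (congrArg (fun t : S => MulOpposite.op (t : B))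
    (map_smul φ.toContinuousLinearMap c ⟨(x : Aᵐᵒᵖ).unop, x.2⟩))
  cont := by
    refine Continuous.subtype_mk ?_ _
    exact MulOpposite.continuous_op.comp (continuous_subtype_val.comp
      (φ.toContinuousLinearMap.continuous.comp
        ((MulOpposite.continuous_unop.comp continuous_subtype_val).subtype_mk _)))
  map_tern' x y z := by
    apply Subtype.ext
    apply MulOpposite.unop_injective
    change (φ _ : B) = (φ ⟨(z : Aᵐᵒᵖ).unop, z.2⟩ : B) * (star (φ ⟨(y : Aᵐᵒᵖ).unop, y.2⟩ : B) *
      (φ ⟨(x : Aᵐᵒᵖ).unop, x.2⟩ : B))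
    rw [← mul_assoc, ← coe_map_tern]
    congr 2
    apply Subtype.ext
    change (z : Aᵐᵒᵖ).unop * (star (y : Aᵐᵒᵖ).unop * (x : Aᵐᵒᵖ).unop) = _ * _ * _
    rw [mul_assoc]

/-- `L(φ)` is compatible with the left module structures. -/
theorem left_mul (φ : TROHom T S) (a : T.left) (x : T) :
    (φ ⟨(a : A) * (x : A), T.left_mul_mem a.2 x.2⟩ : B) = (φ.left a : B) * (φ x : B) := by
  obtain ⟨y, hy, hy'⟩ := φ.graph.left_mul_mem (φ.leftFun_mem a)
    (x := ((x : A), (φ x : B))) ⟨x, rfl, rfl⟩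
  have : y = ⟨(a : A) * (x : A), T.left_mul_mem a.2 x.2⟩ := Subtype.ext hy
  rw [← this, hy']
  rfl

/-- The *-homomorphism `R(T) → R(S)` with `x* y ↦ φ(x)* φ(y)`. -/
def right (φ : TROHom T S) : T.right →⋆ₙₐ[ℂ] S.right := φ.conj.left

theorem right_star_mul (φ : TROHom T S) (x y : T) :
    (φ.right ⟨star (x : A) * (y : A), T.star_mul_mem_right x.2 y.2⟩ : B) =
      star (φ x : B) * (φ y : B) := by
  have h := φ.conj.left_mul_star ⟨_, T.star_mem_conj x.2⟩ ⟨_, T.star_mem_conj y.2⟩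
  rw [φ.coe_conj x.2, φ.coe_conj y.2] at h
  refine Eq.trans ?_ (h.trans (congrArg (star (φ x : B) * ·) (star_star (φ y : B))))
  refine congrArg (fun t : T.conj.left => (φ.conj.left t : B)) (Subtype.ext ?_)
  exact congrArg (star (x : A) * ·) (star_star (y : A)).symm

/-- `R(φ)` is compatible with the right module structures. -/
theorem mul_right (φ : TROHom T S) (x : T) (b : T.right) :
    (φ ⟨(x : A) * (b : A), T.mul_right_mem x.2 b.2⟩ : B) = (φ x : B) * (φ.right b : B) := by
  let b' : T.conj.left := b
  have h := congrArg star (φ.conj.left_mul (star b') ⟨_, T.star_mem_conj x.2⟩)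
  rw [φ.coe_conj x.2, star_mul, star_star, map_star φ.conj.left b'] at h
  refine Eq.trans ?_ (h.trans (congrArg ((φ x : B) * ·) (star_star (φ.conj.left b' : B))))
  refine Eq.trans ?_ (star_star _).symm
  refine congrArg (fun t : T => (φ t : B)) (Subtype.ext ?_)
  change (x : A) * (b : A) = star (star (b : A) * star (x : A))
  simp

/-- An element of `L(T)` with image zero annihilates `T`, hence `L(T)`. -/
theorem left_injective (φ : TROHom T S) (h : Function.Injective φ) :
    Function.Injective φ.left := by
  rw [injective_iff_map_eq_zero]
  intro a ha
  have h1 : ∀ x ∈ T.toSubmodule, (a : A) * x = 0 := by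
    intro x hx
    have := φ.left_mul a ⟨x, hx⟩
    rw [ha] at this
    have h0 : φ ⟨(a : A) * x, T.left_mul_mem a.2 hx⟩ = 0 := Subtype.ext (by
      rw [this]; exact zero_mul _)
    have h0' := h (h0.trans (map_zero φ.toContinuousLinearMap).symm)
    exact congrArg Subtype.val h0'
  have h2 : ∀ b ∈ T.left, (a : A) * b = 0 := by
    refine T.left_induction (p := fun b => (a : A) * b = 0) ?_ ?_ ?_ ?_ ?_ ?_
    · exact isClosed_eq (continuous_const_mul _) continuous_const
    · intro x hx y _
      rw [← mul_assoc, h1 x hx, zero_mul]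
    · exact mul_zero _
    · intro b c hb hc; rw [mul_add, hb, hc, add_zero]
    · intro b c hb _; rw [← mul_assoc, hb, zero_mul]
    · intro c b hb; rw [mul_smul_comm, hb, smul_zero]
  exact Subtype.ext ((CStarRing.mul_star_self_eq_zero_iff _).mp (h2 _ (star_mem a.2)))

theorem conj_injective (φ : TROHom T S) (h : Function.Injective φ) :
    Function.Injective φ.conj := by
  intro x y hxy
  have h1 : star (φ ⟨star (x : A), x.2⟩ : B) = star (φ ⟨star (y : A), y.2⟩ : B) :=
    congrArg Subtype.val hxy
  have h2 := h (Subtype.ext (star_injective h1))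
  exact Subtype.ext (star_injective (congrArg Subtype.val h2))

end TROHom

end

/-! ### Projections in matrix algebras -/

noncomputable section

namespace Matrix

variable {α β ι : Type*} [Fintype α] [Fintype β]

/-- A projection is `A Aᴴ` for an isometry `A`, whose number of columns is the trace. -/
theorem exists_isometry_of_projection [DecidableEq α] {P : Matrix α α ℂ} (h : P * P = P)
    (h' : Pᴴ = P) : ∃ (k : ℕ) (A : Matrix α (Fin k) ℂ), Aᴴ * A = 1 ∧ A * Aᴴ = P ∧ P.trace = k := by
  obtain ⟨U, d, hUU, hUU', hD⟩ : ∃ (U : Matrix α α ℂ) (d : α → ℂ), Uᴴ * U = 1 ∧ U * Uᴴ = 1 ∧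
      Uᴴ * P * U = diagonal d := by
    have hP : P.IsHermitian := h'
    refine ⟨hP.eigenvectorUnitary, fun a => hP.eigenvalues a, Unitary.coe_star_mul_self _,
      Unitary.coe_mul_star_self _, ?_⟩
    have := hP.conjStarAlgAut_star_eigenvectorUnitary
    rw [Unitary.conjStarAlgAut_star_apply] at this
    exact this
  have hPD : P = U * diagonal d * Uᴴ := by
    rw [← hD]
    calc P = (U * Uᴴ) * P * (U * Uᴴ) := by rw [hUU']; simp
      _ = _ := by simp only [Matrix.mul_assoc]
  have hev : ∀ a, d a = 0 ∨ d a = 1 := by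
    intro a
    have h2 : diagonal d * diagonal d
        = diagonal d := by
      rw [← hD]
      calc Uᴴ * P * U * (Uᴴ * P * U) = Uᴴ * P * (U * Uᴴ) * P * U := by
            simp only [Matrix.mul_assoc]
        _ = Uᴴ * (P * P) * U := by rw [hUU']; simp [Matrix.mul_assoc]
        _ = _ := by rw [h]
    have h3 := congrFun (congrFun h2 a) a
    rw [diagonal_mul_diagonal, diagonal_apply_eq, diagonal_apply_eq] at h3
    have h4 : d a * (d a - 1) = 0 := by
      rw [mul_sub, h3]; ring
    rcases mul_eq_zero.mp h4 with h5 | h5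
    · exact Or.inl h5
    · exact Or.inr (sub_eq_zero.mp h5)
  -- the columns of `A` are the eigenvectors for the eigenvalue `1`
  classical
  let κ := {a : α // d a = 1}
  let e : Fin (Fintype.card κ) ≃ κ := (Fintype.equivFin κ).symm
  let A : Matrix α (Fin (Fintype.card κ)) ℂ := U.submatrix id (fun j => (e j : α))
  have h1 : Aᴴ * A = 1 := by
    have : Aᴴ * A = (Uᴴ * U).submatrix (fun j => (e j : α)) (fun j => (e j : α)) := by
      ext i j; simp [A, Matrix.mul_apply]
    rw [this, hUU]
    exact submatrix_one _ (Subtype.val_injective.comp e.injective)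
  have h2 : A * Aᴴ = P := by
    ext i j
    have h3 : ∑ c, A i c * Aᴴ c j = ∑ c : κ, U i c * Uᴴ c j :=
      e.sum_comp (fun c : κ => U i c * Uᴴ c j)
    rw [hPD, Matrix.mul_apply, Matrix.mul_apply, h3,
      ← Finset.sum_subtype (p := fun a => d a = 1) (Finset.univ.filter (d · = 1)) (by simp)
        (fun c => U i c * Uᴴ c j), Finset.sum_filter]
    refine Finset.sum_congr rfl fun c _ => ?_
    rw [Matrix.mul_diagonal]
    rcases hev c with hc | hc <;> simp [hc]
  refine ⟨_, A, h1, h2, ?_⟩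
  rw [← h2, Matrix.trace_mul_comm, h1]
  simp

open scoped ComplexOrder in
/-- A matrix whose left support is a projection is a partial isometry. -/
theorem mul_conjTranspose_mul_of_isProj {V : Matrix α β ℂ} (h : V * Vᴴ * (V * Vᴴ) = V * Vᴴ) :
    V * Vᴴ * V = V := by
  rw [← sub_eq_zero, ← self_mul_conjTranspose_eq_zero]
  have h1 : V * Vᴴ * V * (V * Vᴴ * V)ᴴ = V * Vᴴ := by
    simp only [conjTranspose_mul, conjTranspose_conjTranspose, Matrix.mul_assoc] at h ⊢
    rw [h, h]
  have h2 : V * Vᴴ * V * Vᴴ = V * Vᴴ := by rw [Matrix.mul_assoc _ V, h]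
  have h3 : V * (V * Vᴴ * V)ᴴ = V * Vᴴ := by
    simp only [conjTranspose_mul, conjTranspose_conjTranspose, Matrix.mul_assoc] at h ⊢
    exact h
  rw [conjTranspose_sub, Matrix.sub_mul, Matrix.mul_sub, Matrix.mul_sub, h1, h2, h3]
  simp

/-- Projections of equal trace are Murray-von Neumann equivalent. -/
theorem exists_partialIsometry_of_trace_eq [DecidableEq α] [DecidableEq β] {P : Matrix α α ℂ}
    {Q : Matrix β β ℂ} (hP : P * P = P) (hP' : Pᴴ = P) (hQ : Q * Q = Q) (hQ' : Qᴴ = Q)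
    (h : P.trace = Q.trace) : ∃ V : Matrix α β ℂ, V * Vᴴ = P ∧ Vᴴ * V = Q := by
  obtain ⟨k, A, hA1, hA2, hk⟩ := exists_isometry_of_projection hP hP'
  obtain ⟨l, B, hB1, hB2, hl⟩ := exists_isometry_of_projection hQ hQ'
  obtain rfl : k = l := by
    rw [hk, hl] at h; exact_mod_cast h
  refine ⟨A * Bᴴ, ?_, ?_⟩
  · rw [conjTranspose_mul, conjTranspose_conjTranspose, Matrix.mul_assoc, ← Matrix.mul_assoc Bᴴ,
      hB1, Matrix.one_mul, hA2]
  · rw [conjTranspose_mul, conjTranspose_conjTranspose, Matrix.mul_assoc, ← Matrix.mul_assoc Aᴴ,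
      hA1, Matrix.one_mul, hB2]

/-- A skew-symmetric partial isometry has even rank: compressed to its support, it becomes an
invertible skew-symmetric matrix. -/
theorem exists_trace_eq_two_mul_of_skew [DecidableEq α] {w : Matrix α α ℂ} (h : wᵀ = -w)
    (h' : w * wᴴ * w = w) : ∃ n : ℕ, (w * wᴴ).trace = 2 * n := by
  obtain ⟨k, A, hA1, hA2, hk⟩ := exists_isometry_of_projection (P := w * wᴴ)
    (by rw [← Matrix.mul_assoc, h']) (by simp)
  let Ac : Matrix α (Fin k) ℂ := Aᴴᵀ
  let B : Matrix (Fin k) (Fin k) ℂ := Aᴴ * w * Ac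
  have hBt : Bᵀ = -B := by
    simp only [B, Ac, transpose_mul, transpose_transpose, h]
    simp [Matrix.mul_assoc]
  -- `w Ā Aᵀ = w`, since `Ā Aᵀ` is the entrywise conjugate of `w wᴴ`, which equals `wᴴ w`
  have hcc : w * (Ac * Acᴴ) = w := by
    have h1 : Ac * Acᴴ = (A * Aᴴ)ᵀ := by
      simp only [Ac, transpose_mul]
      congr 1
      ext i j; simp
    have h2 : wᴴᵀ = -wᴴ := by
      have := congrArg conjTranspose h
      rw [conjTranspose_neg] at this
      rw [← this]; rfl
    rw [h1, hA2, transpose_mul, h, h2, neg_mul_neg, ← Matrix.mul_assoc, h']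
  have hBB : B * Bᴴ = 1 := by
    calc B * Bᴴ = Aᴴ * (w * (Ac * Acᴴ)) * wᴴ * A := by
          simp only [B, conjTranspose_mul, conjTranspose_conjTranspose, Matrix.mul_assoc]
      _ = (Aᴴ * A) * (Aᴴ * A) := by
          rw [hcc, Matrix.mul_assoc Aᴴ, ← hA2]; simp only [Matrix.mul_assoc]
      _ = 1 := by rw [hA1, Matrix.one_mul]
  have hdet : B.det ≠ 0 := by
    intro h0
    have := congrArg det hBB
    rw [det_mul, h0, zero_mul, det_one] at this
    exact zero_ne_one this
  have hk2 : Even k := by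
    by_contra hodd
    rw [Nat.not_even_iff_odd] at hodd
    have h1 := congrArg det hBt
    rw [det_transpose, det_neg, Fintype.card_fin, hodd.neg_one_pow] at h1
    apply hdet
    linear_combination (1 / 2 : ℂ) * h1
  obtain ⟨n, hn⟩ := hk2
  refine ⟨n, ?_⟩
  rw [hk, hn]; push_cast; ring

/-- A matrix is block diagonal with respect to a labelling of its rows and columns by blocks. -/
def IsBlockDiag (f : α → ι) (g : β → ι) (V : Matrix α β ℂ) : Prop :=
  ∀ a b, f a ≠ g b → V a b = 0

/-- The trace of the block with label `i`. -/
def blockTrace [DecidableEq ι] (f : α → ι) (i : ι) (X : Matrix α α ℂ) : ℂ :=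
  ∑ a, if f a = i then X a a else 0

/-- The projection onto the block with label `i`. -/
def blockProj [DecidableEq α] [DecidableEq ι] (f : α → ι) (i : ι) : Matrix α α ℂ :=
  diagonal fun a => if f a = i then 1 else 0

variable [DecidableEq ι]

theorem blockProj_mul_self [DecidableEq α] (f : α → ι) (i : ι) :
    blockProj f i * blockProj f i = blockProj f i := by
  rw [blockProj, diagonal_mul_diagonal]; congr 1; ext a; split_ifs <;> simp

theorem blockProj_mul_of_ne [DecidableEq α] (f : α → ι) {i j : ι} (h : i ≠ j) :
    blockProj f i * blockProj f j = 0 := by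
  rw [blockProj, blockProj, diagonal_mul_diagonal, ← diagonal_zero]; congr 1; ext a
  split_ifs with h1 h2 <;> simp
  exact h (h1.symm.trans h2)

omit [Fintype α] in
@[simp] theorem conjTranspose_blockProj [DecidableEq α] (f : α → ι) (i : ι) :
    (blockProj f i)ᴴ = blockProj f i := by
  rw [blockProj, diagonal_conjTranspose]; congr 1; ext a
  simp only [Pi.star_apply]; split_ifs <;> simp

omit [Fintype α] in
theorem sum_blockProj [DecidableEq α] [Fintype ι] (f : α → ι) :
    ∑ i, blockProj f i = 1 := by
  ext a b
  rw [Matrix.sum_apply]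
  by_cases h : a = b
  · subst h; simp [blockProj]
  · simp [blockProj, h]

theorem trace_mul_blockProj [DecidableEq α] (f : α → ι) (i : ι) (X : Matrix α α ℂ) :
    (X * blockProj f i).trace = blockTrace f i X := by
  simp [Matrix.trace, blockProj, blockTrace]

theorem IsBlockDiag.mul_blockProj [DecidableEq α] [DecidableEq β] {f : α → ι} {g : β → ι}
    {X : Matrix α β ℂ} (h : IsBlockDiag f g X) (i : ι) :
    X * blockProj g i = blockProj f i * X := by
  ext a b
  rw [blockProj, blockProj, mul_diagonal, diagonal_mul]
  by_cases hab : f a = g b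
  · rw [hab, mul_comm]
  · rw [h a b hab]; simp

theorem IsBlockDiag.of_mul_blockProj [DecidableEq α] [DecidableEq β] {f : α → ι} {g : β → ι}
    {X : Matrix α β ℂ} (h : ∀ i, X * blockProj g i = blockProj f i * X) : IsBlockDiag f g X := by
  intro a b hab
  have h1 := congrFun (congrFun (h (f a)) a) b
  rw [blockProj, blockProj, mul_diagonal, diagonal_mul] at h1
  simpa [Ne.symm hab] using h1.symm

/-- Block diagonal projections whose blocks have the same traces are Murray-von Neumann
equivalent through a block diagonal partial isometry. -/
theorem exists_blockDiag_partialIsometry [DecidableEq α] [DecidableEq β] [Fintype ι] {f : α → ι}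
    {g : β → ι} {P : Matrix α α ℂ} {Q : Matrix β β ℂ} (hP : P * P = P) (hP' : Pᴴ = P)
    (hQ : Q * Q = Q) (hQ' : Qᴴ = Q) (hPb : IsBlockDiag f f P) (hQb : IsBlockDiag g g Q)
    (h : ∀ i, blockTrace f i P = blockTrace g i Q) :
    ∃ V : Matrix α β ℂ, V * Vᴴ = P ∧ Vᴴ * V = Q ∧ IsBlockDiag f g V := by
  have key : ∀ i, ∃ V : Matrix α β ℂ, V * Vᴴ = P * blockProj f i ∧ Vᴴ * V = Q * blockProj g i := by
    intro i
    apply exists_partialIsometry_of_trace_eq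
    · rw [Matrix.mul_assoc, ← Matrix.mul_assoc _ P, ← hPb.mul_blockProj, Matrix.mul_assoc,
        blockProj_mul_self, ← Matrix.mul_assoc, hP]
    · rw [conjTranspose_mul, conjTranspose_blockProj, hP', hPb.mul_blockProj]
    · rw [Matrix.mul_assoc, ← Matrix.mul_assoc _ Q, ← hQb.mul_blockProj, Matrix.mul_assoc,
        blockProj_mul_self, ← Matrix.mul_assoc, hQ]
    · rw [conjTranspose_mul, conjTranspose_blockProj, hQ', hQb.mul_blockProj]
    · rw [trace_mul_blockProj, trace_mul_blockProj, h]
  choose V hV1 hV2 using key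
  have hPi : ∀ i, P * blockProj f i * (P * blockProj f i) = P * blockProj f i := fun i => by
    rw [Matrix.mul_assoc, ← Matrix.mul_assoc _ P, ← hPb.mul_blockProj, Matrix.mul_assoc,
      blockProj_mul_self, ← Matrix.mul_assoc, hP]
  have hPV : ∀ i, P * blockProj f i * V i = V i := fun i => by
    rw [← hV1]; exact mul_conjTranspose_mul_of_isProj (by rw [hV1, hPi])
  have hVQ : ∀ i, V i * (Q * blockProj g i) = V i := fun i => by
    rw [← hV2, ← Matrix.mul_assoc, hV1, hPV]
  have hfV : ∀ i, blockProj f i * V i = V i := fun i => by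
    conv_lhs => rw [← hPV, hPb.mul_blockProj, ← Matrix.mul_assoc, ← Matrix.mul_assoc,
      blockProj_mul_self]
    rw [← hPb.mul_blockProj, hPV]
  have hVg : ∀ i, V i * blockProj g i = V i := fun i => by
    conv_lhs => rw [← hVQ, Matrix.mul_assoc, Matrix.mul_assoc, blockProj_mul_self]
    rw [hVQ]
  have hVf0 : ∀ i j, i ≠ j → blockProj f i * V j = 0 := fun i j hij => by
    rw [← hfV j, ← Matrix.mul_assoc, blockProj_mul_of_ne f hij, Matrix.zero_mul]
  have hVg0 : ∀ i j, i ≠ j → V i * blockProj g j = 0 := fun i j hij => by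
    rw [← hVg i, Matrix.mul_assoc, blockProj_mul_of_ne g hij, Matrix.mul_zero]
  have h1 : ∀ i j, i ≠ j → V i * (V j)ᴴ = 0 := fun i j hij => by
    rw [← hVg j, conjTranspose_mul, conjTranspose_blockProj, ← Matrix.mul_assoc, hVg0 i j hij,
      Matrix.zero_mul]
  have h2 : ∀ i j, i ≠ j → (V i)ᴴ * V j = 0 := fun i j hij => by
    rw [← hfV i, conjTranspose_mul, conjTranspose_blockProj, Matrix.mul_assoc, hVf0 i j hij,
      Matrix.mul_zero]
  refine ⟨∑ i, V i, ?_, ?_, ?_⟩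
  · rw [conjTranspose_sum, Matrix.sum_mul]
    simp_rw [Matrix.mul_sum]
    rw [Finset.sum_congr rfl fun i _ => Finset.sum_eq_single i
      (fun j _ hj => h1 i j (Ne.symm hj)) (by simp)]
    simp_rw [hV1]
    rw [← Matrix.mul_sum, sum_blockProj, Matrix.mul_one]
  · rw [conjTranspose_sum, Matrix.sum_mul]
    simp_rw [Matrix.mul_sum]
    rw [Finset.sum_congr rfl fun i _ => Finset.sum_eq_single i
      (fun j _ hj => h2 i j (Ne.symm hj)) (by simp)]
    simp_rw [hV2]
    rw [← Matrix.mul_sum, sum_blockProj, Matrix.mul_one]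
  · apply IsBlockDiag.of_mul_blockProj
    intro i
    rw [Matrix.sum_mul, Matrix.mul_sum, Finset.sum_eq_single i (fun j _ hj => hVg0 j i hj) (by simp),
      Finset.sum_eq_single i (fun j _ hj => hVf0 i j (Ne.symm hj)) (by simp), hVg, hfV]

/-- The block traces of a block diagonal projection are the ranks of its blocks. -/
theorem exists_blockTrace_eq [DecidableEq α] {f : α → ι} {P : Matrix α α ℂ} (hP : P * P = P)
    (hP' : Pᴴ = P) (hPb : IsBlockDiag f f P) (i : ι) :
    ∃ n : ℕ, n ≤ (Finset.univ.filter (f · = i)).card ∧ blockTrace f i P = n := by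
  have h1 : P * blockProj f i * (P * blockProj f i) = P * blockProj f i := by
    rw [Matrix.mul_assoc, ← Matrix.mul_assoc _ P, ← hPb.mul_blockProj, Matrix.mul_assoc,
        blockProj_mul_self, ← Matrix.mul_assoc, hP]
  have h2 : (P * blockProj f i)ᴴ = P * blockProj f i := by
    rw [conjTranspose_mul, conjTranspose_blockProj, hP', hPb.mul_blockProj]
  obtain ⟨n, -, -, -, hn⟩ := exists_isometry_of_projection h1 h2
  -- the bound is the non-negativity of the rank of the complementary projection of the block
  have h3 : (blockProj f i - P * blockProj f i) * (blockProj f i - P * blockProj f i) =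
      blockProj f i - P * blockProj f i := by
    rw [sub_mul, mul_sub, mul_sub, h1, blockProj_mul_self, ← Matrix.mul_assoc,
      ← hPb.mul_blockProj, Matrix.mul_assoc, blockProj_mul_self]
    simp
  obtain ⟨m, -, -, -, hm⟩ := exists_isometry_of_projection h3
    (by rw [conjTranspose_sub, h2, conjTranspose_blockProj])
  refine ⟨n, ?_, by rw [← hn, trace_mul_blockProj]⟩
  rw [trace_sub, hn] at hm
  have h4 : (blockProj f i).trace = ((Finset.univ.filter (f · = i)).card : ℂ) := by
    simp [blockProj, Matrix.trace]
  rw [h4, sub_eq_iff_eq_add] at hm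
  have h5 : (Finset.univ.filter (f · = i)).card = m + n := by exact_mod_cast hm
  omega

end Matrix
end

/-! ### Traces on `K₀` -/

noncomputable section

namespace KZero

section Trace

variable {R S M : Type*} [NonUnitalRing R] [StarRing R] [NonUnitalRing S] [StarRing S]
  [AddCommGroup M]

/-- The class in `K₀(R)` of a projection in a matrix algebra over `R`. -/
def ofMatrix (p : MatrixProjection R) : KZero R :=
  Algebra.GrothendieckAddGroup.of (Quotient.mk _ p : ProjectionClass R)

theorem lift_of (g : ProjectionClass R →+ M) (x : ProjectionClass R) :
    Algebra.GrothendieckAddGroup.lift g (Algebra.GrothendieckAddGroup.of x) = g x :=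
  DFunLike.congr_fun (Algebra.GrothendieckAddGroup.lift.symm_apply_apply g) x

theorem map_ofMatrix [Module ℂ R] [Module ℂ S] (ψ : R →⋆ₙₐ[ℂ] S) (p : MatrixProjection R) :
    KZero.map ψ (ofMatrix p) = ofMatrix (p.map ψ) :=
  lift_of _ _

theorem unop_ofMatrix (p : MatrixProjection Rᵐᵒᵖ) : KZero.unop (ofMatrix p) = ofMatrix p.unop :=
  lift_of _ _

theorem ofMatrix_add (p q : MatrixProjection R) :
    ofMatrix p + ofMatrix q = ofMatrix (p.sum q) :=
  (map_add (Algebra.GrothendieckAddGroup.of (M := ProjectionClass R)) _ _).symm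

theorem exists_eq_of_sub_of {N : Type*} [AddCommMonoid N] (x : Algebra.GrothendieckAddGroup N) :
    ∃ a b : N, x = Algebra.GrothendieckAddGroup.of a - Algebra.GrothendieckAddGroup.of b := by
  induction x using AddLocalization.induction_on with
  | _ y =>
    obtain ⟨a, b, hb⟩ := y
    refine ⟨a, b, ?_⟩
    rw [eq_sub_iff_add_eq]
    change AddLocalization.mk a ⟨b, hb⟩ + AddLocalization.mk b 0 = AddLocalization.mk a 0
    rw [AddLocalization.mk_add, AddLocalization.mk_eq_mk_iff, AddLocalization.r_iff_exists]
    exact ⟨0, by simp [add_comm]⟩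

theorem exists_eq_sub (x : KZero R) : ∃ p q : MatrixProjection R, x = ofMatrix p - ofMatrix q := by
  obtain ⟨a, b, rfl⟩ := exists_eq_of_sub_of x
  induction a, b using Quotient.inductionOn₂ with
  | _ p q => exact ⟨p, q, rfl⟩

theorem hom_ext_of_ofMatrix {f g : KZero R →+ M} (h : ∀ p, f (ofMatrix p) = g (ofMatrix p)) :
    f = g := by
  ext x
  obtain ⟨p, q, rfl⟩ := exists_eq_sub x
  rw [map_sub, map_sub, h, h]

/-- The homomorphism on `K₀` induced by an additive map `t` with `t (v v*) = t (v* v)`. -/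
def ofTrace (t : R →+ M) (ht : ∀ v, t (v * star v) = t (star v * v)) : KZero R →+ M :=
  Algebra.GrothendieckAddGroup.lift
    { toFun := Quotient.lift (fun p : MatrixProjection R => ∑ k, t (p.mat k k)) (by
        rintro p q ⟨v, h1, h2⟩
        have e1 : ∀ k, t (p.mat k k) = ∑ l, t (star (v k l) * v k l) := fun k => by
          rw [← h1, Matrix.mul_apply, map_sum]
          exact Finset.sum_congr rfl fun l _ => ht _
        have e2 : ∀ l, t (q.mat l l) = ∑ k, t (star (v k l) * v k l) := fun l => by
          rw [← h2, Matrix.mul_apply, map_sum]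
          rfl
        change ∑ k, t (p.mat k k) = ∑ l, t (q.mat l l)
        simp_rw [e1, e2]
        exact Finset.sum_comm)
      map_zero' := by
        change ∑ k : Fin 0, _ = _
        simp
      map_add' := by
        intro a b
        induction a, b using Quotient.inductionOn₂ with
        | _ p q =>
          change ∑ k, t ((p.sum q).mat k k) = ∑ k, t (p.mat k k) + ∑ k, t (q.mat k k)
          rw [← (MatrixProjection.sumIndex p q).sum_comp, Fintype.sum_sum_type]
          have h := MatrixProjection.sum_submatrix p q
          congr 1
          · refine Finset.sum_congr rfl fun k _ => ?_
            exact congrArg t (congrFun (congrFun h (Sum.inl k)) (Sum.inl k))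
          · refine Finset.sum_congr rfl fun k _ => ?_
            exact congrArg t (congrFun (congrFun h (Sum.inr k)) (Sum.inr k)) }

theorem ofTrace_ofMatrix (t : R →+ M) (ht : ∀ v, t (v * star v) = t (star v * v))
    (p : MatrixProjection R) : ofTrace t ht (ofMatrix p) = ∑ k, t (p.mat k k) :=
  lift_of _ _

theorem ofTrace_ofProjection (t : R →+ M) (ht : ∀ v, t (v * star v) = t (star v * v))
    (p : R) (h : p * p = p) (h' : star p = p) : ofTrace t ht (ofProjection p h h') = t p := by
  refine (ofTrace_ofMatrix t ht (MatrixProjection.single p h h')).trans ?_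
  change ∑ k : Fin 1, t p = t p
  simp

theorem ofProjection_eq {p q : R} (hp : p * p = p) (hp' : star p = p) (hq : q * q = q)
    (hq' : star q = q) (v : R) (h1 : v * star v = p) (h2 : star v * v = q) :
    ofProjection p hp hp' = ofProjection q hq hq' := by
  refine congrArg Algebra.GrothendieckAddGroup.of (Quotient.sound ?_)
  refine ⟨Matrix.of fun _ _ => v, ?_, ?_⟩
  · ext i j
    change ∑ k : Fin 1, v * star v = p
    simp [h1]
  · ext i j
    change ∑ k : Fin 1, star v * v = q
    simp [h2]

theorem map_ofProjection [Module ℂ R] [Module ℂ S] (ψ : R →⋆ₙₐ[ℂ] S) (p : R) (h : p * p = p)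
    (h' : star p = p) : KZero.map ψ (ofProjection p h h') =
      ofProjection (ψ p) (by rw [← map_mul, h]) (by rw [← map_star, h']) :=
  lift_of _ _

end Trace

end KZero

/-- Coordinates of a *-algebra: an isomorphism with the algebra of block diagonal matrices, given
as an injective homomorphism `ψ` into the full matrix algebra. -/
structure BlockCoordinates (R : Type*) [NonUnitalRing R] [StarRing R] [Module ℂ R]
    {α ι : Type*} [Fintype α] (f : α → ι) where
  ψ : R →⋆ₙₐ[ℂ] Matrix α α ℂ
  injective : Function.Injective ψ
  isBlockDiag : ∀ a, Matrix.IsBlockDiag f f (ψ a)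
  exists_eq : ∀ X, Matrix.IsBlockDiag f f X → ∃ a, ψ a = X

namespace BlockCoordinates

variable {R : Type*} [NonUnitalRing R] [StarRing R] [Module ℂ R]
  {α ι : Type*} [Fintype α] {f : α → ι}

/-- A matrix over `R` as a matrix of complex numbers. -/
def flatten (c : BlockCoordinates R f) {m n : Type*} (v : Matrix m n R) :
    Matrix (m × α) (n × α) ℂ :=
  Matrix.of fun x y => c.ψ (v x.1 y.1) x.2 y.2

variable (c : BlockCoordinates R f)

theorem flatten_mul {l m n : Type*} [Fintype m] (v : Matrix l m R) (w : Matrix m n R) :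
    c.flatten (v * w) = c.flatten v * c.flatten w := by
  ext x y
  simp only [flatten, Matrix.of_apply, Matrix.mul_apply, map_sum, map_mul, Matrix.sum_apply,
    Fintype.sum_prod_type]

theorem flatten_conjTranspose {m n : Type*} (v : Matrix m n R) :
    c.flatten vᴴ = (c.flatten v)ᴴ := by
  ext x y
  simp only [flatten, Matrix.of_apply, Matrix.conjTranspose_apply, map_star]
  rfl

theorem flatten_injective {m n : Type*} :
    Function.Injective (c.flatten : Matrix m n R → Matrix (m × α) (n × α) ℂ) := by
  intro v w h
  ext i j
  apply c.injective
  ext a b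
  exact congrFun (congrFun h (i, a)) (j, b)

theorem isBlockDiag_flatten {m n : Type*} (v : Matrix m n R) :
    Matrix.IsBlockDiag (fun x : m × α => f x.2) (fun x : n × α => f x.2) (c.flatten v) :=
  fun _ _ h => c.isBlockDiag _ _ _ h

theorem exists_flatten_eq {m n : Type*} (X : Matrix (m × α) (n × α) ℂ)
    (h : Matrix.IsBlockDiag (fun x : m × α => f x.2) (fun x : n × α => f x.2) X) :
    ∃ v : Matrix m n R, c.flatten v = X := by
  have : ∀ i j, ∃ a, c.ψ a = Matrix.of fun x y => X (i, x) (j, y) :=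
    fun i j => c.exists_eq _ fun a b hab => h (i, a) (j, b) hab
  choose v hv using this
  refine ⟨Matrix.of v, ?_⟩
  ext ⟨i, a⟩ ⟨j, b⟩
  exact congrFun (congrFun (hv i j) a) b

variable [DecidableEq ι]

/-- The additive map which sends an element to the trace of one block. -/
def tr (i : ι) : R →+ ℂ where
  toFun a := Matrix.blockTrace f i (c.ψ a)
  map_zero' := by simp [Matrix.blockTrace]
  map_add' a b := by
    simp only [Matrix.blockTrace, map_add, Matrix.add_apply, ← Finset.sum_add_distrib]
    refine Finset.sum_congr rfl fun x _ => ?_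
    split_ifs <;> simp

theorem tr_apply (i : ι) (a : R) : c.tr i a = Matrix.blockTrace f i (c.ψ a) := rfl

theorem _root_.Matrix.blockTrace_mul_comm [DecidableEq α] {X Y : Matrix α α ℂ}
    (hX : Matrix.IsBlockDiag f f X) (i : ι) :
    Matrix.blockTrace f i (X * Y) = Matrix.blockTrace f i (Y * X) := by
  rw [← Matrix.trace_mul_blockProj, ← Matrix.trace_mul_blockProj, Matrix.mul_assoc Y,
    hX.mul_blockProj, ← Matrix.mul_assoc Y, Matrix.trace_mul_comm (Y * _), Matrix.mul_assoc,
    Matrix.trace_mul_comm X, Matrix.mul_assoc]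

variable [DecidableEq α]

theorem tr_mul_star (i : ι) (v : R) : c.tr i (v * star v) = c.tr i (star v * v) := by
  rw [tr_apply, tr_apply, map_mul, map_mul, Matrix.blockTrace_mul_comm (c.isBlockDiag v)]

/-- The rank of one block, as a homomorphism on `K₀`. -/
def dim (i : ι) : KZero R →+ ℂ := KZero.ofTrace (c.tr i) (c.tr_mul_star i)

theorem dim_ofProjection (i : ι) (p : R) (h : p * p = p) (h' : star p = p) :
    c.dim i (KZero.ofProjection p h h') = Matrix.blockTrace f i (c.ψ p) :=
  KZero.ofTrace_ofProjection _ _ _ _ _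

theorem dim_ofMatrix (i : ι) (p : MatrixProjection R) :
    c.dim i (KZero.ofMatrix p) =
      Matrix.blockTrace (fun x : Fin p.size × α => f x.2) i (c.flatten p.mat) := by
  rw [dim, KZero.ofTrace_ofMatrix, Matrix.blockTrace, Fintype.sum_prod_type]
  rfl

/-- Projections with the same block traces are equivalent. -/
theorem ofMatrix_eq_of_dim_eq [Fintype ι] {p q : MatrixProjection R}
    (h : ∀ i, c.dim i (KZero.ofMatrix p) = c.dim i (KZero.ofMatrix q)) : p ≈ q := by
  have hproj : ∀ p : MatrixProjection R, c.flatten p.mat * c.flatten p.mat = c.flatten p.mat ∧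
      (c.flatten p.mat)ᴴ = c.flatten p.mat := fun p =>
    ⟨by rw [← flatten_mul, p.mul_self], by rw [← flatten_conjTranspose, p.adjoint]⟩
  obtain ⟨V, h1, h2, h3⟩ := Matrix.exists_blockDiag_partialIsometry (hproj p).1 (hproj p).2
    (hproj q).1 (hproj q).2 (c.isBlockDiag_flatten p.mat) (c.isBlockDiag_flatten q.mat)
    (fun i => by rw [← dim_ofMatrix, ← dim_ofMatrix, h])
  obtain ⟨v, rfl⟩ := c.exists_flatten_eq V h3
  refine ⟨v, c.flatten_injective ?_, c.flatten_injective ?_⟩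
  · rw [flatten_mul, flatten_conjTranspose, h1]
  · rw [flatten_mul, flatten_conjTranspose, h2]

/-- An element of `K₀` is determined by its ranks in the blocks. -/
theorem eq_of_dim_eq [Fintype ι] {x y : KZero R} (h : ∀ i, c.dim i x = c.dim i y) : x = y := by
  obtain ⟨p, q, rfl⟩ := KZero.exists_eq_sub x
  obtain ⟨p', q', rfl⟩ := KZero.exists_eq_sub y
  rw [sub_eq_sub_iff_add_eq_add, KZero.ofMatrix_add, KZero.ofMatrix_add]
  refine congrArg Algebra.GrothendieckAddGroup.of (Quotient.sound (c.ofMatrix_eq_of_dim_eq ?_))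
  intro i
  have h1 := h i
  rw [map_sub, map_sub, sub_eq_sub_iff_add_eq_add] at h1
  rw [← KZero.ofMatrix_add, ← KZero.ofMatrix_add, map_add, map_add, h1]

theorem exists_dim_ofMatrix_eq (p : MatrixProjection R) (i : ι) :
    ∃ n : ℕ, c.dim i (KZero.ofMatrix p) = n := by
  obtain ⟨n, -, hn⟩ := Matrix.exists_blockTrace_eq (P := c.flatten p.mat)
    (by rw [← flatten_mul, p.mul_self]) (by rw [← flatten_conjTranspose, p.adjoint])
    (c.isBlockDiag_flatten p.mat) i
  exact ⟨n, by rw [dim_ofMatrix, hn]⟩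

/-- A family dual to the ranks generates `K₀`. -/
theorem exists_eq_sum [Fintype ι] {δ : ι → KZero R}
    (hδ : ∀ i j, c.dim j (δ i) = if i = j then 1 else 0) (x : KZero R) :
    ∃ n : ι → ℤ, x = ∑ i, n i • δ i ∧ ∀ i, c.dim i x = n i := by
  obtain ⟨p, q, hx⟩ := KZero.exists_eq_sub x
  choose a ha using c.exists_dim_ofMatrix_eq p
  choose b hb using c.exists_dim_ofMatrix_eq q
  have h1 : ∀ i, c.dim i x = ((a i - b i : ℤ) : ℂ) := fun i => by
    rw [hx, map_sub, ha, hb]; push_cast; rfl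
  refine ⟨fun i => a i - b i, c.eq_of_dim_eq fun j => ?_, h1⟩
  rw [h1, map_sum]
  simp [map_zsmul, hδ]

theorem hom_ext [Fintype ι] {M : Type*} [AddCommGroup M] {δ : ι → KZero R}
    (hδ : ∀ i j, c.dim j (δ i) = if i = j then 1 else 0) {φ φ' : KZero R →+ M}
    (h : ∀ i, φ (δ i) = φ' (δ i)) : φ = φ' := by
  ext x
  obtain ⟨n, rfl, -⟩ := c.exists_eq_sum hδ x
  simp [map_sum, map_zsmul, h]

end BlockCoordinates

end

/-! ### Patterned matrices -/

noncomputable section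

open TripleProduct
open scoped Matrix.Norms.L2Operator

/-- Data describing a triple of patterned matrices. The index set `R` is divided into blocks, and
`swap` is an involution on the set of blocks. A matrix has the pattern if its rows in the block `i`
are supported on the columns in the block `swap i`, and the triple consists of the matrices with
`X b a = sign (blk a) * X a b`. A fixed point of `swap` stands for a hermitian factor (sign `1`) or a
symplectic factor (sign `-1`), and a pair of blocks exchanged by `swap` for a rectangular factor, in
which the matrix `a` is encoded as the symmetric matrix with off-diagonal corners `a` and `aᵀ`. The
sizes required in `kind` are those of principal factors; a hermitian factor of order `1` does no
harm. -/
structure Pattern where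
  R : Type u
  ι : Type
  [fintypeR : Fintype R]
  [decR : DecidableEq R]
  [fintypeBlk : Fintype ι]
  [decBlk : DecidableEq ι]
  blk : R → ι
  swap : ι → ι
  sign : ι → ℂ
  swap_swap : ∀ i, swap (swap i) = i
  sign_eq : ∀ i, sign i = 1 ∨ sign i = -1
  sign_swap : ∀ i, sign (swap i) = sign i
  exists_blk_eq : ∀ i, ∃ a, blk a = i
  kind : ∀ i, (swap i = i ∧ sign i = 1) ∨
    (swap i = i ∧ sign i = -1 ∧ 5 ≤ (Finset.univ.filter (blk · = i)).card) ∨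
    (swap i ≠ i ∧ sign i = 1 ∧ 2 ≤ (Finset.univ.filter (blk · = i)).card)

namespace Pattern

attribute [instance] Pattern.fintypeR Pattern.decR Pattern.fintypeBlk Pattern.decBlk

variable (P : Pattern.{u})

/-- The positions at which a patterned matrix may have non-zero entries. -/
def Adj (a b : P.R) : Prop := P.blk b = P.swap (P.blk a)

instance (a b : P.R) : Decidable (P.Adj a b) := inferInstanceAs (Decidable (_ = _))

variable {P} in
theorem Adj.symm {a b : P.R} (h : P.Adj a b) : P.Adj b a := by
  unfold Adj at *; rw [h, P.swap_swap]

theorem sign_mul_self (i : P.ι) : P.sign i * P.sign i = 1 := by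
  rcases P.sign_eq i with h | h <;> rw [h] <;> norm_num

variable {P} in
theorem Adj.sign_eq {a b : P.R} (h : P.Adj a b) : P.sign (P.blk b) = P.sign (P.blk a) := by
  rw [h, P.sign_swap]

theorem star_sign (i : P.ι) : star (P.sign i) = P.sign i := by
  rcases P.sign_eq i with h | h <;> rw [h] <;> simp

theorem isClosed_vanishing (p : P.R → P.R → Prop) :
    IsClosed {X : Matrix P.R P.R ℂ | ∀ a b, p a b → X a b = 0} := by
  simp only [Set.ofPred_forall]
  exact isClosed_iInter fun a => isClosed_iInter fun b => isClosed_iInter fun _ =>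
    isClosed_eq (LinearMap.continuous_of_finiteDimensional (Matrix.entryLinearMap ℂ ℂ a b))
      continuous_const

/-- The TRO of all matrices with the given pattern. -/
def tro : TRO (Matrix P.R P.R ℂ) where
  carrier := {X | ∀ a b, ¬ P.Adj a b → X a b = 0}
  add_mem' {X Y} hX hY a b h := by simp [hX a b h, hY a b h]
  zero_mem' a b _ := rfl
  smul_mem' c X hX a b h := by simp [hX a b h]
  isClosed' := P.isClosed_vanishing fun a b => ¬ P.Adj a b
  tern_mem' X hX Y hY Z hZ a b h := by
    rw [Matrix.mul_apply]
    refine Finset.sum_eq_zero fun c _ => ?_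
    by_cases hc : P.Adj c b
    · rw [Matrix.mul_apply, Finset.sum_eq_zero fun d _ => ?_, zero_mul]
      by_cases h1 : P.Adj a d
      · rw [Matrix.star_apply, hY c d ?_, star_zero, mul_zero]
        intro h2
        apply h
        have h3 : P.blk c = P.swap (P.blk d) := h2.symm
        have h4 : P.blk d = P.swap (P.blk a) := h1
        rw [h4, P.swap_swap] at h3
        rw [Adj, hc, h3]
      · rw [hX a d h1, zero_mul]
    · rw [hZ c b hc, mul_zero]

variable {P} in
theorem mem_tro {X : Matrix P.R P.R ℂ} :
    X ∈ P.tro.toSubmodule ↔ ∀ a b, ¬ P.Adj a b → X a b = 0 := Iff.rfl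

theorem single_mem_tro {a b : P.R} (h : P.Adj a b) (x : ℂ) :
    Matrix.single a b x ∈ P.tro.toSubmodule := by
  intro c d hcd
  apply Matrix.single_apply_of_ne
  rintro ⟨rfl, rfl⟩
  exact hcd h

theorem exists_adj (a : P.R) : ∃ b, P.Adj a b := P.exists_blk_eq _

variable {P} in
theorem blk_eq_of_adj {a b c : P.R} (h : P.Adj a b) (h' : P.Adj c b) : P.blk a = P.blk c := by
  have h1 : P.blk a = P.swap (P.blk b) := h.symm
  have h2 : P.blk c = P.swap (P.blk b) := h'.symm
  rw [h1, h2]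

variable {P} in
theorem adj_of_blk_eq {a b c : P.R} (h : P.Adj a b) (h' : P.blk c = P.blk a) : P.Adj c b := by
  unfold Adj at *; rw [h, h']

/-- Block diagonal matrices are sums of products `X Y*` of patterned matrices. -/
theorem mem_closure_of_isBlockDiag {X : Matrix P.R P.R ℂ} (hX : Matrix.IsBlockDiag P.blk P.blk X) :
    X ∈ AddSubmonoid.closure {M | ∃ Y ∈ P.tro.toSubmodule, ∃ Y' ∈ P.tro.toSubmodule,
      Y * star Y' = M} := by
  rw [Matrix.matrix_eq_sum_single X]
  refine sum_mem fun a _ => sum_mem fun b _ => ?_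
  by_cases h : P.blk a = P.blk b
  · obtain ⟨c, hc⟩ := P.exists_adj a
    refine AddSubmonoid.subset_closure ⟨Matrix.single a c (X a b), P.single_mem_tro hc _,
      Matrix.single b c 1, P.single_mem_tro (adj_of_blk_eq hc h.symm) _, ?_⟩
    rw [Matrix.star_eq_conjTranspose, Matrix.conjTranspose_single, Matrix.single_mul_single_same]
    simp
  · rw [hX a b h, Matrix.single_zero]; exact zero_mem _

/-- The left C*-algebra consists of the block diagonal matrices. -/
theorem mem_left_iff {X : Matrix P.R P.R ℂ} :
    X ∈ P.tro.left ↔ Matrix.IsBlockDiag P.blk P.blk X := by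
  constructor
  · refine P.tro.left_induction (p := fun X => Matrix.IsBlockDiag P.blk P.blk X) ?_ ?_ ?_ ?_ ?_ ?_ X
    · exact P.isClosed_vanishing fun a b => P.blk a ≠ P.blk b
    · intro X hX Y hY a b hab
      rw [Matrix.mul_apply]
      refine Finset.sum_eq_zero fun c _ => ?_
      by_cases h1 : P.Adj a c
      · rw [Matrix.star_apply, hY b c fun h2 => hab (blk_eq_of_adj h1 h2), star_zero, mul_zero]
      · rw [hX a c h1, zero_mul]
    · intro a b _; rfl
    · intro X Y hX hY a b h; simp [hX a b h, hY a b h]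
    · intro X Y hX hY a b h
      rw [Matrix.mul_apply]
      refine Finset.sum_eq_zero fun c _ => ?_
      by_cases h1 : P.blk a = P.blk c
      · rw [hY c b (h1 ▸ h), mul_zero]
      · rw [hX a c h1, zero_mul]
    · intro c X hX a b h; simp [hX a b h]
  · intro hX
    refine (AddSubmonoid.closure_le (S := P.tro.left.toAddSubmonoid)).mpr ?_
      (P.mem_closure_of_isBlockDiag hX)
    rintro _ ⟨Y, hY, Y', hY', rfl⟩
    exact P.tro.mul_star_mem_left hY hY'

/-- Since adjacency is symmetric, the space of patterned matrices is closed under adjoints. -/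
theorem conj_tro : P.tro.conj = P.tro := by
  have : P.tro.conj.toSubmodule = P.tro.toSubmodule := by
    ext X
    change star X ∈ P.tro.toSubmodule ↔ _
    simp only [mem_tro, Matrix.star_apply, star_eq_zero]
    constructor
    · intro h a b hab; exact h b a fun h' => hab h'.symm
    · intro h a b hab; exact h b a fun h' => hab h'.symm
  cases h1 : P.tro.conj; cases h2 : P.tro
  rw [h1, h2] at this
  cases this
  rfl

theorem mem_right_iff {X : Matrix P.R P.R ℂ} :
    X ∈ P.tro.right ↔ Matrix.IsBlockDiag P.blk P.blk X := by
  rw [TRO.right, conj_tro, mem_left_iff]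

/-- The canonical involution `X ↦ D Xᵀ` of the patterned matrices, where `D` is the diagonal matrix
of the signs. -/
def anti (X : Matrix P.R P.R ℂ) : Matrix P.R P.R ℂ :=
  Matrix.of fun a b => P.sign (P.blk a) * X b a

theorem anti_apply (X : Matrix P.R P.R ℂ) (a b : P.R) :
    P.anti X a b = P.sign (P.blk a) * X b a := rfl

theorem anti_mem {X : Matrix P.R P.R ℂ} (hX : X ∈ P.tro.toSubmodule) :
    P.anti X ∈ P.tro.toSubmodule := by
  intro a b hab
  rw [anti_apply, hX b a fun h => hab h.symm, mul_zero]

theorem anti_eq (X : Matrix P.R P.R ℂ) :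
    P.anti X = Matrix.diagonal (fun a => P.sign (P.blk a)) * Xᵀ := by
  ext a b
  rw [anti_apply, Matrix.diagonal_mul, Matrix.transpose_apply]

theorem signDiag_mul_self : (Matrix.diagonal (fun a => P.sign (P.blk a)) : Matrix P.R P.R ℂ) *
    Matrix.diagonal (fun a => P.sign (P.blk a)) = 1 := by
  rw [Matrix.diagonal_mul_diagonal, ← Matrix.diagonal_one]
  congr 1; ext a; exact P.sign_mul_self _

theorem star_signDiag : star (Matrix.diagonal (fun a => P.sign (P.blk a)) : Matrix P.R P.R ℂ) =
    Matrix.diagonal (fun a => P.sign (P.blk a)) := by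
  rw [Matrix.star_eq_conjTranspose, Matrix.diagonal_conjTranspose]
  congr 1; ext a; exact P.star_sign _

/-- The involution of the patterned matrices, as a TRO-morphism to the opposite TRO. -/
def antiHom : TROHom P.tro P.tro.op where
  toContinuousLinearMap := LinearMap.toContinuousLinearMap
    { toFun := fun X => ⟨MulOpposite.op (P.anti X), P.anti_mem X.2⟩
      map_add' := fun X Y => Subtype.ext (congrArg MulOpposite.op (by
        ext a b; simp [anti_apply, mul_add]))
      map_smul' := fun c X => Subtype.ext (congrArg MulOpposite.op (by
        ext a b; simp [anti_apply]; ring)) }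
  map_tern' X Y Z := by
    apply Subtype.ext
    apply MulOpposite.unop_injective
    change P.anti ((X : Matrix P.R P.R ℂ) * star (Y : Matrix P.R P.R ℂ) * Z) =
      P.anti Z * (star (P.anti Y) * P.anti X)
    rw [anti_eq, anti_eq, anti_eq, anti_eq, star_mul, star_signDiag, Matrix.transpose_mul,
      Matrix.transpose_mul]
    have : (star (Y : Matrix P.R P.R ℂ))ᵀ = star (Y : Matrix P.R P.R ℂ)ᵀ := rfl
    have h2 : ∀ M : Matrix P.R P.R ℂ, Matrix.diagonal (fun a => P.sign (P.blk a)) *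
        (Matrix.diagonal (fun a => P.sign (P.blk a)) * M) = M := fun M => by
      rw [← Matrix.mul_assoc, signDiag_mul_self, Matrix.one_mul]
    rw [this]
    simp only [Matrix.mul_assoc, h2]

end Pattern

/-! ### Morphisms defined by matrix units -/

namespace Pattern

variable (P : Pattern.{u}) {B : Type*} [NonUnitalCStarAlgebra B]

/-- The linear map which sends the matrix unit at the position `(a, b)` to `l a * r b`. -/
def unitsFun (l r : P.R → B) (X : Matrix P.R P.R ℂ) : B := ∑ a, ∑ b, X a b • (l a * r b)

theorem unitsFun_add (l r : P.R → B) (X Y : Matrix P.R P.R ℂ) :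
    P.unitsFun l r (X + Y) = P.unitsFun l r X + P.unitsFun l r Y := by
  simp [unitsFun, add_smul, Finset.sum_add_distrib]

theorem unitsFun_smul (l r : P.R → B) (c : ℂ) (X : Matrix P.R P.R ℂ) :
    P.unitsFun l r (c • X) = c • P.unitsFun l r X := by
  simp [unitsFun, mul_smul, Finset.smul_sum]

theorem unitsFun_single (l r : P.R → B) (a b : P.R) (x : ℂ) :
    P.unitsFun l r (Matrix.single a b x) = x • (l a * r b) := by
  rw [unitsFun, Finset.sum_eq_single a, Finset.sum_eq_single b]
  · simp
  · intro c _ hc; rw [Matrix.single_apply_of_col_ne _ _ (Ne.symm hc), zero_smul]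
  · simp
  · intro c _ hc
    exact Finset.sum_eq_zero fun d _ => by
      rw [Matrix.single_apply_of_row_ne (Ne.symm hc), zero_smul]
  · simp

/-- The map on the left C*-algebras which belongs to `unitsFun`. Only the products of equal columns
survive on the left-hand side. -/
theorem unitsFun_mul_star {l r : P.R → B} {k : P.ι → B}
    (hr : ∀ b d, r b * star (r d) = if b = d then k (P.swap (P.blk b)) else 0)
    (hk : ∀ a, l a * k (P.blk a) = l a) {X : Matrix P.R P.R ℂ} (hX : X ∈ P.tro.toSubmodule)
    (Y : Matrix P.R P.R ℂ) : P.unitsFun l r X * star (P.unitsFun l r Y) =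
      ∑ a, ∑ c, (X * Yᴴ) a c • (l a * star (l c)) := by
  simp only [unitsFun, star_sum, star_smul, star_mul]
  rw [Finset.sum_mul]
  refine Finset.sum_congr rfl fun a _ => ?_
  rw [Finset.mul_sum]
  refine Finset.sum_congr rfl fun c _ => ?_
  rw [Finset.sum_mul, Matrix.mul_apply, Finset.sum_smul]
  refine Finset.sum_congr rfl fun b _ => ?_
  rw [Finset.mul_sum, Finset.sum_eq_single b]
  · rw [smul_mul_smul_comm, mul_assoc, ← mul_assoc (r b), hr, if_pos rfl, ← mul_assoc]
    by_cases h : P.Adj a b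
    · have h' : P.blk a = P.swap (P.blk b) := h.symm
      rw [← h', hk]; rfl
    · rw [hX a b h]; simp
  · intro d _ hd
    rw [smul_mul_smul_comm, mul_assoc, ← mul_assoc (r b), hr, if_neg (Ne.symm hd)]
    simp
  · simp

theorem unitsFun_tern {l r : P.R → B} {k : P.ι → B}
    (hl : ∀ a c, star (l a) * l c = if a = c then k (P.blk a) else 0)
    (hr : ∀ b d, r b * star (r d) = if b = d then k (P.swap (P.blk b)) else 0)
    (hk : ∀ a, l a * k (P.blk a) = l a) {X Y : Matrix P.R P.R ℂ} (hX : X ∈ P.tro.toSubmodule)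
    (hY : Y ∈ P.tro.toSubmodule) (Z : Matrix P.R P.R ℂ) :
    P.unitsFun l r (X * star Y * Z) =
      P.unitsFun l r X * star (P.unitsFun l r Y) * P.unitsFun l r Z := by
  rw [P.unitsFun_mul_star hr hk hX]
  rw [unitsFun, Finset.sum_mul]
  refine Finset.sum_congr rfl fun a _ => ?_
  have h1 : ∀ b, (X * star Y * Z) a b • (l a * r b) =
      ∑ c, ((X * star Y) a c * Z c b) • (l a * r b) := fun b => by
    rw [Matrix.mul_apply, Finset.sum_smul]
  rw [Finset.sum_congr rfl fun b _ => h1 b, Finset.sum_comm, Finset.sum_mul]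
  refine Finset.sum_congr rfl fun c _ => ?_
  rw [unitsFun, Finset.mul_sum]
  symm
  rw [Finset.sum_eq_single c]
  · rw [Finset.mul_sum]
    refine Finset.sum_congr rfl fun b _ => ?_
    rw [smul_mul_smul_comm, mul_assoc, ← mul_assoc (star _), hl, if_pos rfl, ← mul_assoc]
    by_cases h : P.blk a = P.blk c
    · rw [← h, hk]; rfl
    · have h0 : (X * star Y) a c = 0 :=
        P.mem_left_iff.mp (P.tro.mul_star_mem_left hX hY) a c h
      have h0' : (X * Yᴴ) a c = 0 := h0
      rw [h0, h0']; simp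
  · intro d _ hd
    rw [Finset.mul_sum]
    refine Finset.sum_eq_zero fun b _ => ?_
    rw [smul_mul_smul_comm, mul_assoc, ← mul_assoc (star _), hl, if_neg (Ne.symm hd)]
    simp
  · simp

/-- The TRO-morphism defined by a system of matrix units, factorized as products `l a * r b`. -/
def homOfUnits (S : TRO B) {l r : P.R → B} {k : P.ι → B}
    (hl : ∀ a c, star (l a) * l c = if a = c then k (P.blk a) else 0)
    (hr : ∀ b d, r b * star (r d) = if b = d then k (P.swap (P.blk b)) else 0)
    (hk : ∀ a, l a * k (P.blk a) = l a)
    (hS : ∀ a b, P.Adj a b → l a * r b ∈ S.toSubmodule) : TROHom P.tro S where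
  toContinuousLinearMap := LinearMap.toContinuousLinearMap
    { toFun := fun X => ⟨P.unitsFun l r X, by
        refine sum_mem fun a _ => sum_mem fun b _ => ?_
        by_cases h : P.Adj a b
        · exact S.toSubmodule.smul_mem _ (hS a b h)
        · rw [X.2 a b h, zero_smul]; exact zero_mem _⟩
      map_add' := fun X Y => Subtype.ext (P.unitsFun_add l r X Y)
      map_smul' := fun c X => Subtype.ext (P.unitsFun_smul l r c X) }
  map_tern' X Y Z := Subtype.ext (P.unitsFun_tern hl hr hk X.2 Y.2 Z)

theorem coe_homOfUnits (S : TRO B) {l r : P.R → B} {k : P.ι → B}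
    (hl : ∀ a c, star (l a) * l c = if a = c then k (P.blk a) else 0)
    (hr : ∀ b d, r b * star (r d) = if b = d then k (P.swap (P.blk b)) else 0)
    (hk : ∀ a, l a * k (P.blk a) = l a)
    (hS : ∀ a b, P.Adj a b → l a * r b ∈ S.toSubmodule) (X : P.tro) :
    (P.homOfUnits S hl hr hk hS X : B) = P.unitsFun l r X := rfl

end Pattern

end

/-! ### Peirce decompositions -/

noncomputable section

section Peirce

variable {B : Type*} [NonUnitalRing B] [StarRing B]

omit [StarRing B] in
theorem two_nsmul_eq_zero_of_module [Module ℂ B] {x : B} (h : x + x = 0) : x = 0 := by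
  rw [← two_smul ℂ x] at h
  exact (smul_eq_zero.mp h).resolve_left two_ne_zero

/-- Triple orthogonality to a tripotent implies orthogonality of the left and right supports. -/
theorem orthogonal_of_tripotent [Module ℂ B] {u v : B} (hu : u * star u * u = u)
    (h : u * star u * v + v * star u * u = 0) : star u * v = 0 ∧ u * star v = 0 := by
  -- the Peirce two component of `v` vanishes, and then so does its Peirce one component
  have h1 : u * star u * (v * star u * u) = 0 := by
    apply two_nsmul_eq_zero_of_module
    have h2 := congrArg (fun x => u * star u * x * (star u * u)) h
    simp only [mul_add, add_mul, mul_zero, zero_mul] at h2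
    have e1 : u * star u * (u * star u * v) * (star u * u) = u * star u * (v * star u * u) := by
      calc _ = (u * star u * u) * star u * v * star u * u := by simp only [mul_assoc]
        _ = _ := by rw [hu]; simp only [mul_assoc]
    have e2 : u * star u * (v * star u * u) * (star u * u) = u * star u * (v * star u * u) := by
      calc _ = u * star u * v * star u * (u * star u * u) := by simp only [mul_assoc]
        _ = _ := by rw [hu]; simp only [mul_assoc]
    rwa [e1, e2] at h2
  have h3 : u * star u * v = 0 := by
    have h2 := congrArg (fun x => u * star u * x) h
    simp only [mul_add, mul_zero] at h2
    rw [h1, add_zero, ← mul_assoc, ← mul_assoc, hu] at h2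
    exact h2
  have h4 : v * star u * u = 0 := by rwa [h3, zero_add] at h
  have hu' : star u * u * star u = star u := by
    have := congrArg star hu
    simpa [mul_assoc] using this
  constructor
  · rw [← hu', mul_assoc, mul_assoc, ← mul_assoc u, h3, mul_zero]
  · have : v * star u = 0 := by
      rw [← hu', ← mul_assoc, ← mul_assoc, h4, zero_mul]
    have h5 := congrArg star this
    simpa using h5

omit [StarRing B] in
/-- If `x` lies in the Peirce one spaces of two orthogonal tripotents, its two components coincide. -/
theorem peirce_one_eq {p q p' q' x : B} (h : p * x + x * q = x) (h' : p' * x + x * q' = x)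
    (hp : p' * p = 0) (hq : q' * q = 0) : p' * x = x * q := by
  have h1 : p' * x = p' * x * q := by
    conv_lhs => rw [← h]
    rw [mul_add, ← mul_assoc, hp, zero_mul, zero_add, mul_assoc]
  have h2 : x * q = p' * x * q := by
    conv_lhs => rw [← h']
    rw [add_mul, mul_assoc x, hq, mul_zero, add_zero]
  rw [h1, ← h2]

omit [StarRing B] in
/-- If `x` lies in the Peirce two space of a pair of idempotents, it is fixed by both. -/
theorem peirce_two_eq [Module ℂ B] {p q x : B} (hp : p * p = p) (hq : q * q = q)
    (h : p * x + x * q = x + x) : p * x = x ∧ x * q = x := by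
  have h1 : p * x * q = p * x := by
    have := congrArg (fun y => p * y) h
    simp only [mul_add, ← mul_assoc, hp] at this
    exact add_left_cancel this
  have h2 : p * x * q = x * q := by
    have := congrArg (fun y => y * q) h
    simp only [add_mul, mul_assoc, hq] at this
    rw [mul_assoc]
    exact add_right_cancel this
  have h3 : p * x = x * q := h1.symm.trans h2
  have h4 : p * x = x := by
    rw [← h3] at h
    have h5 : (p * x - x) + (p * x - x) = 0 := by rw [← sub_eq_zero.mpr h]; abel
    exact sub_eq_zero.mp (two_nsmul_eq_zero_of_module h5)
  exact ⟨h4, h3 ▸ h4⟩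

end Peirce

namespace Pattern

variable (P : Pattern.{u})

/-- The index `a` belongs to a hermitian factor. -/
def Herm (a : P.R) : Prop := P.swap (P.blk a) = P.blk a ∧ P.sign (P.blk a) = 1

variable {P}

theorem Herm.adj_self {a : P.R} (h : P.Herm a) : P.Adj a a := h.1.symm

theorem Herm.of_adj {a b : P.R} (h : P.Herm a) (hab : P.Adj a b) : P.Herm b := by
  have : P.blk b = P.blk a := by rw [hab, h.1]
  unfold Herm; rw [this]; exact h

theorem not_herm_of_adj {a b : P.R} (h : ¬ P.Herm a) (hab : P.Adj a b) : ¬ P.Herm b :=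
  fun hb => h (hb.of_adj hab.symm)

theorem exists_blk_eq_notMem {i : P.ι} (s : Finset P.R)
    (h : s.card < (Finset.univ.filter (P.blk · = i)).card) : ∃ c, P.blk c = i ∧ c ∉ s := by
  obtain ⟨c, hc, hcs⟩ := Finset.exists_mem_notMem_of_card_lt_card h
  exact ⟨c, by simpa using hc, hcs⟩

/-- The rectangular and the symplectic factors contain enough quadrangles. In a symplectic factor,
up to four indices have to be avoided, whence the order has to be at least `5`. -/
theorem exists_adj_avoiding {a b d d' : P.R} (h : ¬ P.Herm a) (hab : P.Adj a b) (hd : P.Adj a d)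
    (hd' : P.Adj a d') : ∃ c, P.Adj b c ∧ c ≠ a ∧ c ≠ b ∧ c ≠ d ∧ c ≠ d' := by
  rcases P.kind (P.blk a) with h1 | ⟨h1, -, h2⟩ | ⟨h1, -, h2⟩
  · exact absurd h1 h
  · obtain ⟨c, hc, hcs⟩ := exists_blk_eq_notMem (i := P.blk a) {a, b, d, d'}
      (lt_of_le_of_lt Finset.card_le_four (by omega))
    simp only [Finset.mem_insert, Finset.mem_singleton, not_or] at hcs
    exact ⟨c, by rw [Adj, hc, hab.symm], hcs⟩
  · obtain ⟨c, hc, hcs⟩ := exists_blk_eq_notMem (i := P.blk a) {a}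
      (lt_of_le_of_lt (Finset.card_singleton a).le (by omega))
    -- `c` lies in the block of `a`, and `b`, `d`, `d'` lie in the opposite one
    have key : ∀ x, P.Adj a x → c ≠ x := by
      rintro x hx rfl
      exact h1 (by rw [← hc]; conv_rhs => rw [hx, ← hc])
    exact ⟨c, by rw [Adj, hc, hab.symm], by simpa using hcs, key _ hab, key _ hd, key _ hd'⟩

theorem exists_adj_ne {a : P.R} (h : ¬ P.Herm a) (b : P.R) :
    ∃ d, P.Adj a d ∧ d ≠ a ∧ d ≠ b := by
  rcases P.kind (P.blk a) with h1 | ⟨h1, -, h2⟩ | ⟨h1, -, h2⟩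
  · exact absurd h1 h
  · obtain ⟨c, hc, hcs⟩ := exists_blk_eq_notMem (i := P.blk a) {a, b}
      (lt_of_le_of_lt Finset.card_le_two (by omega))
    simp only [Finset.mem_insert, Finset.mem_singleton, not_or] at hcs
    exact ⟨c, by rw [Adj, hc, h1], hcs⟩
  · have h3 : 2 ≤ (Finset.univ.filter (P.blk · = P.swap (P.blk a))).card := by
      rcases P.kind (P.swap (P.blk a)) with h4 | ⟨h4, -⟩ | ⟨-, -, h4⟩
      · exact absurd (h4.1.symm.trans (P.swap_swap _)) h1
      · exact absurd (h4.symm.trans (P.swap_swap _)) h1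
      · exact h4
    obtain ⟨c, hc, hcs⟩ := exists_blk_eq_notMem (i := P.swap (P.blk a)) {b}
      (lt_of_le_of_lt (Finset.card_singleton b).le (by omega))
    refine ⟨c, hc, ?_, by simpa using hcs⟩
    rintro rfl
    exact h1 hc.symm

/-- Distinct indices `a` and `c` belong to disjoint adjacent pairs `(a, b)` and `(c, d)`. -/
theorem exists_disjoint_adj {a c : P.R} (ha : ¬ P.Herm a) (hc : ¬ P.Herm c) :
    ∃ b d, P.Adj a b ∧ P.Adj c d ∧ a ≠ b ∧ c ≠ d ∧ a ≠ d ∧ b ≠ c ∧ b ≠ d := by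
  obtain ⟨b, hb, hba, hbc⟩ := exists_adj_ne ha c
  suffices h : ∃ d, P.Adj c d ∧ d ≠ c ∧ d ≠ a ∧ d ≠ b by
    obtain ⟨d, h1, h2, h3, h4⟩ := h
    exact ⟨b, d, hb, h1, hba.symm, h2.symm, h3.symm, hbc, h4.symm⟩
  by_cases h1 : P.Adj c a
  · by_cases h2 : P.Adj c b
    · rcases P.kind (P.blk c) with h3 | ⟨h3, -, h4⟩ | ⟨h3, -, h4⟩
      · exact absurd h3 hc
      · obtain ⟨d, hd, hds⟩ := exists_blk_eq_notMem (i := P.blk c) {c, a, b}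
          (lt_of_le_of_lt Finset.card_le_three (by omega))
        simp only [Finset.mem_insert, Finset.mem_singleton, not_or] at hds
        exact ⟨d, by rw [Adj, hd, h3], hds⟩
      · exfalso
        -- `a` and `b` would both lie in the block opposite to `c`, but they are adjacent
        unfold Adj at h1 h2 hb
        rw [h1, P.swap_swap] at hb
        exact h3 (h2.symm.trans hb)
    · obtain ⟨d, hd, hdc, hda⟩ := exists_adj_ne hc a
      exact ⟨d, hd, hdc, hda, fun h => h2 (h ▸ hd)⟩
  · obtain ⟨d, hd, hdc, hdb⟩ := exists_adj_ne hc b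
    exact ⟨d, hd, hdc, fun h => h1 (h ▸ hd), hdb⟩

end Pattern

/-! ### Grids and matrix units -/

/-- The relations in a TRO between the images `u a b` of the matrices `E a b + sign • E b a` and the
images `t a` of the diagonal matrix units `E a a` of the hermitian factors which follow from the
values of the triple product. -/
structure Grid (P : Pattern.{u}) {B : Type v} [NonUnitalCStarAlgebra B] (u : P.R → P.R → B)
    (t : P.R → B) : Prop where
  symm : ∀ a b, P.Adj a b → u b a = P.sign (P.blk a) • u a b
  tern_self : ∀ a b, P.Adj a b → a ≠ b → u a b * star (u a b) * u a b = u a b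
  collinear : ∀ a b c, P.Adj a b → P.Adj a c → a ≠ b → a ≠ c → b ≠ c →
    u a b * star (u a b) * u a c + u a c * star (u a b) * u a b = u a c
  orth : ∀ a b c d, P.Adj a b → P.Adj c d → a ≠ b → c ≠ d → a ≠ c → a ≠ d → b ≠ c → b ≠ d →
    u a b * star (u a b) * u c d + u c d * star (u a b) * u a b = 0
  quad : ∀ a b c d, P.Adj a b → P.Adj c b → P.Adj c d → a ≠ b → a ≠ c → a ≠ d → b ≠ c → b ≠ d →
    c ≠ d → u a b * star (u c b) * u c d + u c d * star (u c b) * u a b = u a d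
  t_self : ∀ a, P.Herm a → t a * star (t a) * t a = t a
  t_collinear : ∀ a b, P.Herm a → P.Adj a b → a ≠ b →
    t a * star (t a) * u a b + u a b * star (t a) * t a = u a b
  t_orth : ∀ a b, P.Herm a → P.Herm b → a ≠ b →
    t a * star (t a) * t b + t b * star (t a) * t a = 0
  t_orth_u : ∀ a b c, P.Herm a → P.Adj b c → b ≠ c → a ≠ b → a ≠ c →
    t a * star (t a) * u b c + u b c * star (t a) * t a = 0
  t_quad : ∀ a o b, P.Herm o → P.Adj a o → P.Adj o b → a ≠ o → o ≠ b → a ≠ b →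
    u a o * star (t o) * u o b + u o b * star (t o) * u a o = u a b
  t_flip : ∀ a o, P.Herm o → P.Adj a o → a ≠ o → u a o * star (t o) * u a o = t a
  t_peirce_two : ∀ a b, P.Herm a → P.Adj a b → a ≠ b →
    u a b * star (u a b) * t a + t a * star (u a b) * u a b = t a + t a

namespace Grid

variable {P : Pattern.{u}} {B : Type v} [NonUnitalCStarAlgebra B] {u : P.R → P.R → B} {t : P.R → B}

open Pattern

/-- Grids are stable under the involution. -/
protected theorem star (G : Grid P u t) :
    Grid P (fun a b => star (u a b)) (fun a => star (t a)) where
  symm a b h := by rw [G.symm a b h, star_smul, P.star_sign]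
  tern_self a b h h' := by
    simpa [mul_assoc] using congrArg star (G.tern_self a b h h')
  collinear a b c h1 h2 h3 h4 h5 := by
    have := congrArg star (G.collinear a b c h1 h2 h3 h4 h5)
    rw [add_comm]; simpa [mul_assoc] using this
  orth a b c d h1 h2 h3 h4 h5 h6 h7 h8 := by
    have := congrArg star (G.orth a b c d h1 h2 h3 h4 h5 h6 h7 h8)
    rw [add_comm]; simpa [mul_assoc] using this
  quad a b c d h1 h2 h3 h4 h5 h6 h7 h8 h9 := by
    have := congrArg star (G.quad a b c d h1 h2 h3 h4 h5 h6 h7 h8 h9)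
    rw [add_comm]; simpa [mul_assoc] using this
  t_self a h := by simpa [mul_assoc] using congrArg star (G.t_self a h)
  t_collinear a b h1 h2 h3 := by
    have := congrArg star (G.t_collinear a b h1 h2 h3)
    rw [add_comm]; simpa [mul_assoc] using this
  t_orth a b h1 h2 h3 := by
    have := congrArg star (G.t_orth a b h1 h2 h3)
    rw [add_comm]; simpa [mul_assoc] using this
  t_orth_u a b c h1 h2 h3 h4 h5 := by
    have := congrArg star (G.t_orth_u a b c h1 h2 h3 h4 h5)
    rw [add_comm]; simpa [mul_assoc] using this
  t_quad a o b h1 h2 h3 h4 h5 h6 := by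
    have := congrArg star (G.t_quad a o b h1 h2 h3 h4 h5 h6)
    rw [add_comm]; simpa [mul_assoc] using this
  t_flip a o h1 h2 h3 := by
    have := congrArg star (G.t_flip a o h1 h2 h3)
    simpa [mul_assoc] using this
  t_peirce_two a b h1 h2 h3 := by
    have := congrArg star (G.t_peirce_two a b h1 h2 h3)
    rw [add_comm]; simpa [mul_assoc] using this

variable (P) in
/-- A neighbour of `a` other than `a` and `b`. -/
def other (a b : P.R) : P.R :=
  open Classical in if h : ∃ d, P.Adj a d ∧ d ≠ a ∧ d ≠ b then h.choose else a

theorem other_spec {a : P.R} (h : ¬ P.Herm a) (b : P.R) :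
    P.Adj a (other P a b) ∧ other P a b ≠ a ∧ other P a b ≠ b := by
  have h' := exists_adj_ne h b
  rw [other, dif_pos h']
  exact h'.choose_spec

/-- The image of the matrix unit at the position `(a, b)`, for `a ≠ b` a Peirce component of
`u a b`. -/
def unit (u : P.R → P.R → B) (t : P.R → B) (a b : P.R) : B :=
  open Classical in
  if a = b then t a else if P.Herm a then t a * star (t a) * u a b else
    u a (other P a b) * star (u a (other P a b)) * u a b

theorem unit_self (a : P.R) : unit u t a a = t a := by simp [unit]

theorem unit_of_herm {a b : P.R} (h : P.Herm a) (hab : a ≠ b) :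
    unit u t a b = t a * star (t a) * u a b := by simp [unit, h, hab]

variable (G : Grid P u t)
include G

theorem star_mul_eq_zero {a b c d : P.R} (h : P.Adj a b) (h' : P.Adj c d) (hab : a ≠ b)
    (hcd : c ≠ d) (hac : a ≠ c) (had : a ≠ d) (hbc : b ≠ c) (hbd : b ≠ d) :
    star (u a b) * u c d = 0 ∧ u a b * star (u c d) = 0 :=
  orthogonal_of_tripotent (G.tern_self a b h hab) (G.orth a b c d h h' hab hcd hac had hbc hbd)

/-- The two descriptions of a Peirce component through the sides of a quadrangle. -/
theorem quadrangle {a b c d : P.R} (hab : P.Adj a b) (had : P.Adj a d) (hbc : P.Adj b c)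
    (h1 : a ≠ b) (h2 : a ≠ c) (h3 : a ≠ d) (h4 : b ≠ c) (h5 : b ≠ d) (h6 : c ≠ d) :
    u a d * star (u a d) * u a b = u a b * (star (u b c) * u b c) := by
  obtain ⟨e1, e2⟩ := G.star_mul_eq_zero had hbc h3 h4 h1 h2 h5.symm h6.symm
  refine peirce_one_eq (p := u b c * star (u b c)) (q := star (u b c) * u b c)
    (p' := u a d * star (u a d)) (q' := star (u a d) * u a d) ?_ ?_ ?_ ?_
  · have h := G.collinear b c a hbc hab.symm h4 h1.symm h2.symm
    rw [G.symm a b hab, mul_smul_comm, smul_mul_assoc, smul_mul_assoc, ← smul_add] at h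
    have h' := congrArg (fun x => P.sign (P.blk a) • x) h
    simp only [smul_smul, P.sign_mul_self, one_smul] at h'
    rw [← mul_assoc]; exact h'
  · rw [← mul_assoc]
    exact G.collinear a d b had hab h3 h1 h5.symm
  · rw [mul_assoc, ← mul_assoc (star (u a d)), e1, zero_mul, mul_zero]
  · rw [mul_assoc, ← mul_assoc (u a d), e2, zero_mul, mul_zero]

/-- The matrix units do not depend on the choice of the neighbour `d` of `a`: compare two choices
with a common right multiplication. -/
theorem unit_of_not_herm {a b d : P.R} (h : ¬ P.Herm a) (hab : P.Adj a b) (had : P.Adj a d)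
    (h1 : a ≠ b) (h2 : d ≠ a) (h3 : d ≠ b) :
    unit u t a b = u a d * star (u a d) * u a b := by
  obtain ⟨g1, g2, g3⟩ := other_spec h b
  obtain ⟨c, hc, k1, k2, k3, k4⟩ := exists_adj_avoiding h hab had g1
  rw [unit, if_neg h1, if_neg h,
    G.quadrangle hab g1 hc h1 k1.symm g2.symm k2.symm g3.symm k4,
    G.quadrangle hab had hc h1 k1.symm h2.symm k2.symm h3.symm k3]

theorem unit_of_not_herm' {a b c : P.R} (h : ¬ P.Herm a) (hab : P.Adj a b) (hbc : P.Adj b c)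
    (h1 : a ≠ b) (h2 : c ≠ a) (h3 : c ≠ b) :
    unit u t a b = u a b * (star (u b c) * u b c) := by
  obtain ⟨d, hd, k1, k2, k3, -⟩ := exists_adj_avoiding (not_herm_of_adj h hab) hab.symm hbc hbc
  rw [G.unit_of_not_herm h hab hd h1 k2 k1,
    G.quadrangle hab hd hbc h1 h2.symm k2.symm h3.symm k1.symm k3.symm]

/-- In a hermitian factor, the two descriptions of a Peirce component of `u a b`. -/
theorem t_mul_star_mul {a b : P.R} (ha : P.Herm a) (hab : P.Adj a b) (h : a ≠ b) :
    t a * star (t a) * u a b = u a b * (star (t b) * t b) := by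
  have hb := ha.of_adj hab
  obtain ⟨e1, e2⟩ := orthogonal_of_tripotent (G.t_self a ha) (G.t_orth a b ha hb h)
  refine peirce_one_eq (p := t b * star (t b)) (q' := star (t a) * t a) ?_ ?_ ?_ ?_
  · have h := G.t_collinear b a hb hab.symm h.symm
    rw [G.symm a b hab, ha.2, one_smul] at h
    rw [← mul_assoc]; exact h
  · rw [← mul_assoc]; exact G.t_collinear a b ha hab h
  · rw [mul_assoc, ← mul_assoc (star (t a)), e1, zero_mul, mul_zero]
  · rw [mul_assoc, ← mul_assoc (t a), e2, zero_mul, mul_zero]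

/-- The Peirce decomposition of `u a b`. -/
theorem eq_unit_add {a b : P.R} (hab : P.Adj a b) (h : a ≠ b) :
    u a b = unit u t a b + P.sign (P.blk a) • unit u t b a := by
  by_cases ha : P.Herm a
  · have hb := ha.of_adj hab
    rw [unit_of_herm ha h, unit_of_herm hb h.symm, ha.2, one_smul,
      G.t_mul_star_mul hb hab.symm h.symm, G.symm a b hab, ha.2, one_smul, ← mul_assoc]
    exact (G.t_collinear a b ha hab h).symm
  · obtain ⟨d, hd, k1, k2⟩ := exists_adj_ne ha b
    rw [G.unit_of_not_herm ha hab hd h k1 k2, G.unit_of_not_herm' (not_herm_of_adj ha hab) hab.symm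
      hd h.symm k2 k1, G.symm a b hab, smul_mul_assoc, smul_smul, P.sign_mul_self, one_smul,
      ← mul_assoc]
    exact (G.collinear a d b hd hab k1.symm h k2).symm

/-- The matrix units of the adjoint grid. -/
theorem unit_star {a b : P.R} (hab : P.Adj a b) (h : a ≠ b) :
    unit (fun a b => star (u a b)) (fun a => star (t a)) a b =
      P.sign (P.blk a) • star (unit u t b a) := by
  by_cases ha : P.Herm a
  · have hb := ha.of_adj hab
    rw [unit_of_herm ha h, unit_of_herm hb h.symm, G.t_mul_star_mul hb hab.symm h.symm,
      G.symm a b hab]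
    simp [ha.2]
  · obtain ⟨d, hd, k1, k2⟩ := exists_adj_ne ha b
    rw [G.star.unit_of_not_herm ha hab hd h k1 k2,
      G.unit_of_not_herm' (not_herm_of_adj ha hab) hab.symm hd h.symm k2 k1, G.symm a b hab]
    simp [P.star_sign, smul_smul, P.sign_mul_self, mul_smul_comm]

theorem proj_mul_self {a b : P.R} (hab : P.Adj a b) (h : a ≠ b) :
    u a b * star (u a b) * (u a b * star (u a b)) = u a b * star (u a b) := by
  rw [← mul_assoc, G.tern_self a b hab h]

/-- The left supports of collinear elements of the grid commute. -/
theorem proj_comm {a b d : P.R} (hab : P.Adj a b) (had : P.Adj a d) (h1 : a ≠ b) (h2 : a ≠ d)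
    (h3 : b ≠ d) : u a b * star (u a b) * (u a d * star (u a d)) =
      u a d * star (u a d) * (u a b * star (u a b)) := by
  have h : u a b * star (u a b) * (u a d * star (u a d)) =
      u a d * star (u a d) - u a d * (star (u a b) * u a b) * star (u a d) := by
    rw [eq_sub_iff_add_eq]
    have := congrArg (fun x => x * star (u a d)) (G.collinear a b d hab had h1 h2 h3)
    simpa only [add_mul, mul_assoc] using this
  have h' := congrArg star h
  simp only [star_mul, star_sub, star_star] at h'
  rw [h]
  simp only [mul_assoc] at h' ⊢
  exact h'.symm

theorem unit_mul_star_of_not_herm {a b d : P.R} (h : ¬ P.Herm a) (hab : P.Adj a b)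
    (had : P.Adj a d) (h1 : a ≠ b) (h2 : d ≠ a) (h3 : d ≠ b) :
    unit u t a b * star (unit u t a b) = u a d * star (u a d) * (u a b * star (u a b)) := by
  rw [G.unit_of_not_herm h hab had h1 h2 h3, star_mul, star_mul, star_star]
  calc _ = u a d * star (u a d) * ((u a b * star (u a b)) * (u a d * star (u a d))) := by
        simp only [mul_assoc]
    _ = (u a d * star (u a d) * (u a d * star (u a d))) * (u a b * star (u a b)) := by
        rw [G.proj_comm hab had h1 h2.symm h3.symm]; simp only [mul_assoc]
    _ = _ := by rw [G.proj_mul_self had h2.symm]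

theorem unit_mul_star_eq_of_not_herm {a b b' : P.R} (h : ¬ P.Herm a) (hab : P.Adj a b)
    (hab' : P.Adj a b') (h1 : a ≠ b) (h2 : a ≠ b') :
    unit u t a b * star (unit u t a b) = unit u t a b' * star (unit u t a b') := by
  by_cases hbb : b = b'
  · rw [hbb]
  · rw [G.unit_mul_star_of_not_herm h hab hab' h1 h2.symm (Ne.symm hbb),
      G.unit_mul_star_of_not_herm h hab' hab h2 h1.symm hbb, G.proj_comm hab hab' h1 h2 hbb]

/-- In a hermitian factor, the left supports in the row `a` agree with that of the diagonal matrix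
unit: `t a` lies in the Peirce two space of `u a b`, so it is dominated by the supports of the Peirce
components of `u a b`. -/
theorem unit_mul_star_of_herm {a b : P.R} (ha : P.Herm a) (hab : P.Adj a b) :
    unit u t a b * star (unit u t a b) = t a * star (t a) := by
  by_cases h : a = b
  · rw [← h, unit_self]
  have hb := ha.of_adj hab
  have hba : u b a = u a b := by rw [G.symm a b hab, ha.2, one_smul]
  have e1 : unit u t a b = t a * star (t a) * u a b := unit_of_herm ha h
  have e2 : unit u t b a = u a b * (star (t a) * t a) := by
    rw [unit_of_herm hb (Ne.symm h), G.t_mul_star_mul hb hab.symm (Ne.symm h), hba]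
  have e3 : unit u t a b = u a b * (star (t b) * t b) := by
    rw [e1, G.t_mul_star_mul ha hab h]
  have ht : star (t a) * t a * star (t a) = star (t a) := by
    simpa [mul_assoc] using congrArg star (G.t_self a ha)
  -- the idempotents `e e*` and `f* f` of the two Peirce components `e` and `f` of `u a b`
  have hE : unit u t a b * star (unit u t a b) = t a * star (t a) * (u a b * star (u a b)) *
      (t a * star (t a)) := by
    rw [e1]; simp only [star_mul, star_star, mul_assoc]
  have hF : star (unit u t b a) * unit u t b a = star (t a) * t a * (star (u a b) * u a b) *
      (star (t a) * t a) := by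
    rw [e2]; simp only [star_mul, star_star, mul_assoc]
  have hu := G.tern_self a b hab h
  have k1 : unit u t a b * star (unit u t a b) * unit u t a b = unit u t a b := by
    calc _ = t a * star (t a) * u a b * star (u a b) * (t a * star (t a) * (t a * star (t a))) *
          u a b := by
          conv_lhs => rw [hE, e1]
          simp only [mul_assoc]
      _ = t a * star (t a) * u a b * star (u a b) * (t a * star (t a) * u a b) := by
          rw [← mul_assoc (t a * star (t a)) (t a), G.t_self a ha]; simp only [mul_assoc]
      _ = t a * star (t a) * (u a b * star (u a b) * u a b) * (star (t b) * t b) := by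
          refine (congrArg (fun x => t a * star (t a) * u a b * star (u a b) * x)
            (e1.symm.trans e3)).trans ?_
          simp only [mul_assoc]
      _ = _ := by rw [hu, mul_assoc, ← e3, e1, ← mul_assoc, ← mul_assoc, G.t_self a ha]
  have k2 : unit u t b a * star (unit u t b a) * unit u t b a = unit u t b a := by
    have e4 : unit u t b a = t b * star (t b) * u a b := by
      rw [unit_of_herm hb (Ne.symm h), hba]
    calc _ = u a b * ((star (t a) * t a * star (t a)) * t a) * (star (u a b) * u a b) *
          (star (t a) * t a) := by
          conv_lhs => rw [mul_assoc, hF, e2]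
          simp only [mul_assoc]
      _ = u a b * (star (t a) * t a) * star (u a b) * (u a b * (star (t a) * t a)) := by
          rw [ht]; simp only [mul_assoc]
      _ = t b * star (t b) * (u a b * star (u a b) * u a b) * (star (t a) * t a) := by
          refine (congrArg (fun x => x * star (u a b) * (u a b * (star (t a) * t a)))
            (e2.symm.trans e4)).trans ?_
          simp only [mul_assoc]
      _ = _ := by
          rw [hu, mul_assoc, ← e2, e4, ← mul_assoc, ← mul_assoc, G.t_self b hb]
  have key : unit u t a b * star (unit u t a b) * t a = t a := by
    refine (peirce_two_eq (q := star (unit u t b a) * unit u t b a) ?_ ?_ ?_).1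
    · rw [← mul_assoc, k1]
    · rw [mul_assoc, ← mul_assoc (unit u t b a), k2]
    · have h2 := congrArg (fun x => t a * star (t a) * x * (star (t a) * t a))
        (G.t_peirce_two a b ha hab h)
      simp only [mul_add, add_mul] at h2
      have h3 : t a * star (t a) * t a * (star (t a) * t a) = t a := by
        rw [G.t_self a ha, ← mul_assoc, G.t_self a ha]
      rw [h3] at h2
      rw [← h2, hE, hF]
      congr 1
      · simp only [mul_assoc]
      · simp only [mul_assoc]
  calc _ = unit u t a b * star (unit u t a b) * (t a * star (t a)) := by
        conv_lhs => rw [e1, star_mul, star_mul, star_star]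
        conv_rhs => rw [e1, star_mul, star_mul, star_star]
        simp only [mul_assoc]
        rw [← mul_assoc (t a) (star (t a)) (t a * star (t a)), ← mul_assoc (t a * star (t a)) (t a),
          G.t_self a ha]
    _ = _ := by rw [← mul_assoc, key]

end Grid

/-- The pairs of indices for which `Grid.unit` is the image of a matrix unit. -/
def Pattern.Good (P : Pattern.{u}) (a b : P.R) : Prop := P.Adj a b ∧ (a = b → P.Herm a)

theorem Pattern.Good.symm {P : Pattern.{u}} {a b : P.R} (h : P.Good a b) : P.Good b a :=
  ⟨h.1.symm, fun hab => hab ▸ h.2 hab.symm⟩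

theorem Pattern.Good.of_ne {P : Pattern.{u}} {a b : P.R} (h : P.Adj a b) (h' : a ≠ b) : P.Good a b :=
  ⟨h, fun hab => absurd hab h'⟩

namespace Grid

variable {P : Pattern.{u}} {B : Type v} [NonUnitalCStarAlgebra B] {u : P.R → P.R → B} {t : P.R → B}

open Pattern

variable (G : Grid P u t)
include G

/-- The left support of a matrix unit depends on its row only. -/
theorem unit_mul_star_eq {a b b' : P.R} (h : P.Good a b) (h' : P.Good a b') :
    unit u t a b * star (unit u t a b) = unit u t a b' * star (unit u t a b') := by
  by_cases ha : P.Herm a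
  · rw [G.unit_mul_star_of_herm ha h.1, G.unit_mul_star_of_herm ha h'.1]
  · exact G.unit_mul_star_eq_of_not_herm ha h.1 h'.1 (fun e => ha (h.2 e)) (fun e => ha (h'.2 e))

/-- The right supports of a grid are the left supports of the adjoint grid. -/
theorem star_unit_mul_eq_unit_star {a b : P.R} (h : P.Good a b) :
    star (unit u t a b) * unit u t a b =
      unit (fun a b => star (u a b)) (fun a => star (t a)) b a *
        star (unit (fun a b => star (u a b)) (fun a => star (t a)) b a) := by
  by_cases hab : a = b
  · subst hab; simp [unit_self]
  · rw [G.unit_star h.1.symm (Ne.symm hab), star_smul, P.star_sign, smul_mul_smul_comm,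
      P.sign_mul_self, one_smul, star_star]

/-- The right support of a matrix unit depends on its column only. -/
theorem star_mul_unit_eq {a a' b : P.R} (h : P.Good a b) (h' : P.Good a' b) :
    star (unit u t a b) * unit u t a b = star (unit u t a' b) * unit u t a' b := by
  rw [G.star_unit_mul_eq_unit_star h, G.star_unit_mul_eq_unit_star h',
    G.star.unit_mul_star_eq h.symm h'.symm]

/-- Matrix units are tripotents. -/
theorem unit_tern_self {a b : P.R} (h : P.Good a b) :
    unit u t a b * star (unit u t a b) * unit u t a b = unit u t a b := by
  by_cases ha : P.Herm a
  · rw [G.unit_mul_star_of_herm ha h.1]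
    by_cases hab : a = b
    · rw [← hab, unit_self, G.t_self a ha]
    · rw [unit_of_herm ha hab, ← mul_assoc, ← mul_assoc, G.t_self a ha]
  · have hab : a ≠ b := fun e => ha (h.2 e)
    obtain ⟨d, hd, k1, k2⟩ := exists_adj_ne ha b
    rw [G.unit_mul_star_of_not_herm ha h.1 hd hab k1 k2, G.unit_of_not_herm ha h.1 hd hab k1 k2]
    calc _ = u a d * star (u a d) * ((u a b * star (u a b)) * (u a d * star (u a d))) * u a b := by
          simp only [mul_assoc]
      _ = (u a d * star (u a d) * (u a d * star (u a d))) * (u a b * star (u a b) * u a b) := by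
          rw [G.proj_comm h.1 hd hab k1.symm k2.symm]; simp only [mul_assoc]
      _ = _ := by rw [G.proj_mul_self hd k1.symm, G.tern_self a b h.1 hab]

/-- The left support of a matrix unit is below the left support of every element of its row. -/
theorem exists_unit_eq_mul {a b c : P.R} (h : P.Good a b) (ha : ¬ P.Herm a) (hc : P.Adj a c)
    (hac : a ≠ c) : ∃ y, unit u t a b = u a c * y := by
  have hab : a ≠ b := fun e => ha (h.2 e)
  have h2 : unit u t a b = unit u t a c * star (unit u t a c) * unit u t a b := by
    rw [← G.unit_mul_star_eq h (Good.of_ne hc hac), G.unit_tern_self h]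
  obtain ⟨d, hd, k1, k2⟩ := exists_adj_ne ha c
  rw [h2, G.unit_mul_star_of_not_herm ha hc hd hac k1 k2,
    ← G.proj_comm hc hd hac k1.symm k2.symm]
  exact ⟨star (u a c) * (u a d * star (u a d) * unit u t a b), by simp only [mul_assoc]⟩

/-- Matrix units in different rows have orthogonal left supports. -/
theorem star_unit_mul_unit {a b c d : P.R} (h : P.Good a b) (h' : P.Good c d) (hac : a ≠ c) :
    star (unit u t a b) * unit u t c d = 0 := by
  have aux : ∀ {x y x' y' : B}, star x * y = 0 → star (x * x') * (y * y') = 0 := by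
    intro x y x' y' e
    rw [star_mul, mul_assoc, ← mul_assoc (star x), e, zero_mul, mul_zero]
  -- in either case, the left support is below that of a tripotent of the grid, and the grid has
  -- enough pairs of orthogonal tripotents
  have hermUnit : ∀ {a b : P.R}, P.Good a b → P.Herm a → ∃ y, unit u t a b = t a * y := by
    intro a b h ha
    have := G.unit_tern_self h
    rw [G.unit_mul_star_of_herm ha h.1] at this
    exact ⟨_, by rw [← this, mul_assoc]⟩
  by_cases ha : P.Herm a
  · obtain ⟨y, hy⟩ := hermUnit h ha
    by_cases hc : P.Herm c
    · obtain ⟨y', hy'⟩ := hermUnit h' hc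
      rw [hy, hy']
      exact aux (orthogonal_of_tripotent (G.t_self a ha) (G.t_orth a c ha hc hac)).1
    · obtain ⟨e, he, hec, hea⟩ := exists_adj_ne hc a
      obtain ⟨y', hy'⟩ := G.exists_unit_eq_mul h' hc he hec.symm
      rw [hy, hy']
      exact aux (orthogonal_of_tripotent (G.t_self a ha)
        (G.t_orth_u a c e ha he hec.symm hac hea.symm)).1
  · by_cases hc : P.Herm c
    · obtain ⟨y', hy'⟩ := hermUnit h' hc
      obtain ⟨e, he, hea, hec⟩ := exists_adj_ne ha c
      obtain ⟨y, hy⟩ := G.exists_unit_eq_mul h ha he hea.symm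
      have := (orthogonal_of_tripotent (G.t_self c hc)
        (G.t_orth_u c a e hc he hea.symm hac.symm hec.symm)).1
      rw [hy, hy']
      exact aux (by simpa using congrArg star this)
    · obtain ⟨e, f, h1, h2, h3, h4, h5, h6, h7⟩ := exists_disjoint_adj ha hc
      obtain ⟨y, hy⟩ := G.exists_unit_eq_mul h ha h1 h3
      obtain ⟨y', hy'⟩ := G.exists_unit_eq_mul h' hc h2 h4
      rw [hy, hy']
      exact aux (G.star_mul_eq_zero h1 h2 h3 h4 hac h5 h6 h7).1

/-- Matrix units in different columns have orthogonal right supports. -/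
theorem unit_mul_star_unit {a b c d : P.R} (h : P.Good a b) (h' : P.Good c d) (hbd : b ≠ d) :
    unit u t a b * star (unit u t c d) = 0 := by
  have h1 := G.star.star_unit_mul_unit h.symm h'.symm hbd
  have aux : ∀ {a b : P.R}, P.Good a b → ∃ z : ℂ, z ≠ 0 ∧
      unit (fun a b => star (u a b)) (fun a => star (t a)) b a = z • star (unit u t a b) := by
    intro a b h
    by_cases hab : a = b
    · exact ⟨1, one_ne_zero, by rw [hab, unit_self, unit_self, one_smul]⟩
    · refine ⟨P.sign (P.blk b), ?_, G.unit_star h.1.symm (Ne.symm hab)⟩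
      exact left_ne_zero_of_mul_eq_one (P.sign_mul_self _)
  obtain ⟨z, hz, e1⟩ := aux h
  obtain ⟨z', hz', e2⟩ := aux h'
  rw [e1, e2, star_smul, star_star, smul_mul_smul_comm] at h1
  exact (smul_eq_zero.mp h1).resolve_left (mul_ne_zero (star_ne_zero.mpr hz) hz')

end Grid
end

noncomputable section

open Pattern TripleProduct

namespace Grid

open scoped Matrix.Norms.L2Operator

variable {P : Pattern.{u}} {B : Type v} [NonUnitalCStarAlgebra B] {u : P.R → P.R → B} {t : P.R → B}
variable (G : Grid P u t)
include G

theorem star_unit_mul_grid {a b c d : P.R} (h : P.Good a b) (hcd : P.Adj c d) (hne : c ≠ d)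
    (hac : a ≠ c) (had : a ≠ d) : star (unit u t a b) * u c d = 0 := by
  rw [G.eq_unit_add hcd hne, mul_add, mul_smul_comm, G.star_unit_mul_unit h (.of_ne hcd hne) hac,
    G.star_unit_mul_unit h (Good.of_ne hcd hne).symm had, smul_zero, add_zero]

theorem supp_mul_grid {a b d : P.R} (h : P.Good a d) (hab : P.Adj a b) (hne : a ≠ b) :
    unit u t a d * star (unit u t a d) * u a b = unit u t a b := by
  rw [G.unit_mul_star_eq h (.of_ne hab hne), G.eq_unit_add hab hne, mul_add, mul_smul_comm,
    G.unit_tern_self (.of_ne hab hne), mul_assoc,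
    G.star_unit_mul_unit (.of_ne hab hne) (Good.of_ne hab hne).symm hne, mul_zero, smul_zero,
    add_zero]

theorem grid_mul_supp {a b d : P.R} (h : P.Good d b) (hab : P.Adj a b) (hne : a ≠ b) :
    u a b * (star (unit u t d b) * unit u t d b) = unit u t a b := by
  rw [G.star_mul_unit_eq h (.of_ne hab hne), G.eq_unit_add hab hne, add_mul, smul_mul_assoc,
    ← mul_assoc, ← mul_assoc, G.unit_tern_self (.of_ne hab hne),
    G.unit_mul_star_unit (Good.of_ne hab hne).symm (.of_ne hab hne) hne, zero_mul, smul_zero,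
    add_zero]

theorem unit_mul_star_grid {a b c d : P.R} (h : P.Good a b) (hcd : P.Adj c d) (hne : c ≠ d)
    (hbc : b ≠ c) : unit u t a b * star (u c d) = unit u t a b * star (unit u t c d) := by
  rw [G.eq_unit_add hcd hne, star_add, mul_add, star_smul, mul_smul_comm,
    G.unit_mul_star_unit h (Good.of_ne hcd hne).symm hbc, smul_zero, add_zero]

/-- The ternary product of matrix units around a quadrangle, obtained from the corresponding relation
of the grid by cutting down with the supports of the row `a` and the column `d`. -/
theorem unit_quad {a b c d : P.R} (hab : P.Adj a b) (hcb : P.Adj c b) (hcd : P.Adj c d)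
    (h1 : a ≠ b) (h2 : a ≠ c) (h3 : a ≠ d) (h4 : b ≠ c) (h5 : b ≠ d) (h6 : c ≠ d) :
    unit u t a b * star (unit u t c b) * unit u t c d = unit u t a d := by
  have had : P.Adj a d := adj_of_blk_eq hcd (blk_eq_of_adj hab hcb)
  have hg : P.Good a b := .of_ne hab h1
  have hg' : P.Good c d := .of_ne hcd h6
  have h := congrArg (fun x => unit u t a b * star (unit u t a b) * x *
    (star (unit u t c d) * unit u t c d)) (G.quad a b c d hab hcb hcd h1 h2 h3 h4 h5 h6)
  simp only [mul_add, add_mul] at h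
  have e1 : unit u t a b * star (unit u t a b) * (u a b * star (u c b) * u c d) *
      (star (unit u t c d) * unit u t c d) = unit u t a b * star (unit u t c b) * unit u t c d := by
    calc _ = unit u t a b * star (unit u t a b) * u a b * star (u c b) *
          (u c d * (star (unit u t c d) * unit u t c d)) := by simp only [mul_assoc]
      _ = _ := by
        rw [G.supp_mul_grid hg hab h1, G.grid_mul_supp hg' hcd h6,
          G.unit_mul_star_grid hg hcb h4.symm h4]
  have e2 : unit u t a b * star (unit u t a b) * (u c d * star (u c b) * u a b) *
      (star (unit u t c d) * unit u t c d) = 0 := by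
    calc _ = unit u t a b * (star (unit u t a b) * u c d) * star (u c b) * u a b *
          (star (unit u t c d) * unit u t c d) := by simp only [mul_assoc]
      _ = _ := by
        rw [G.star_unit_mul_grid hg hcd h6 h2 h3]; simp only [mul_zero, zero_mul]
  rw [e1, e2, add_zero, G.supp_mul_grid hg had h3, G.star_mul_unit_eq hg' (.of_ne had h3),
    ← mul_assoc (unit u t a d), G.unit_tern_self (.of_ne had h3)] at h
  exact h

/-- The ternary product of matrix units around a quadrangle, which may be degenerate. -/
theorem unit_tern {a b c d : P.R} (h : ¬ P.Herm a) (hab : P.Good a b) (hcb : P.Good c b)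
    (hcd : P.Good c d) (had : P.Good a d) :
    unit u t a b * star (unit u t c b) * unit u t c d = unit u t a d := by
  by_cases hac : a = c
  · subst hac
    rw [G.unit_mul_star_eq hab had, G.unit_tern_self had]
  · by_cases hbd : b = d
    · subst hbd
      rw [mul_assoc, G.star_mul_unit_eq hcb hab, ← mul_assoc, G.unit_tern_self hab]
    · have hb := not_herm_of_adj h hab.1
      have hc := not_herm_of_adj hb hcb.1.symm
      exact G.unit_quad hab.1 hcb.1 hcd.1 (fun e => h (hab.2 e)) hac (fun e => h (had.2 e))
        (fun e => hc (hcb.2 e.symm)) hbd (fun e => hc (hcd.2 e))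

/-- The ternary product of matrix units of a hermitian factor around a diagonal matrix unit. -/
theorem unit_tern_of_herm {a o b : P.R} (h : P.Herm o) (hao : P.Adj a o) (hob : P.Adj o b) :
    unit u t a o * star (unit u t o o) * unit u t o b = unit u t a b := by
  have hb := h.of_adj hob
  have ha := h.of_adj hao.symm
  have hab : P.Adj a b := by
    have h1 : P.blk a = P.blk o := by rw [hao.symm, h.1]
    exact adj_of_blk_eq hob h1
  have gao : P.Good a o := ⟨hao, fun _ => ha⟩
  have gob : P.Good o b := ⟨hob, fun _ => h⟩
  have goo : P.Good o o := ⟨h.adj_self, fun _ => h⟩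
  have gab : P.Good a b := ⟨hab, fun _ => ha⟩
  by_cases h1 : a = o
  · subst h1
    rw [G.unit_mul_star_eq goo gob, G.unit_tern_self gob]
  by_cases h2 : o = b
  · subst h2
    rw [mul_assoc, G.star_mul_unit_eq goo gao, ← mul_assoc, G.unit_tern_self gao]
  have key : unit u t a o * star (t o) * unit u t o b =
      unit u t a o * star (unit u t a o) * (u a o * star (t o) * u o b) *
        (star (unit u t o b) * unit u t o b) := by
    calc _ = unit u t a o * star (unit u t a o) * u a o * star (t o) *
          (u o b * (star (unit u t o b) * unit u t o b)) := by
          rw [G.supp_mul_grid gao hao h1, G.grid_mul_supp gob hob h2]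
      _ = _ := by simp only [mul_assoc]
  rw [unit_self, key]
  by_cases h3 : a = b
  · subst h3
    have hsym : u o a = u a o := by rw [G.symm a o hao, ha.2, one_smul]
    rw [hsym, G.t_flip a o h hao h1, G.unit_mul_star_of_herm ha hao, G.t_self a ha, unit_self,
      G.star_mul_unit_eq gob ⟨ha.adj_self, fun _ => ha⟩, unit_self, ← mul_assoc, G.t_self a ha]
  · have h4 := congrArg (fun x => unit u t a o * star (unit u t a o) * x *
      (star (unit u t o b) * unit u t o b)) (G.t_quad a o b h hao hob h1 h2 h3)
    simp only [mul_add, add_mul] at h4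
    have e2 : unit u t a o * star (unit u t a o) * (u o b * star (t o) * u a o) *
        (star (unit u t o b) * unit u t o b) = 0 := by
      calc _ = unit u t a o * (star (unit u t a o) * u o b) * star (t o) * u a o *
            (star (unit u t o b) * unit u t o b) := by simp only [mul_assoc]
        _ = _ := by
          rw [G.star_unit_mul_grid gao hob h2 h1 h3]; simp only [mul_zero, zero_mul]
    rw [e2, add_zero] at h4
    rw [h4, G.supp_mul_grid gao hab h3, G.star_mul_unit_eq gob gab, ← mul_assoc,
      G.unit_tern_self gab]

theorem star_factor_mul_factor {a b o : P.R} (h : P.Good a b) (h' : P.Good o b) :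
    star (unit u t a b * star (unit u t o b)) * (unit u t a b * star (unit u t o b)) =
      unit u t o b * star (unit u t o b) := by
  rw [star_mul, star_star]
  calc _ = unit u t o b * (star (unit u t a b) * unit u t a b) * star (unit u t o b) := by
        simp only [mul_assoc]
    _ = unit u t o b * star (unit u t o b) * unit u t o b * star (unit u t o b) := by
        rw [G.star_mul_unit_eq h h']; simp only [mul_assoc]
    _ = _ := by rw [G.unit_tern_self h']

theorem factor_mul_supp {a b o c : P.R} (h' : P.Good o b) (h'' : P.Good o c) :
    unit u t a b * star (unit u t o b) * (unit u t o c * star (unit u t o c)) =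
      unit u t a b * star (unit u t o b) := by
  have h1 : star (unit u t o b) * unit u t o b * star (unit u t o b) = star (unit u t o b) := by
    simpa [mul_assoc] using congrArg star (G.unit_tern_self h')
  rw [← G.unit_mul_star_eq h' h'', mul_assoc, ← mul_assoc (star _), h1]

omit G in
/-- A factorization of the matrix units in the rows of the block `i` as products of a column `l` and
a row `r`, in the form in which `Pattern.homOfUnits` needs it. Up to the partial isometry which
identifies their supports, `l` and `r` are one column and one row of the system of matrix units. -/
structure BlockUnits (u : P.R → P.R → B) (t : P.R → B) (i : P.ι) where
  k : B
  l : P.R → B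
  r : P.R → B
  star_l_mul_l : ∀ a, P.blk a = i → star (l a) * l a = k
  l_mul_k : ∀ a, P.blk a = i → l a * k = l a
  r_mul_star_r : ∀ b, P.blk b = P.swap i → r b * star (r b) = k
  l_eq : ∀ a, P.blk a = i → ∃ b y, P.Good a b ∧ l a = unit u t a b * y
  r_eq : ∀ b, P.blk b = P.swap i → ∃ a y, P.Good a b ∧ r b = y * unit u t a b
  l_mul_r : ∀ a b, P.blk a = i → P.blk b = P.swap i → P.Good a b → l a * r b = unit u t a b
  mem : ∀ S : TRO B, (∀ a b, P.Good a b → unit u t a b ∈ S.toSubmodule) →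
    ∀ a b, P.blk a = i → P.blk b = P.swap i → l a * r b ∈ S.toSubmodule

/-- If every pair of indices is good, one fixed row and one fixed column serve to factorize. -/
theorem exists_blockUnits_of_good {o o' : P.R} {i : P.ι} (ho : P.blk o = i)
    (ho' : P.blk o' = P.swap i) (hg : ∀ a b, P.blk a = i → P.blk b = P.swap i → P.Good a b)
    (ht : ∀ a b, P.blk a = i → P.blk b = P.swap i →
      unit u t a o' * star (unit u t o o') * unit u t o b = unit u t a b) :
    Nonempty (BlockUnits u t i) :=
  ⟨{  k := unit u t o o' * star (unit u t o o')
      l := fun a => unit u t a o' * star (unit u t o o')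
      r := fun b => unit u t o b
      star_l_mul_l := fun a ha => G.star_factor_mul_factor (hg a o' ha ho') (hg o o' ho ho')
      l_mul_k := fun a ha => G.factor_mul_supp (hg o o' ho ho') (hg o o' ho ho')
      r_mul_star_r := fun b hb => G.unit_mul_star_eq (hg o b ho hb) (hg o o' ho ho')
      l_eq := fun a ha => ⟨o', _, hg a o' ha ho', rfl⟩
      r_eq := fun b hb => ⟨o, unit u t o o' * star (unit u t o o'), hg o b ho hb, by
        rw [G.unit_mul_star_eq (hg o o' ho ho') (hg o b ho hb), G.unit_tern_self (hg o b ho hb)]⟩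
      l_mul_r := fun a b ha hb _ => ht a b ha hb
      mem := fun S hS a b ha hb => by
        rw [ht a b ha hb]; exact hS a b (hg a b ha hb) }⟩

/-- In a symplectic factor, the diagonal matrix units are not Peirce components of the grid. The
column and the row in which they would occur are factorized through further indices. -/
theorem exists_blockUnits_of_symplectic {i : P.ι} (hi : P.swap i = i) (hs : P.sign i = -1)
    (hc : 5 ≤ (Finset.univ.filter (P.blk · = i)).card) : Nonempty (BlockUnits u t i) := by
  classical
  -- the row `o` and the column `o'` serve to factorize, and the missing entries of the row at `o`
  -- and of the column at `o'` are reached through `d` and `c`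
  obtain ⟨o, ho, -⟩ := exists_blk_eq_notMem (i := i) ∅
    (by rw [Finset.card_empty]; omega)
  obtain ⟨o', ho', h1⟩ := exists_blk_eq_notMem (i := i) {o}
    (by rw [Finset.card_singleton]; omega)
  obtain ⟨c, hc', h2⟩ := exists_blk_eq_notMem (i := i) {o, o'}
    (lt_of_le_of_lt Finset.card_le_two (by omega))
  obtain ⟨d, hd, h3⟩ := exists_blk_eq_notMem (i := i) {o, o', c}
    (lt_of_le_of_lt Finset.card_le_three (by omega))
  simp only [Finset.mem_insert, Finset.mem_singleton, not_or] at h1 h2 h3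
  have hadj : ∀ a b, P.blk a = i → P.blk b = i → P.Adj a b := fun a b ha hb => by
    rw [Adj, ha, hb, hi]
  have hg : ∀ a b, P.blk a = i → P.blk b = i → a ≠ b → P.Good a b := fun a b ha hb hab =>
    .of_ne (hadj a b ha hb) hab
  have hnh : ∀ a, P.blk a = i → ¬ P.Herm a := fun a ha h => by
    have := h.2
    rw [ha, hs] at this
    norm_num at this
  have goo' := hg o o' ho ho' (Ne.symm h1)
  have goc := hg o c ho hc' (Ne.symm h2.1)
  have go'c := hg o' c ho' hc' (Ne.symm h2.2)
  have gdo' := hg d o' hd ho' h3.2.1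
  have gdo := hg d o hd ho h3.1
  have gdc := hg d c hd hc' h3.2.2
  have hr : ∀ b, P.blk b = i → (if b = o then unit u t o o' * star (unit u t d o') * unit u t d o
      else unit u t o b) * star (if b = o then unit u t o o' * star (unit u t d o') * unit u t d o
      else unit u t o b) = unit u t o o' * star (unit u t o o') := by
    intro b hb
    split_ifs with h
    · rw [star_mul, star_mul, star_star]
      calc _ = unit u t o o' * star (unit u t d o') * (unit u t d o * star (unit u t d o)) *
            (unit u t d o' * star (unit u t o o')) := by simp only [mul_assoc]
        _ = unit u t o o' * (star (unit u t d o') * (unit u t d o' * star (unit u t d o') *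
            unit u t d o')) * star (unit u t o o') := by
            rw [G.unit_mul_star_eq gdo gdo']; simp only [mul_assoc]
        _ = _ := by
            rw [G.unit_tern_self gdo', G.star_mul_unit_eq gdo' goo', ← mul_assoc,
              G.unit_tern_self goo']
    · exact G.unit_mul_star_eq (hg o b ho hb (Ne.symm h)) goo'
  refine ⟨{
    k := unit u t o o' * star (unit u t o o')
    l := fun a => if a = o' then unit u t o' c * star (unit u t o c) else
      unit u t a o' * star (unit u t o o')
    r := fun b => if b = o then unit u t o o' * star (unit u t d o') * unit u t d o else
      unit u t o b
    star_l_mul_l := ?_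
    l_mul_k := ?_
    r_mul_star_r := fun b hb => hr b (hb.trans hi)
    l_eq := ?_
    r_eq := ?_
    l_mul_r := ?_
    mem := ?_ }⟩
  · intro a ha
    split_ifs with h
    · rw [G.star_factor_mul_factor go'c goc, G.unit_mul_star_eq goc goo']
    · exact G.star_factor_mul_factor (hg a o' ha ho' h) goo'
  · intro a ha
    split_ifs with h
    · exact G.factor_mul_supp goc goo'
    · exact G.factor_mul_supp goo' goo'
  · intro a ha
    split_ifs with h
    · subst h; exact ⟨c, _, go'c, rfl⟩
    · exact ⟨o', _, hg a o' ha ho' h, rfl⟩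
  · intro b hb
    rw [hi] at hb
    split_ifs with h
    · subst h; exact ⟨d, _, gdo, rfl⟩
    · refine ⟨o, unit u t o b * star (unit u t o b), hg o b ho hb (Ne.symm h), ?_⟩
      rw [G.unit_tern_self (hg o b ho hb (Ne.symm h))]
  · intro a b ha hb gab
    rw [hi] at hb
    split_ifs with h h' h'
    · subst h h'
      calc _ = unit u t a c * star (unit u t d a * star (unit u t b a) * unit u t b c) *
            unit u t d b := by simp only [star_mul, star_star, mul_assoc]
        _ = _ := by
          rw [G.unit_tern (hnh d hd) gdo' goo' goc gdc, G.unit_tern (hnh a ha) go'c gdc gdo gab]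
    · subst h
      exact G.unit_tern (hnh a ha) go'c goc (hg o b ho hb (Ne.symm h')) gab
    · subst h'
      calc _ = unit u t a o' * star (unit u t b o') * unit u t b o' * star (unit u t d o') *
            unit u t d b := by simp only [mul_assoc]
        _ = _ := by
          have gao' := hg a o' ha ho' h
          rw [G.unit_tern (hnh a ha) gao' goo' goo' gao', G.unit_tern (hnh a ha) gao' gdo' gdo gab]
    · exact G.unit_tern (hnh a ha) (hg a o' ha ho' h) goo' (hg o b ho hb (Ne.symm h')) gab
  · intro S hS a b ha hb
    rw [hi] at hb
    have hrS : (if b = o then unit u t o o' * star (unit u t d o') * unit u t d o else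
        unit u t o b) ∈ S.toSubmodule := by
      split_ifs with h
      · exact S.tern_mem (hS _ _ goo') (hS _ _ gdo') (hS _ _ gdo)
      · exact hS _ _ (hg o b ho hb (Ne.symm h))
    split_ifs at hrS ⊢ with h h' h'
    · exact S.tern_mem (hS _ _ go'c) (hS _ _ goc) hrS
    · exact S.tern_mem (hS _ _ go'c) (hS _ _ goc) hrS
    · exact S.tern_mem (hS _ _ (hg a o' ha ho' h)) (hS _ _ goo') hrS
    · exact S.tern_mem (hS _ _ (hg a o' ha ho' h)) (hS _ _ goo') hrS

theorem exists_blockUnits (i : P.ι) : Nonempty (BlockUnits u t i) := by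
  rcases P.kind i with ⟨h1, h2⟩ | ⟨h1, h2, h3⟩ | ⟨h1, -, -⟩
  · obtain ⟨o, ho⟩ := P.exists_blk_eq i
    have hH : ∀ a, P.blk a = i → P.Herm a := fun a ha => ⟨by rw [ha, h1], by rw [ha, h2]⟩
    have hadj : ∀ a b, P.blk a = i → P.blk b = P.swap i → P.Adj a b := fun a b ha hb => by
      rw [Adj, ha, hb]
    refine G.exists_blockUnits_of_good ho (ho.trans h1.symm)
      (fun a b ha hb => ⟨hadj a b ha hb, fun _ => hH a ha⟩) fun a b ha hb => ?_
    exact G.unit_tern_of_herm (hH o ho) (hadj a o ha (ho.trans h1.symm)) (hadj o b ho hb)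
  · exact G.exists_blockUnits_of_symplectic h1 h2 h3
  · obtain ⟨o, ho⟩ := P.exists_blk_eq i
    obtain ⟨o', ho'⟩ := P.exists_blk_eq (P.swap i)
    have hnh : ∀ a, P.blk a = i → ¬ P.Herm a := fun a ha h => h1 (by rw [← ha]; exact h.1)
    have hg : ∀ a b, P.blk a = i → P.blk b = P.swap i → P.Good a b := fun a b ha hb => by
      refine .of_ne (by rw [Adj, ha, hb]) ?_
      rintro rfl
      exact h1 (hb.symm.trans ha)
    exact G.exists_blockUnits_of_good ho ho' hg fun a b ha hb =>
      G.unit_tern (hnh a ha) (hg a o' ha ho') (hg o o' ho ho') (hg o b ho hb) (hg a b ha hb)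

/-- The images of the matrix units extend to a TRO-morphism. -/
theorem exists_hom (S : TRO B) (hS : ∀ a b, P.Good a b → unit u t a b ∈ S.toSubmodule) :
    ∃ φ : TROHom P.tro S, ∀ a b (h : P.Good a b),
      (φ ⟨Matrix.single a b 1, P.single_mem_tro h.1 1⟩ : B) = unit u t a b := by
  have E : ∀ i, BlockUnits u t i := fun i => (G.exists_blockUnits i).some
  let l : P.R → B := fun a => (E (P.blk a)).l a
  let r : P.R → B := fun b => (E (P.swap (P.blk b))).r b
  let k : P.ι → B := fun i => (E i).k
  have hswap : ∀ b, P.blk b = P.swap (P.swap (P.blk b)) := fun b => (P.swap_swap _).symm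
  have hl : ∀ a c, star (l a) * l c = if a = c then k (P.blk a) else 0 := by
    intro a c
    split_ifs with h
    · subst h; exact (E (P.blk a)).star_l_mul_l a rfl
    · obtain ⟨b, y, hb, e⟩ := (E (P.blk a)).l_eq a rfl
      obtain ⟨b', y', hb', e'⟩ := (E (P.blk c)).l_eq c rfl
      change star ((E (P.blk a)).l a) * (E (P.blk c)).l c = 0
      rw [e, e', star_mul, mul_assoc, ← mul_assoc (star (unit u t a b)),
        G.star_unit_mul_unit hb hb' h, zero_mul, mul_zero]
  have hr : ∀ b d, r b * star (r d) = if b = d then k (P.swap (P.blk b)) else 0 := by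
    intro b d
    split_ifs with h
    · subst h; exact (E (P.swap (P.blk b))).r_mul_star_r b (hswap b)
    · obtain ⟨a, y, ha, e⟩ := (E (P.swap (P.blk b))).r_eq b (hswap b)
      obtain ⟨a', y', ha', e'⟩ := (E (P.swap (P.blk d))).r_eq d (hswap d)
      change (E (P.swap (P.blk b))).r b * star ((E (P.swap (P.blk d))).r d) = 0
      rw [e, e', star_mul, mul_assoc, ← mul_assoc (unit u t a b),
        G.unit_mul_star_unit ha ha' h, zero_mul, mul_zero]
  have hr' : ∀ a b, P.Adj a b → r b = (E (P.blk a)).r b := fun a b h => by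
    have : P.blk a = P.swap (P.blk b) := h.symm
    change (E (P.swap (P.blk b))).r b = _
    rw [this]
  refine ⟨P.homOfUnits S hl hr (fun a => (E (P.blk a)).l_mul_k a rfl) ?_, ?_⟩
  · intro a b h
    rw [hr' a b h]
    exact (E (P.blk a)).mem S hS a b rfl h
  · intro a b h
    rw [coe_homOfUnits, unitsFun_single, one_smul, hr' a b h.1]
    exact (E (P.blk a)).l_mul_r a b rfl h.1 h

end Grid

end

/-! ### The universal TRO of a triple of patterned matrices -/

noncomputable section

open TripleProduct
open scoped Matrix.Norms.L2Operator

namespace Pattern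

variable (P : Pattern.{u})

/-- The triple of patterned matrices, the fixed points of the canonical involution. -/
def fixed : Submodule ℂ (Matrix P.R P.R ℂ) where
  carrier := {X | X ∈ P.tro.toSubmodule ∧ P.anti X = X}
  add_mem' {X Y} hX hY := ⟨add_mem hX.1 hY.1, by
    conv_rhs => rw [← hX.2, ← hY.2]
    ext a b; simp [anti_apply, mul_add]⟩
  zero_mem' := ⟨zero_mem _, by ext a b; simp [anti_apply]⟩
  smul_mem' c X hX := ⟨P.tro.toSubmodule.smul_mem c hX.1, by
    conv_rhs => rw [← hX.2]
    ext a b; simp [anti_apply]; ring⟩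

/-- The symmetrization of the matrix unit at the position `(a, b)`. -/
def pair (a b : P.R) : Matrix P.R P.R ℂ :=
  Matrix.single a b 1 + P.sign (P.blk a) • Matrix.single b a 1

variable {P}

theorem pair_mem {a b : P.R} (h : P.Adj a b) : P.pair a b ∈ P.fixed := by
  refine ⟨add_mem (P.single_mem_tro h 1)
    (P.tro.toSubmodule.smul_mem _ (P.single_mem_tro h.symm 1)), ?_⟩
  have e := h.sign_eq
  have e2 := P.sign_mul_self (P.blk a)
  ext c d
  simp only [anti_apply, pair, Matrix.add_apply, Matrix.smul_apply, Matrix.single_apply,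
    smul_eq_mul, mul_add]
  rw [add_comm]
  congr 1
  · by_cases h1 : b = d ∧ a = c
    · obtain ⟨rfl, rfl⟩ := h1; simp [e2]
    · have h2 : ¬ (a = c ∧ b = d) := fun h => h1 h.symm
      simp [h1, h2]
  · by_cases h1 : a = d ∧ b = c
    · obtain ⟨rfl, rfl⟩ := h1; simp [e]
    · have h2 : ¬ (b = c ∧ a = d) := fun h => h1 h.symm
      simp [h1, h2]

theorem single_mem_fixed {a : P.R} (h : P.Herm a) : Matrix.single a a 1 ∈ P.fixed := by
  refine ⟨P.single_mem_tro h.adj_self 1, ?_⟩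
  ext c d
  simp only [anti_apply, Matrix.single_apply]
  by_cases h1 : a = d ∧ a = c
  · obtain ⟨rfl, rfl⟩ := h1; simp [h.2]
  · have h2 : ¬ (a = c ∧ a = d) := fun h => h1 h.symm
    simp [h1, h2]

theorem star_single (a b : P.R) : star (Matrix.single a b (1 : ℂ)) = Matrix.single b a 1 := by
  rw [Matrix.star_eq_conjTranspose, Matrix.conjTranspose_single, star_one]

/-- The images of the symmetrized matrix units under a triple morphism form a grid. -/
theorem grid_of_triple {B : Type v} [NonUnitalCStarAlgebra B] (p : Matrix P.R P.R ℂ →ₗ[ℂ] B)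
    (hp : ∀ X ∈ P.fixed, ∀ Y ∈ P.fixed, ∀ Z ∈ P.fixed, p (X * star Y * Z + Z * star Y * X) =
      p X * star (p Y) * p Z + p Z * star (p Y) * p X) :
    Grid P (fun a b => p (P.pair a b)) (fun a => p (Matrix.single a a 1)) := by
  -- every relation of the grid is the image of a relation between matrices
  have half : ∀ {x y : B}, x + x = y + y → x = y := fun {x y} h => by
    have : (x - y) + (x - y) = 0 := by rw [← sub_eq_zero.mpr h]; abel
    exact sub_eq_zero.mp (two_nsmul_eq_zero_of_module this)
  constructor
  · intro a b h
    rw [← map_smul]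
    congr 1
    rw [pair, pair, h.sign_eq, smul_add, smul_smul, P.sign_mul_self, one_smul, add_comm]
  · intro a b h h1
    refine half ?_
    rw [← hp _ (pair_mem h) _ (pair_mem h) _ (pair_mem h), ← map_add]
    congr 1
    rcases P.sign_eq (P.blk a) with e | e <;>
    simp [pair, mul_add, add_mul, e, h1, h1.symm]
  · intro a b c h h' h1 h2 h3
    rw [← hp _ (pair_mem h) _ (pair_mem h) _ (pair_mem h')]
    congr 1
    rcases P.sign_eq (P.blk a) with e | e <;>
    simp [pair, mul_add, add_mul, e, h1, h1.symm, h2, h3]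
  · intro a b c d h h' h1 h2 h3 h4 h5 h6
    rw [← hp _ (pair_mem h) _ (pair_mem h) _ (pair_mem h'), ← map_zero p]
    congr 1
    simp [pair, mul_add, add_mul, h1, h1.symm, h3, h4, h5, h6]
  · intro a b c d h h' h'' h1 h2 h3 h4 h5 h6
    rw [← hp _ (pair_mem h) _ (pair_mem h') _ (pair_mem h'')]
    congr 1
    have e1 : P.sign (P.blk c) = P.sign (P.blk a) := by rw [← h'.sign_eq, h.sign_eq]
    rcases P.sign_eq (P.blk a) with e | e <;>
    simp [pair, mul_add, add_mul, e, e1, h1.symm, h2.symm, h4, h4.symm, h5, h6]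
  · intro a h
    refine half ?_
    have h0 := single_mem_fixed h
    rw [← hp _ h0 _ h0 _ h0, ← map_add]
    congr 1
    simp [star_single]
  · intro a b h h' h1
    have h0 := single_mem_fixed h
    rw [← hp _ h0 _ h0 _ (pair_mem h')]
    congr 1
    simp [star_single, pair, mul_add, add_mul, h1, h1.symm]
  · intro a b h h' h1
    have h0 := single_mem_fixed h
    rw [← hp _ h0 _ h0 _ (single_mem_fixed h'), ← map_zero p]
    congr 1
    simp [star_single, h1, h1.symm]
  · intro a b c h h' h1 h2 h3
    have h0 := single_mem_fixed h
    rw [← hp _ h0 _ h0 _ (pair_mem h'), ← map_zero p]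
    congr 1
    simp [star_single, pair, mul_add, add_mul, h2, h2.symm, h3,
      h3.symm]
  · intro a o b h h' h'' h1 h2 h3
    rw [← hp _ (pair_mem h') _ (single_mem_fixed h) _ (pair_mem h'')]
    congr 1
    have e1 : P.sign (P.blk a) = 1 := by rw [← h'.sign_eq, h.2]
    simp [star_single, pair, mul_add, add_mul, h.2, e1, h1, h1.symm, h2,
      h2.symm]
  · intro a o h h' h1
    refine half ?_
    rw [← hp _ (pair_mem h') _ (single_mem_fixed h) _ (pair_mem h'), ← map_add]
    congr 1
    have e1 : P.sign (P.blk a) = 1 := by rw [← h'.sign_eq, h.2]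
    simp [star_single, pair, mul_add, add_mul, e1, h1, h1.symm]
  · intro a b h h' h1
    rw [← hp _ (pair_mem h') _ (pair_mem h') _ (single_mem_fixed h), ← map_add]
    congr 1
    simp [pair, mul_add, add_mul, h.2, h1, h1.symm]

/-- The patterned matrices are the TRO generated by the triple. -/
theorem tro_le_of_fixed_le {N : Submodule ℂ (Matrix P.R P.R ℂ)}
    (hN : ∀ x ∈ N, ∀ y ∈ N, ∀ z ∈ N, x * star y * z ∈ N) (h : P.fixed ≤ N) :
    P.tro.toSubmodule ≤ N := by
  have key : ∀ a b, P.Adj a b → a ≠ b → Matrix.single a b 1 ∈ N := by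
    intro a b hab h1
    by_cases ha : P.Herm a
    · have h0 := h (single_mem_fixed ha)
      convert hN _ h0 _ h0 _ (h (pair_mem hab)) using 1
      simp [star_single, pair, mul_add, h1]
    · obtain ⟨d, hd, h2, h3⟩ := exists_adj_ne ha b
      have h0 := h (pair_mem hd)
      convert hN _ h0 _ h0 _ (h (pair_mem hab)) using 1
      rcases P.sign_eq (P.blk a) with e | e <;>
      simp [pair, mul_add, add_mul, e, h1, h2, h2.symm, h3]
  intro X hX
  rw [Matrix.matrix_eq_sum_single X]
  refine sum_mem fun a _ => sum_mem fun b _ => ?_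
  by_cases hab : P.Adj a b
  · suffices Matrix.single a b 1 ∈ N by
      have h1 := N.smul_mem (X a b) this
      rwa [Matrix.smul_single, smul_eq_mul, mul_one] at h1
    by_cases h1 : a = b
    · subst h1
      by_cases ha : P.Herm a
      · exact h (single_mem_fixed ha)
      -- in a symplectic factor, a diagonal matrix unit is a product around a quadrangle
      · obtain ⟨b, hb, h2, -⟩ := exists_adj_ne ha a
        obtain ⟨c, hc, h3, h4, -⟩ := exists_adj_avoiding ha hb hb hb
        have hca : P.Adj c a := adj_of_blk_eq hab (blk_eq_of_adj hc.symm hb)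
        convert hN _ (key a b hb h2.symm) _ (key c b hc.symm h4) _ (key c a hca h3) using 1
        simp [star_single]
    · exact key a b hab h1
  · rw [hX a b hab, Matrix.single_zero]
    exact zero_mem _

/-- Every matrix of the triple is a combination of symmetrized matrix units. -/
theorem two_smul_eq_sum_pair {X : Matrix P.R P.R ℂ} (hX : X ∈ P.fixed) :
    (2 : ℂ) • X = ∑ a, ∑ b, X a b • P.pair a b := by
  have h1 : X = ∑ a, ∑ b, X a b • Matrix.single a b (1 : ℂ) := by
    conv_lhs => rw [Matrix.matrix_eq_sum_single X]
    simp
  have h2 : X = ∑ a, ∑ b, X a b • P.sign (P.blk a) • Matrix.single b a (1 : ℂ) := by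
    rw [Finset.sum_comm]
    conv_lhs => rw [h1]
    refine Finset.sum_congr rfl fun a _ => Finset.sum_congr rfl fun b _ => ?_
    rw [smul_smul]
    congr 1
    conv_lhs => rw [← hX.2, anti_apply]
    by_cases h : P.Adj a b
    · rw [h.sign_eq, mul_comm]
    · rw [hX.1 b a fun h' => h h'.symm, mul_zero, zero_mul]
  rw [two_smul]
  conv_lhs => rw [h1]
  conv_lhs => arg 2; rw [← h1, h2]
  simp only [pair, smul_add, Finset.sum_add_distrib]

/-- Triple morphisms on the patterned triple extend to TRO-morphisms. -/
theorem exists_hom_of_triple {B : Type v} [NonUnitalCStarAlgebra B] (S : TRO B)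
    (p : Matrix P.R P.R ℂ →ₗ[ℂ] B) (hS : ∀ X ∈ P.fixed, p X ∈ S.toSubmodule)
    (hp : ∀ X ∈ P.fixed, ∀ Y ∈ P.fixed, ∀ Z ∈ P.fixed, p (X * star Y * Z + Z * star Y * X) =
      p X * star (p Y) * p Z + p Z * star (p Y) * p X) :
    ∃ φ : TROHom P.tro S, ∀ (X : Matrix P.R P.R ℂ) (hX : X ∈ P.fixed),
      (φ ⟨X, hX.1⟩ : B) = p X := by
  have G := grid_of_triple p hp
  obtain ⟨φ, hφ⟩ := G.exists_hom S fun a b h => by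
    by_cases h1 : a = b
    · subst h1
      rw [Grid.unit_self]
      exact hS _ (single_mem_fixed (h.2 rfl))
    · by_cases ha : P.Herm a
      · rw [Grid.unit_of_herm ha h1]
        have h0 := hS _ (single_mem_fixed ha)
        exact S.tern_mem h0 h0 (hS _ (pair_mem h.1))
      · obtain ⟨d, hd, h2, h3⟩ := exists_adj_ne ha b
        rw [G.unit_of_not_herm ha h.1 hd h1 h2 h3]
        have h0 := hS _ (pair_mem hd)
        exact S.tern_mem h0 h0 (hS _ (pair_mem h.1))
  -- `φ` and `p` agree on the symmetrized matrix units, which span the triple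
  obtain ⟨q, hq⟩ := LinearMap.exists_extend
    (S.toSubmodule.subtype ∘ₗ (φ.toContinuousLinearMap : P.tro →ₗ[ℂ] S))
  have hq' : ∀ X (hX : X ∈ P.tro.toSubmodule), q X = (φ ⟨X, hX⟩ : B) := fun X hX =>
    LinearMap.congr_fun hq ⟨X, hX⟩
  have hpair : ∀ a b, P.Adj a b → q (P.pair a b) = p (P.pair a b) := by
    intro a b hab
    by_cases h1 : a = b
    · subst h1
      by_cases ha : P.Herm a
      · rw [pair, ha.2, one_smul, map_add, map_add, hq' _ (P.single_mem_tro hab 1),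
          hφ a a ⟨hab, fun _ => ha⟩, Grid.unit_self]
      · have : P.sign (P.blk a) = -1 :=
          (P.sign_eq _).resolve_left fun h => ha ⟨Eq.symm hab, h⟩
        rw [pair, this, neg_one_smul, add_neg_cancel, map_zero, map_zero]
    · have g := Good.of_ne hab h1
      rw [G.eq_unit_add hab h1, pair, map_add, map_smul, hq' _ (P.single_mem_tro hab 1),
        hq' _ (P.single_mem_tro hab.symm 1), hφ a b g, hφ b a g.symm]
  refine ⟨φ, fun X hX => ?_⟩
  rw [← hq' X hX.1]
  refine smul_right_injective B (two_ne_zero (α := ℂ)) ?_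
  change (2 : ℂ) • q X = (2 : ℂ) • p X
  rw [← map_smul, ← map_smul, two_smul_eq_sum_pair hX]
  simp only [map_sum, map_smul]
  refine Finset.sum_congr rfl fun a _ => Finset.sum_congr rfl fun b _ => ?_
  by_cases hab : P.Adj a b
  · rw [hpair a b hab]
  · rw [hX.1 a b hab, zero_smul, zero_smul]

/-- TRO-morphisms on the patterned matrices are determined by their values on the triple. -/
theorem hom_ext {B : Type v} [NonUnitalCStarAlgebra B] {S : TRO B} {φ ψ : TROHom P.tro S}
    (h : ∀ X (hX : X ∈ P.fixed), φ ⟨X, hX.1⟩ = ψ ⟨X, hX.1⟩) : φ = ψ := by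
  let N : Submodule ℂ P.tro := LinearMap.eqLocus φ.toContinuousLinearMap.toLinearMap
    ψ.toContinuousLinearMap.toLinearMap
  have hN : ∀ x, x ∈ N ↔ φ x = ψ x := fun x => Iff.rfl
  have hM : ∀ {X}, X ∈ N.map P.tro.toSubmodule.subtype ↔ ∃ hX, φ ⟨X, hX⟩ = ψ ⟨X, hX⟩ := by
    intro X
    constructor
    · rintro ⟨x, hx, rfl⟩; exact ⟨x.2, hx⟩
    · rintro ⟨hX, h⟩; exact ⟨⟨X, hX⟩, h, rfl⟩
  have key : P.tro.toSubmodule ≤ N.map P.tro.toSubmodule.subtype := by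
    refine tro_le_of_fixed_le ?_ fun X hX => hM.mpr ⟨hX.1, h X hX⟩
    intro x hx y hy z hz
    obtain ⟨hx, ex⟩ := hM.mp hx
    obtain ⟨hy, ey⟩ := hM.mp hy
    obtain ⟨hz, ez⟩ := hM.mp hz
    refine hM.mpr ⟨P.tro.tern_mem hx hy hz, ?_⟩
    have h1 := φ.map_tern ⟨x, hx⟩ ⟨y, hy⟩ ⟨z, hz⟩
    rw [ex, ey, ez, ← ψ.map_tern] at h1
    exact h1
  refine TROHom.ext' fun x => ?_
  obtain ⟨_, h⟩ := hM.mp (key x.2)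
  exact h

/-- An isomorphism of a triple `Z` onto the triple of patterned matrices. -/
structure Model (P : Pattern.{u}) (Z : Type w) [NormedAddCommGroup Z] [NormedSpace ℂ Z]
    [TripleProduct Z] where
  ρ : Z →ₗ[ℂ] Matrix P.R P.R ℂ
  injective : Function.Injective ρ
  mem_fixed : ∀ z, ρ z ∈ P.fixed
  exists_eq : ∀ X ∈ P.fixed, ∃ z, ρ z = X
  map_triple : ∀ x y z, ρ (triple x y z) =
    (1 / 2 : ℂ) • (ρ x * star (ρ y) * ρ z + ρ z * star (ρ y) * ρ x)

namespace Model

variable {Z : Type w} [NormedAddCommGroup Z] [NormedSpace ℂ Z] [TripleProduct Z] (M : P.Model Z)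

include M in
theorem finiteDimensional : FiniteDimensional ℂ Z := FiniteDimensional.of_injective M.ρ M.injective

/-- The embedding of the triple into the TRO of patterned matrices. -/
def toJBHom : JBHom Z P.tro where
  toContinuousLinearMap :=
    haveI := M.finiteDimensional
    LinearMap.toContinuousLinearMap (M.ρ.codRestrict P.tro.toSubmodule fun z => (M.mem_fixed z).1)
  map_triple' x y z := Subtype.ext (M.map_triple x y z)

/-- The patterned matrices are a universal TRO. -/
def universal : UniversalTRO.{u} Z where
  Ambient := Matrix P.R P.R ℂ
  tro := P.tro
  ρ := M.toJBHom
  existsUnique_lift B _ S π := by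
    obtain ⟨g, hg⟩ := LinearMap.exists_leftInverse_of_injective M.ρ
      (LinearMap.ker_eq_bot.mpr M.injective)
    have hg' : ∀ z, g (M.ρ z) = z := LinearMap.congr_fun hg
    obtain ⟨φ, hφ⟩ := exists_hom_of_triple S
      (S.toSubmodule.subtype ∘ₗ (π.toContinuousLinearMap : Z →ₗ[ℂ] S) ∘ₗ g)
      (fun X _ => (π.toContinuousLinearMap (g X)).2) (by
        intro X hX Y hY W hW
        obtain ⟨x, rfl⟩ := M.exists_eq X hX
        obtain ⟨y, rfl⟩ := M.exists_eq Y hY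
        obtain ⟨w, rfl⟩ := M.exists_eq W hW
        have h1 : M.ρ x * star (M.ρ y) * M.ρ w + M.ρ w * star (M.ρ y) * M.ρ x =
            M.ρ ((2 : ℂ) • triple x y w) := by
          rw [map_smul, M.map_triple, smul_smul]; norm_num
        have h2 : (π.toContinuousLinearMap (triple x y w) : B) = (1 / 2 : ℂ) •
            ((π.toContinuousLinearMap x : B) * star (π.toContinuousLinearMap y : B) *
              (π.toContinuousLinearMap w : B) + (π.toContinuousLinearMap w : B) *
              star (π.toContinuousLinearMap y : B) * (π.toContinuousLinearMap x : B)) :=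
          congrArg Subtype.val (π.map_triple' x y w)
        rw [h1]
        simp only [LinearMap.comp_apply, hg', map_smul]
        refine (congrArg ((2 : ℂ) • ·) h2).trans ?_
        rw [smul_smul]; norm_num)
    refine ⟨φ, fun z => Subtype.ext ?_, fun ψ hψ => hom_ext fun X hX => ?_⟩
    · refine (hφ (M.ρ z) (M.mem_fixed z)).trans ?_
      exact congrArg (fun z => (π.toContinuousLinearMap z : B)) (hg' z)
    · obtain ⟨z, rfl⟩ := M.exists_eq X hX
      refine (hψ z).trans (Subtype.ext (Eq.symm ?_))
      refine (hφ (M.ρ z) hX).trans ?_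
      exact congrArg (fun z => (π.toContinuousLinearMap z : B)) (hg' z)

end Model

end Pattern
end

/-! ### Coordinates of a universal TRO -/

noncomputable section

open TripleProduct
open scoped Matrix.Norms.L2Operator

namespace UniversalTRO

variable {Z : Type v} [NormedAddCommGroup Z] [NormedSpace ℂ Z] [TripleProduct Z]
  (U : UniversalTRO.{u} Z) {B : Type u} [NonUnitalCStarAlgebra B] {S : TRO B}

theorem lift_ρ (π : JBHom Z S) (z : Z) : U.lift π (U.ρ.toFun z) = π.toFun z :=
  (U.existsUnique_lift B S π).choose_spec.1 z

variable {U} in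
theorem hom_ext {φ ψ : TROHom U.tro S} (h : ∀ z, φ (U.ρ.toFun z) = ψ (U.ρ.toFun z)) : φ = ψ :=
  (U.existsUnique_lift B S (ψ.toJBHom.comp U.ρ)).unique h (fun _ => rfl)

theorem opIso_ρ (z : Z) : (U.opIso (U.ρ.toFun z) : U.Ambientᵐᵒᵖ).unop = U.ρ.toFun z :=
  congrArg (fun t : U.tro.op => (t : U.Ambientᵐᵒᵖ).unop) (U.lift_ρ U.ρop z)

end UniversalTRO

namespace TROHom

variable {A B : Type*} [NonUnitalCStarAlgebra A] [NonUnitalCStarAlgebra B] {T : TRO A} {S : TRO B}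

/-- If the left C*-algebra of `S` is generated by the products `x y*` as an additive group, so is
the left C*-algebra of a TRO isomorphic to `S`. -/
theorem exists_left_eq (φ : TROHom T S) (hφ : Function.Surjective φ) {p : T.left → Prop}
    (h0 : p 0) (hadd : ∀ a b, p a → p b → p (a + b))
    (hgen : ∀ x y : T, p ⟨(x : A) * star (y : A), T.mul_star_mem_left x.2 y.2⟩) {X : B}
    (hX : X ∈ AddSubmonoid.closure {M | ∃ Y ∈ S.toSubmodule, ∃ Y' ∈ S.toSubmodule,
      Y * star Y' = M}) : ∃ a, p a ∧ (φ.left a : B) = X := by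
  induction hX using AddSubmonoid.closure_induction with
  | mem X hX =>
    obtain ⟨Y, hY, Y', hY', rfl⟩ := hX
    obtain ⟨x, hx⟩ := hφ ⟨Y, hY⟩
    obtain ⟨y, hy⟩ := hφ ⟨Y', hY'⟩
    exact ⟨_, hgen x y, by rw [φ.left_mul_star, hx, hy]⟩
  | zero => exact ⟨0, h0, by rw [map_zero]; rfl⟩
  | add X Y _ _ hX hY =>
    obtain ⟨a, ha, rfl⟩ := hX
    obtain ⟨b, hb, rfl⟩ := hY
    exact ⟨a + b, hadd a b ha hb, by rw [map_add]; rfl⟩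

/-- Coordinates of the left C*-algebra of a TRO that is isomorphic to a TRO of matrices. -/
def leftCoordinates {α ι : Type*} [Fintype α] [DecidableEq α] {f : α → ι}
    {S : TRO (Matrix α α ℂ)} (φ : TROHom T S) (hφ : Function.Bijective φ)
    (hS : ∀ X ∈ S.left, Matrix.IsBlockDiag f f X)
    (hS' : ∀ X, Matrix.IsBlockDiag f f X → X ∈ AddSubmonoid.closure {M | ∃ Y ∈ S.toSubmodule,
      ∃ Y' ∈ S.toSubmodule, Y * star Y' = M}) : BlockCoordinates T.left f where
  ψ := (NonUnitalStarSubalgebraClass.subtype S.left).comp φ.left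
  injective := Subtype.val_injective.comp (φ.left_injective hφ.1)
  isBlockDiag a := hS _ (φ.left a).2
  exists_eq X hX := by
    obtain ⟨a, -, h⟩ := φ.exists_left_eq hφ.2 (p := fun _ => True) trivial
      (fun _ _ _ _ => trivial) (fun _ _ => trivial) (hS' X hX)
    exact ⟨a, h⟩

theorem conj_surjective (φ : TROHom T S) (h : Function.Surjective φ) :
    Function.Surjective φ.conj := by
  intro y
  obtain ⟨x, hx⟩ := h ⟨star (y : B), y.2⟩
  refine ⟨⟨star (x : A), T.star_mem_conj x.2⟩, Subtype.ext ?_⟩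
  rw [φ.coe_conj x.2, Subtype.coe_eta, hx]
  exact star_star _

end TROHom

namespace Pattern.Model

variable {P : Pattern.{u}} {Z : Type v} [NormedAddCommGroup Z] [NormedSpace ℂ Z]
  [TripleProduct Z] (M : P.Model Z) (U : UniversalTRO.{u} Z)

/-- The isomorphism of a universal TRO with the TRO of patterned matrices. -/
def iso : TROHom U.tro P.tro := U.lift M.toJBHom

/-- The inverse of `iso`. -/
def inv : TROHom P.tro U.tro := M.universal.lift U.ρ

theorem iso_ρ (z : Z) : (M.iso U (U.ρ.toFun z) : Matrix P.R P.R ℂ) = M.ρ z :=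
  congrArg Subtype.val (U.lift_ρ M.toJBHom z)

theorem inv_toJBHom (z : Z) : M.inv U (M.toJBHom.toFun z) = U.ρ.toFun z :=
  M.universal.lift_ρ U.ρ z

theorem inv_iso (x : U.tro) : M.inv U (M.iso U x) = x := by
  have : (M.inv U).comp (M.iso U) = TROHom.id U.tro := UniversalTRO.hom_ext fun z => by
    refine (congrArg (M.inv U) (U.lift_ρ M.toJBHom z)).trans (M.inv_toJBHom U z)
  exact congrArg (fun φ : TROHom U.tro U.tro => φ x) this

theorem iso_inv (x : P.tro) : M.iso U (M.inv U x) = x := by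
  have : (M.iso U).comp (M.inv U) = TROHom.id P.tro :=
    UniversalTRO.hom_ext (U := M.universal) fun z =>
      (congrArg (M.iso U) (M.inv_toJBHom U z)).trans (U.lift_ρ M.toJBHom z)
  exact congrArg (fun φ : TROHom P.tro P.tro => φ x) this

theorem iso_bijective : Function.Bijective (M.iso U) :=
  ⟨Function.LeftInverse.injective (M.inv_iso U), Function.RightInverse.surjective (M.iso_inv U)⟩

/-- The isomorphism intertwines the canonical involutions. -/
theorem iso_anti (x : U.tro) : (M.iso U (U.anti x) : Matrix P.R P.R ℂ) = P.anti (M.iso U x) := by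
  have : (M.iso U).op.comp U.opIso = P.antiHom.comp (M.iso U) := UniversalTRO.hom_ext fun z => by
    apply Subtype.ext
    apply MulOpposite.unop_injective
    change (M.iso U (U.anti (U.ρ.toFun z)) : Matrix P.R P.R ℂ) = P.anti (M.iso U (U.ρ.toFun z))
    have h : U.anti (U.ρ.toFun z) = U.ρ.toFun z := Subtype.ext (U.opIso_ρ z)
    rw [h, iso_ρ]
    exact (M.mem_fixed z).2.symm
  exact congrArg (fun φ : TROHom U.tro P.tro.op => (φ x : (Matrix P.R P.R ℂ)ᵐᵒᵖ).unop) this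

/-- Coordinates of the left C*-algebra of a universal TRO. -/
def leftCoord : BlockCoordinates U.tro.left P.blk :=
  (M.iso U).leftCoordinates (M.iso_bijective U) (fun _ h => P.mem_left_iff.mp h)
    fun _ h => P.mem_closure_of_isBlockDiag h

/-- Coordinates of the right C*-algebra of a universal TRO. -/
def rightCoord : BlockCoordinates U.tro.right P.blk :=
  (M.iso U).conj.leftCoordinates
    ⟨(M.iso U).conj_injective (M.iso_bijective U).1, (M.iso U).conj_surjective (M.iso_bijective U).2⟩
    (fun _ h => P.mem_right_iff.mp h)
    fun _ h => by rw [conj_tro]; exact P.mem_closure_of_isBlockDiag h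

theorem leftCoord_mul_star (x y : U.tro) :
    (M.leftCoord U).ψ ⟨(x : U.Ambient) * star (y : U.Ambient), U.tro.mul_star_mem_left x.2 y.2⟩ =
      (M.iso U x : Matrix P.R P.R ℂ) * star (M.iso U y : Matrix P.R P.R ℂ) :=
  (M.iso U).left_mul_star x y

theorem rightCoord_star_mul (x y : U.tro) :
    (M.rightCoord U).ψ ⟨star (x : U.Ambient) * (y : U.Ambient), U.tro.star_mul_mem_right x.2 y.2⟩ =
      star (M.iso U x : Matrix P.R P.R ℂ) * (M.iso U y : Matrix P.R P.R ℂ) :=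
  (M.iso U).right_star_mul x y

include M in
theorem left_induction {p : U.tro.left → Prop} (h0 : p 0) (hadd : ∀ a b, p a → p b → p (a + b))
    (hgen : ∀ x y : U.tro,
      p ⟨(x : U.Ambient) * star (y : U.Ambient), U.tro.mul_star_mem_left x.2 y.2⟩)
    (a : U.tro.left) : p a := by
  obtain ⟨b, hb, e⟩ := (M.iso U).exists_left_eq (M.iso_bijective U).2 h0 hadd hgen
    (P.mem_closure_of_isBlockDiag ((M.leftCoord U).isBlockDiag a))
  have : b = a := (M.leftCoord U).injective e
  rwa [← this]

/-- On the left C*-algebra, the canonical involution is the transposition. -/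
theorem rightCoord_unop (a : U.tro.left) :
    (M.rightCoord U).ψ (U.tro.opLeft (U.opIso.left a)).unop = ((M.leftCoord U).ψ a)ᵀ := by
  induction a using M.left_induction U with
  | h0 => simp
  | hadd a b ha hb => simp only [map_add, MulOpposite.unop_add, Matrix.transpose_add, ha, hb]
  | hgen x y =>
    have h : (U.tro.opLeft (U.opIso.left ⟨(x : U.Ambient) * star (y : U.Ambient),
        U.tro.mul_star_mem_left x.2 y.2⟩)).unop =
        ⟨star (U.anti y : U.Ambient) * (U.anti x : U.Ambient),
          U.tro.star_mul_mem_right (U.anti y).2 (U.anti x).2⟩ :=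
      Subtype.ext (congrArg MulOpposite.unop (U.opIso.left_mul_star x y))
    rw [h, rightCoord_star_mul, leftCoord_mul_star, iso_anti, iso_anti, anti_eq, anti_eq, star_mul,
      star_signDiag, Matrix.mul_assoc, ← Matrix.mul_assoc (Matrix.diagonal _), signDiag_mul_self,
      Matrix.one_mul, Matrix.transpose_mul]
    rfl

end Pattern.Model
end

/-! ### The canonical involution in coordinates -/

noncomputable section

open TripleProduct
open scoped Matrix.Norms.L2Operator

theorem KZero.ofProjection_congr {R : Type*} [NonUnitalRing R] [StarRing R] {p q : R}
    (h : p = q) (hp : p * p = p) (hp' : star p = p) (hq : q * q = q) (hq' : star q = q) :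
    KZero.ofProjection p hp hp' = KZero.ofProjection q hq hq' := by
  subst h; rfl

theorem Matrix.blockTrace_transpose {α ι : Type*} [Fintype α] [DecidableEq ι] (f : α → ι) (i : ι)
    (X : Matrix α α ℂ) : Matrix.blockTrace f i Xᵀ = Matrix.blockTrace f i X := rfl

theorem BlockCoordinates.dim_eq_sum {R α ι : Type*} [NonUnitalRing R] [StarRing R] [Module ℂ R]
    [Fintype α] [DecidableEq α] [DecidableEq ι] {f : α → ι} (c : BlockCoordinates R f)
    (p : MatrixProjection R) (i : ι) :
    c.dim i (KZero.ofMatrix p) = ∑ k, Matrix.blockTrace f i (c.ψ (p.mat k k)) :=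
  KZero.ofTrace_ofMatrix _ _ _

/-- An antihomomorphism which is the transposition in coordinates preserves the ranks. -/
theorem BlockCoordinates.dim_unop {R R' S α ι : Type*} [NonUnitalRing R] [StarRing R] [Module ℂ R]
    [NonUnitalRing R'] [StarRing R'] [Module ℂ R'] [NonUnitalRing S] [StarRing S] [Module ℂ S]
    [Fintype α] [DecidableEq α] [DecidableEq ι] {f : α → ι} (c : BlockCoordinates R f)
    (c' : BlockCoordinates R' f) (g : R →⋆ₙₐ[ℂ] S) (g' : S →⋆ₙₐ[ℂ] R'ᵐᵒᵖ)
    (h : ∀ a, c'.ψ (g' (g a)).unop = (c.ψ a)ᵀ) (x : KZero R) (i : ι) :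
    c'.dim i (KZero.unop (KZero.map g' (KZero.map g x))) = c.dim i x := by
  obtain ⟨p, q, rfl⟩ := KZero.exists_eq_sub x
  have key : ∀ p : MatrixProjection R, c'.dim i (KZero.ofMatrix ((p.map g).map g').unop) =
      c.dim i (KZero.ofMatrix p) := fun p => by
    rw [dim_eq_sum, dim_eq_sum]
    refine Finset.sum_congr rfl fun k _ => ?_
    rw [← Matrix.blockTrace_transpose f i (c.ψ _), ← h]
    rfl
  simp only [map_sub, KZero.map_ofMatrix, KZero.unop_ofMatrix, key]

namespace TRO

variable {A B : Type*} [NonUnitalCStarAlgebra A] [NonUnitalCStarAlgebra B] {T : TRO A} {S : TRO B}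

/-- A partial isometry in a TRO. -/
def IsTripotent (x : T) : Prop := (x : A) * star (x : A) * (x : A) = x

theorem isTripotent_of_triple {x : T} (h : triple x x x = x) : IsTripotent x := by
  have h1 : ((1 / 2 : ℂ) • (T.tern x x x + T.tern x x x) : T) = x := h
  rw [← two_smul ℂ, smul_smul] at h1
  norm_num at h1
  exact congrArg Subtype.val h1

theorem IsTripotent.triple_self {x : T} (h : IsTripotent x) : triple x x x = x := by
  have h1 : T.tern x x x = x := Subtype.ext h
  change (1 / 2 : ℂ) • (T.tern x x x + T.tern x x x) = x
  rw [h1, ← two_smul ℂ x, smul_smul]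
  norm_num

theorem IsTripotent.map {x : T} (h : IsTripotent x) (φ : TROHom T S) : IsTripotent (φ x) := by
  have h1 : T.tern x x x = x := Subtype.ext h
  rw [IsTripotent, ← φ.coe_map_tern, h1]

theorem IsTripotent.star_mul_star {x : T} (h : IsTripotent x) :
    star (x : A) * x * star (x : A) = star (x : A) := by
  simpa [mul_assoc] using congrArg star h

/-- The class of the projection `x x*`. -/
def IsTripotent.leftClass {x : T} (h : IsTripotent x) : KZero T.left :=
  KZero.ofProjection ⟨(x : A) * star (x : A), T.mul_star_mem_left x.2 x.2⟩
    (Subtype.ext (by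
      change (x : A) * star (x : A) * ((x : A) * star (x : A)) = _
      rw [← mul_assoc, h]))
    (Subtype.ext (by
      change star ((x : A) * star (x : A)) = _
      rw [star_mul, star_star]))

/-- The class of the projection `x* x`. -/
def IsTripotent.rightClass {x : T} (h : IsTripotent x) : KZero T.right :=
  KZero.ofProjection ⟨star (x : A) * (x : A), T.star_mul_mem_right x.2 x.2⟩
    (Subtype.ext (by
      change star (x : A) * (x : A) * (star (x : A) * (x : A)) = _
      rw [← mul_assoc, h.star_mul_star]))
    (Subtype.ext (by
      change star (star (x : A) * (x : A)) = _
      rw [star_mul, star_star]))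

theorem IsTripotent.map_leftClass {x : T} (h : IsTripotent x) (φ : TROHom T S) :
    KZero.map φ.left h.leftClass = (h.map φ).leftClass := by
  rw [leftClass, KZero.map_ofProjection]
  exact KZero.ofProjection_congr (Subtype.ext (φ.left_mul_star x x)) _ _ _ _

/-- In the linking algebra, the two supports of a partial isometry are equivalent. -/
theorem IsTripotent.map_rightIncl {x : T} (h : IsTripotent x) :
    KZero.map T.rightIncl h.rightClass = KZero.map T.leftIncl h.leftClass := by
  rw [rightClass, leftClass, KZero.map_ofProjection, KZero.map_ofProjection]
  refine KZero.ofProjection_eq _ _ _ _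
    ⟨!![0, star (x : A); 0, 0], zero_mem _, by simp, zero_mem _, zero_mem _⟩ ?_ ?_
  · apply Subtype.ext
    ext i j
    fin_cases i <;> fin_cases j <;> simp [Matrix.mul_apply, Matrix.star_apply, rightIncl]
  · apply Subtype.ext
    ext i j
    fin_cases i <;> fin_cases j <;> simp [Matrix.mul_apply, Matrix.star_apply, leftIncl]

/-- A pair of traces on the two C*-algebras of a TRO which agree on `x x*` and `x* x`, as an
additive map on the linking algebra. -/
def linkingMap {N : Type*} [AddCommGroup N] (s : T.left →+ N) (t : T.right →+ N) : T.linking →+ N where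
  toFun v := s ⟨v.1 1 1, v.2.2.2.2⟩ + t ⟨v.1 0 0, v.2.1⟩
  map_zero' := by
    change s 0 + t 0 = 0
    simp
  map_add' v w := by
    change s (⟨v.1 1 1, v.2.2.2.2⟩ + ⟨w.1 1 1, w.2.2.2.2⟩) +
      t (⟨v.1 0 0, v.2.1⟩ + ⟨w.1 0 0, w.2.1⟩) = _
    rw [map_add, map_add]
    abel

theorem linkingMap_mul_star {N : Type*} [AddCommGroup N] {s : T.left →+ N} {t : T.right →+ N}
    (hs : ∀ a, s (a * star a) = s (star a * a)) (ht : ∀ a, t (a * star a) = t (star a * a))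
    (hst : ∀ x : T, s ⟨(x : A) * star (x : A), T.mul_star_mem_left x.2 x.2⟩ =
      t ⟨star (x : A) * (x : A), T.star_mul_mem_right x.2 x.2⟩) (v : T.linking) :
    linkingMap s t (v * star v) = linkingMap s t (star v * v) := by
  obtain ⟨v, h1, h2, h3, h4⟩ := v
  let b : T.right := ⟨v 0 0, h1⟩
  let y : T := ⟨star (v 0 1), h2⟩
  let x : T := ⟨v 1 0, h3⟩
  let a : T.left := ⟨v 1 1, h4⟩
  have e1 : linkingMap s t (⟨v, h1, h2, h3, h4⟩ * star ⟨v, h1, h2, h3, h4⟩) =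
      s (⟨(x : A) * star (x : A), T.mul_star_mem_left x.2 x.2⟩ + a * star a) +
      t (b * star b + ⟨star (y : A) * (y : A), T.star_mul_mem_right y.2 y.2⟩) := by
    refine congrArg₂ (fun p q => s p + t q) (Subtype.ext ?_) (Subtype.ext ?_)
    · change (v * star v) 1 1 = v 1 0 * star (v 1 0) + v 1 1 * star (v 1 1)
      simp [Matrix.mul_apply, Matrix.star_apply]
    · change (v * star v) 0 0 = v 0 0 * star (v 0 0) + star (star (v 0 1)) * star (v 0 1)
      simp [Matrix.mul_apply, Matrix.star_apply]
  have e2 : linkingMap s t (star ⟨v, h1, h2, h3, h4⟩ * ⟨v, h1, h2, h3, h4⟩) =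
      s (⟨(y : A) * star (y : A), T.mul_star_mem_left y.2 y.2⟩ + star a * a) +
      t (star b * b + ⟨star (x : A) * (x : A), T.star_mul_mem_right x.2 x.2⟩) := by
    refine congrArg₂ (fun p q => s p + t q) (Subtype.ext ?_) (Subtype.ext ?_)
    · change (star v * v) 1 1 = star (v 0 1) * star (star (v 0 1)) + star (v 1 1) * v 1 1
      simp [Matrix.mul_apply, Matrix.star_apply]
    · change (star v * v) 0 0 = star (v 0 0) * v 0 0 + star (v 1 0) * v 1 0
      simp [Matrix.mul_apply, Matrix.star_apply]
  rw [e1, e2, map_add, map_add, map_add, map_add, hs, ht, hst, hst]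
  abel

end TRO

namespace Pattern.Model

open TRO

variable {P : Pattern.{u}} {Z : Type v} [NormedAddCommGroup Z] [NormedSpace ℂ Z]
  [TripleProduct Z] (M : P.Model Z) (U : UniversalTRO.{u} Z)

/-- The element of the universal TRO with the coordinates of a matrix unit. -/
def matrixUnit {a b : P.R} (h : P.Adj a b) : U.tro :=
  M.inv U ⟨Matrix.single a b 1, P.single_mem_tro h 1⟩

theorem iso_matrixUnit {a b : P.R} (h : P.Adj a b) :
    (M.iso U (M.matrixUnit U h) : Matrix P.R P.R ℂ) = Matrix.single a b 1 := by
  rw [matrixUnit, iso_inv]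

theorem isTripotent_matrixUnit {a b : P.R} (h : P.Adj a b) : IsTripotent (M.matrixUnit U h) := by
  refine IsTripotent.map ?_ (M.inv U)
  change Matrix.single a b (1 : ℂ) * star (Matrix.single a b (1 : ℂ)) * Matrix.single a b 1 = _
  simp [star_single]

theorem dim_leftClass {x : U.tro} (h : IsTripotent x) (i : P.ι) :
    (M.leftCoord U).dim i h.leftClass = Matrix.blockTrace P.blk i
      ((M.iso U x : Matrix P.R P.R ℂ) * star (M.iso U x : Matrix P.R P.R ℂ)) := by
  rw [IsTripotent.leftClass, BlockCoordinates.dim_ofProjection, leftCoord_mul_star]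

theorem dim_rightClass {x : U.tro} (h : IsTripotent x) (i : P.ι) :
    (M.rightCoord U).dim i h.rightClass = Matrix.blockTrace P.blk i
      (star (M.iso U x : Matrix P.R P.R ℂ) * (M.iso U x : Matrix P.R P.R ℂ)) := by
  rw [IsTripotent.rightClass, BlockCoordinates.dim_ofProjection, rightCoord_star_mul]

theorem _root_.Pattern.blockTrace_single_self (a : P.R) (j : P.ι) :
    Matrix.blockTrace P.blk j (Matrix.single a a 1) = if P.blk a = j then 1 else 0 := by
  rw [Matrix.blockTrace, Finset.sum_eq_single a]
  · simp
  · intro b _ hb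
    rw [Matrix.single_apply_of_row_ne hb.symm, ite_self]
  · simp

theorem dim_matrixUnit {a b : P.R} (h : P.Adj a b) (j : P.ι) :
    (M.leftCoord U).dim j (M.isTripotent_matrixUnit U h).leftClass =
      if P.blk a = j then 1 else 0 := by
  rw [dim_leftClass, iso_matrixUnit, star_single, Matrix.single_mul_single_same, one_mul,
    blockTrace_single_self]

theorem dim_matrixUnit_right {a b : P.R} (h : P.Adj a b) (j : P.ι) :
    (M.rightCoord U).dim j (M.isTripotent_matrixUnit U h).rightClass =
      if P.blk b = j then 1 else 0 := by
  rw [dim_rightClass, iso_matrixUnit, star_single, Matrix.single_mul_single_same, one_mul,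
    blockTrace_single_self]

include M in
theorem exists_leftIncl_eq (y : KZero U.tro.right) :
    ∃ x, KZero.map U.tro.leftIncl x = KZero.map U.tro.rightIncl y := by
  choose b hb using P.exists_blk_eq
  have hadj : ∀ i, P.Adj (b (P.swap i)) (b i) := fun i => by rw [Adj, hb, hb, P.swap_swap]
  obtain ⟨n, hn, -⟩ := (M.rightCoord U).exists_eq_sum
    (δ := fun i => (M.isTripotent_matrixUnit U (hadj i)).rightClass)
    (fun i j => by rw [dim_matrixUnit_right, hb]) y
  refine ⟨∑ i, n i • (M.isTripotent_matrixUnit U (hadj i)).leftClass, ?_⟩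
  rw [hn]
  simp only [map_sum, map_zsmul, IsTripotent.map_rightIncl]

theorem _root_.Pattern.blockTrace_mul_star {X : Matrix P.R P.R ℂ} (hX : X ∈ P.tro.toSubmodule)
    (i : P.ι) : Matrix.blockTrace P.blk i (X * star X) =
      Matrix.blockTrace P.blk (P.swap i) (star X * X) := by
  have h1 : ∀ a, (if P.blk a = i then (X * star X) a a else 0) =
      ∑ b, if P.blk a = i then X a b * star (X a b) else 0 := fun a => by
    split_ifs
    · rfl
    · simp
  have h2 : ∀ b, (if P.blk b = P.swap i then (star X * X) b b else 0) =
      ∑ a, if P.blk b = P.swap i then X a b * star (X a b) else 0 := fun b => by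
    split_ifs
    · exact Finset.sum_congr rfl fun a _ => mul_comm _ _
    · simp
  simp only [Matrix.blockTrace, h1, h2]
  rw [Finset.sum_comm]
  refine Finset.sum_congr rfl fun b _ => Finset.sum_congr rfl fun a _ => ?_
  by_cases h : P.Adj a b
  · have : P.blk a = i ↔ P.blk b = P.swap i := by
      rw [h]
      exact ⟨fun e => by rw [e], fun e => by
        rw [← P.swap_swap (P.blk a), e, P.swap_swap]⟩
    simp only [this]
  · rw [hX a b h]; simp

/-- Under the Morita isomorphism, the ranks of the blocks are permuted by `swap`. -/
theorem dim_morita (y : KZero U.tro.right) (i : P.ι) :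
    (M.leftCoord U).dim i (U.tro.morita y) = (M.rightCoord U).dim (P.swap i) y := by
  have h0 : KZero.map U.tro.leftIncl (U.tro.morita y) = KZero.map U.tro.rightIncl y :=
    Function.invFun_eq (M.exists_leftIncl_eq U y)
  have ht := linkingMap_mul_star (T := U.tro) ((M.leftCoord U).tr_mul_star i)
    ((M.rightCoord U).tr_mul_star (P.swap i)) (fun x => by
      rw [BlockCoordinates.tr_apply, BlockCoordinates.tr_apply, leftCoord_mul_star,
        rightCoord_star_mul, P.blockTrace_mul_star (M.iso U x).2])
  let t := KZero.ofTrace _ ht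
  have h1 : t.comp (KZero.map U.tro.leftIncl) = (M.leftCoord U).dim i := by
    refine KZero.hom_ext_of_ofMatrix fun p => ?_
    rw [AddMonoidHom.comp_apply, KZero.map_ofMatrix, BlockCoordinates.dim, KZero.ofTrace_ofMatrix,
      KZero.ofTrace_ofMatrix]
    refine Finset.sum_congr rfl fun k _ => ?_
    change (M.leftCoord U).tr i (p.mat k k) + (M.rightCoord U).tr (P.swap i) 0 = _
    rw [map_zero, add_zero]
  have h2 : t.comp (KZero.map U.tro.rightIncl) = (M.rightCoord U).dim (P.swap i) := by
    refine KZero.hom_ext_of_ofMatrix fun p => ?_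
    rw [AddMonoidHom.comp_apply, KZero.map_ofMatrix, BlockCoordinates.dim, KZero.ofTrace_ofMatrix,
      KZero.ofTrace_ofMatrix]
    refine Finset.sum_congr rfl fun k _ => ?_
    change (M.leftCoord U).tr i 0 + (M.rightCoord U).tr (P.swap i) (p.mat k k) = _
    rw [map_zero, zero_add]
  rw [← h1, ← h2, AddMonoidHom.comp_apply, AddMonoidHom.comp_apply, h0]

/-- The canonical involution permutes the ranks of the blocks by `swap`. -/
theorem dim_σ (x : U.K) (i : P.ι) :
    (M.leftCoord U).dim i (U.σ x) = (M.leftCoord U).dim (P.swap i) x := by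
  rw [UniversalTRO.σ, dim_morita]
  exact BlockCoordinates.dim_unop _ _ _ _ (M.rightCoord_unop U) _ _

end Pattern.Model
end

/-! ### The multiplicities of a homomorphism on `K₀` -/

noncomputable section

open TripleProduct
open scoped Matrix.Norms.L2Operator

namespace Pattern

/-- A block on which the matrix of a partial isometry is skew-symmetric has even rank. -/
theorem exists_blockTrace_eq_two_mul {Q : Pattern.{u}} {X : Matrix Q.R Q.R ℂ}
    (hX : X ∈ Q.tro.toSubmodule) (h : X * star X * X = X) {η : ℂ} (ha : Q.anti X = η • X) {j : Q.ι}
    (hj : Q.swap j = j) (hη : η * Q.sign j = -1) :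
    ∃ n : ℕ, Matrix.blockTrace Q.blk j (X * star X) = 2 * n := by
  let p : Matrix Q.R Q.R ℂ := Matrix.blockProj Q.blk j
  have hp : p * p = p := Matrix.blockProj_mul_self _ _
  have hp' : pᴴ = p := Matrix.conjTranspose_blockProj _ _
  have hadj : ∀ a b, Q.Adj a b → (Q.blk a = j ↔ Q.blk b = j) := fun a b hab => by
    rw [hab]
    exact ⟨fun e => by rw [e, hj], fun e => by rw [← Q.swap_swap (Q.blk a), e, hj]⟩
  have hl : ∀ a b, (p * X) a b = (if Q.blk a = j then 1 else 0) * X a b := fun a b =>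
    Matrix.diagonal_mul _ _ _ _
  have hr : ∀ a b, (X * p) a b = X a b * (if Q.blk b = j then 1 else 0) := fun a b =>
    Matrix.mul_diagonal _ _ _ _
  have hpX : p * X = X * p := by
    ext a b
    rw [hl, hr]
    by_cases hab : Q.Adj a b
    · simp only [hadj a b hab, mul_comm]
    · rw [hX a b hab, mul_zero, zero_mul]
  obtain ⟨n, hn⟩ := Matrix.exists_trace_eq_two_mul_of_skew (w := p * X) (by
      ext a b
      rw [Matrix.transpose_apply, Matrix.neg_apply]
      conv_lhs => rw [hpX]
      rw [hl, hr]
      split_ifs with h1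
      · have h2 := congrFun (congrFun ha a) b
        rw [anti_apply, h1, Matrix.smul_apply, smul_eq_mul] at h2
        have h3 := Q.sign_mul_self j
        linear_combination (Q.sign j) * h2 - X b a * h3 + X a b * hη
      · simp) (by
      rw [Matrix.conjTranspose_mul, hp']
      calc p * X * (Xᴴ * p) * (p * X) = p * (X * (Xᴴ * (p * p * X))) := by
            simp only [Matrix.mul_assoc]
        _ = p * (X * (Xᴴ * (X * p))) := by rw [hp, hpX]
        _ = p * (X * star X * X) * p := by simp only [Matrix.mul_assoc]; rfl
        _ = _ := by rw [h, hpX, Matrix.mul_assoc, hp])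
  refine ⟨n, ?_⟩
  rw [← hn, ← Matrix.trace_mul_blockProj, Matrix.conjTranspose_mul, hp', ← Matrix.mul_assoc,
    Matrix.trace_mul_comm _ p, Matrix.trace_mul_comm _ (Matrix.blockProj _ _), ← Matrix.mul_assoc,
    ← Matrix.mul_assoc]
  change (p * X * Xᴴ).trace = (p * (p * X) * Xᴴ).trace
  rw [← Matrix.mul_assoc p, hp]

namespace Model

open TRO

variable {P Q : Pattern.{u}} {Z : Type v} [NormedAddCommGroup Z] [NormedSpace ℂ Z]
  [TripleProduct Z] {W : Type w} [NormedAddCommGroup W] [NormedSpace ℂ W] [TripleProduct W]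
  (M : P.Model Z) (N : Q.Model W) (U : UniversalTRO.{u} Z) (V : UniversalTRO.{u} W)

/-- The generators of `K₀` depend only on the block. -/
theorem leftClass_matrixUnit_eq {a b a' b' : P.R} (h : P.Adj a b) (h' : P.Adj a' b')
    (e : P.blk a = P.blk a') : (M.isTripotent_matrixUnit U h).leftClass =
      (M.isTripotent_matrixUnit U h').leftClass :=
  (M.leftCoord U).eq_of_dim_eq fun j => by rw [dim_matrixUnit, dim_matrixUnit, e]

theorem mem_scale {x : U.tro} (h : IsTripotent x) : h.leftClass ∈ U.scale := ⟨_, _, _, rfl⟩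

theorem σ_leftClass {a b : P.R} (h : P.Adj a b) :
    U.σ (M.isTripotent_matrixUnit U h).leftClass =
      (M.isTripotent_matrixUnit U h.symm).leftClass :=
  (M.leftCoord U).eq_of_dim_eq fun j => by
    rw [dim_σ, dim_matrixUnit, dim_matrixUnit]
    have : P.blk a = P.swap j ↔ P.blk b = j := by
      rw [h]
      exact ⟨fun e => by rw [e, P.swap_swap], fun e => by rw [← e, P.swap_swap]⟩
    simp only [this]

theorem ρ_eq_of_iso_eq {x : U.tro} {z : Z} (h : (M.iso U x : Matrix P.R P.R ℂ) = M.ρ z) :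
    x = U.ρ.toFun z :=
  (M.iso_bijective U).1 (Subtype.ext (h.trans (M.iso_ρ U z).symm))

/-- Classes in `Δ⁺` and `Δ⁻` in terms of coordinates. -/
theorem exists_of_mem_deltaPlus {g : V.K} (hg : g ∈ V.deltaPlus) :
    ∃ X ∈ Q.tro.toSubmodule, X * star X * X = X ∧ Q.anti X = (1 : ℂ) • X ∧
      ∀ j, (N.leftCoord V).dim j g = Matrix.blockTrace Q.blk j (X * star X) := by
  obtain ⟨p, hp, hp', rfl, u, hu, e⟩ := hg
  have h1 : triple (V.ρ.toFun u) (V.ρ.toFun u) (V.ρ.toFun u) = V.ρ.toFun u := by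
    rw [← V.ρ.map_triple', hu]
  have h2 := isTripotent_of_triple h1
  refine ⟨N.iso V (V.ρ.toFun u), (N.iso V _).2, h2.map (N.iso V), ?_, fun j => ?_⟩
  · rw [iso_ρ, one_smul]; exact (N.mem_fixed u).2
  · rw [← N.dim_leftClass V h2]
    exact congrArg _ (KZero.ofProjection_congr (Subtype.ext e) _ _ _ _)

theorem exists_of_mem_deltaMinus {g : V.K} (hg : g ∈ V.deltaMinus) :
    ∃ X ∈ Q.tro.toSubmodule, X * star X * X = X ∧ Q.anti X = (-1 : ℂ) • X ∧
      ∀ j, (N.leftCoord V).dim j g = Matrix.blockTrace Q.blk j (X * star X) := by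
  obtain ⟨p, hp, hp', rfl, w, hw, h1, e⟩ := hg
  have h2 := isTripotent_of_triple h1
  refine ⟨N.iso V w, (N.iso V _).2, h2.map (N.iso V), ?_, fun j => ?_⟩
  · rw [← iso_anti, hw, neg_one_smul, map_neg]; rfl
  · rw [← N.dim_leftClass V h2]
    exact congrArg _ (KZero.ofProjection_congr (Subtype.ext e) _ _ _ _)

theorem anti_single_self (a : P.R) :
    P.anti (Matrix.single a a 1) = P.sign (P.blk a) • Matrix.single a a 1 := by
  ext c d
  simp only [anti_apply, Matrix.smul_apply, Matrix.single_apply, smul_eq_mul]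
  by_cases h1 : a = d ∧ a = c
  · obtain ⟨rfl, rfl⟩ := h1; simp
  · have h2 : ¬ (a = c ∧ a = d) := fun h => h1 h.symm
    simp [h1, h2]

theorem mem_deltaPlus {a : P.R} (h : P.Adj a a) (hs : P.sign (P.blk a) = 1) :
    (M.isTripotent_matrixUnit U h).leftClass ∈ U.deltaPlus := by
  obtain ⟨z, hz⟩ := M.exists_eq _ (single_mem_fixed (a := a) ⟨Eq.symm h, hs⟩)
  have h1 := M.ρ_eq_of_iso_eq U ((M.iso_matrixUnit U h).trans hz.symm)
  refine ⟨_, _, _, rfl, z, M.injective ?_, by rw [h1]⟩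
  rw [M.map_triple, hz]
  simp [star_single, ← two_smul ℂ]

theorem mem_deltaMinus {a : P.R} (h : P.Adj a a) (hs : P.sign (P.blk a) = -1) :
    (M.isTripotent_matrixUnit U h).leftClass ∈ U.deltaMinus := by
  refine ⟨_, _, _, rfl, M.matrixUnit U h, ?_, (M.isTripotent_matrixUnit U h).triple_self, rfl⟩
  refine (M.iso_bijective U).1 (Subtype.ext ?_)
  rw [iso_anti, map_neg]
  change _ = -(M.iso U _ : Matrix P.R P.R ℂ)
  rw [iso_matrixUnit, anti_single_self, hs, neg_one_smul]

/-- The matrix of a homomorphism which preserves the invariants has entries in `ℕ`, is invariant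
under the involutions, respects the sizes of the blocks, and is even where a hermitian and a
symplectic factor meet. -/
theorem exists_multiplicity {γ : U.K →+ V.K} (h1 : Set.MapsTo γ U.scale V.scale)
    (h2 : Set.MapsTo γ U.deltaPlus V.deltaPlus) (h3 : Set.MapsTo γ U.deltaMinus V.deltaMinus)
    (h4 : ∀ x, γ (U.σ x) = V.σ (γ x)) :
    ∃ c : Q.ι → P.ι → ℕ,
      (∀ j a b (h : P.Adj a b), (N.leftCoord V).dim j (γ (M.isTripotent_matrixUnit U h).leftClass) =
        c j (P.blk a)) ∧
      (∀ j i, c (Q.swap j) (P.swap i) = c j i) ∧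
      (∀ j, ∑ i, c j i * (Finset.univ.filter (P.blk · = i)).card ≤
        (Finset.univ.filter (Q.blk · = j)).card) ∧
      (∀ j i, Q.swap j = j → P.swap i = i → Q.sign j * P.sign i = -1 → Even (c j i)) := by
  choose a ha using P.exists_blk_eq
  have hadj : ∀ i, P.Adj (a i) (a (P.swap i)) := fun i => by rw [Adj, ha, ha]
  -- the ranks of an element of the scale
  have hscale : ∀ g ∈ V.scale, ∀ j, ∃ n : ℕ, n ≤ (Finset.univ.filter (Q.blk · = j)).card ∧
      (N.leftCoord V).dim j g = n := by
    rintro _ ⟨p, hp, hp', rfl⟩ j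
    obtain ⟨n, hn, e⟩ := Matrix.exists_blockTrace_eq (P := (N.leftCoord V).ψ p)
      (by rw [← map_mul, hp]) (by
        have := map_star (N.leftCoord V).ψ p
        rw [hp'] at this
        exact this.symm) ((N.leftCoord V).isBlockDiag p) j
    exact ⟨n, hn, by rw [BlockCoordinates.dim_ofProjection, e]⟩
  let δ : P.ι → U.K := fun i => (M.isTripotent_matrixUnit U (hadj i)).leftClass
  choose c _ hc using fun j i => hscale _ (h1 (mem_scale U (M.isTripotent_matrixUnit U (hadj i)))) j
  have hc' : ∀ j a b (h : P.Adj a b), (N.leftCoord V).dim j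
      (γ (M.isTripotent_matrixUnit U h).leftClass) = c j (P.blk a) := fun j a b h => by
    rw [← hc, M.leftClass_matrixUnit_eq U h (hadj (P.blk a)) (ha _).symm]
  refine ⟨c, hc', fun j i => ?_, fun j => ?_, fun j i hj hi hs => ?_⟩
  -- the involution sends the matrix unit at `(a, b)` to the one at `(b, a)`
  · have e1 := hc' (Q.swap j) _ _ (hadj i).symm
    rw [← M.σ_leftClass U (hadj i), h4, dim_σ, Q.swap_swap, hc, ha] at e1
    exact_mod_cast e1.symm
  -- the sizes: the unit of the left C*-algebra has a class in the scale
  · obtain ⟨e, he⟩ := (M.leftCoord U).exists_eq 1 (fun a b hab =>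
      Matrix.one_apply_ne fun h => hab (by rw [h]))
    have he1 : e * e = e := (M.leftCoord U).injective (by rw [map_mul, he, one_mul])
    have he2 : star e = e := (M.leftCoord U).injective (by rw [map_star, he, star_one])
    have he3 : KZero.ofProjection e he1 he2 =
        ∑ i, (Finset.univ.filter (P.blk · = i)).card • δ i := by
      refine (M.leftCoord U).eq_of_dim_eq fun i => ?_
      rw [BlockCoordinates.dim_ofProjection, he, map_sum]
      simp only [map_nsmul, δ, dim_matrixUnit, ha]
      simp [Matrix.blockTrace]
    obtain ⟨n, hn, hn'⟩ := hscale _ (h1 ⟨e, he1, he2, he3.symm⟩) j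
    rw [map_sum, map_sum] at hn'
    simp only [map_nsmul, δ, hc] at hn'
    have : ∑ i, c j i * (Finset.univ.filter (P.blk · = i)).card = n := by
      have h5 : ((∑ i, c j i * (Finset.univ.filter (P.blk · = i)).card : ℕ) : ℂ) = n := by
        rw [← hn']; push_cast
        exact Finset.sum_congr rfl fun i _ => by rw [nsmul_eq_mul, mul_comm]
      exact_mod_cast h5
    rw [this]; exact hn
  -- the parities: a diagonal matrix unit is a tripotent of the triple or of `{w | Φ w = -w}`
  · have hai : P.Adj (a i) (a i) := by rw [Adj, ha, hi]
    have key : ∃ X ∈ Q.tro.toSubmodule, X * star X * X = X ∧ Q.anti X = P.sign i • X ∧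
        ∀ j, (N.leftCoord V).dim j (γ (M.isTripotent_matrixUnit U hai).leftClass) =
          Matrix.blockTrace Q.blk j (X * star X) := by
      rcases P.sign_eq i with e | e
      · rw [e]
        exact N.exists_of_mem_deltaPlus V (h2 (M.mem_deltaPlus U hai (by rw [ha, e])))
      · rw [e]
        exact N.exists_of_mem_deltaMinus V (h3 (M.mem_deltaMinus U hai (by rw [ha, e])))
    obtain ⟨X, hX, e1, e2, e3⟩ := key
    obtain ⟨n, hn⟩ := exists_blockTrace_eq_two_mul hX e1 e2 hj (by rw [mul_comm, hs])
    have h5 := e3 j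
    rw [hc', ha, hn] at h5
    exact ⟨n, by rw [← two_mul]; exact_mod_cast h5⟩

end Model

end Pattern
end

/-! ### Morphisms with prescribed multiplicities -/

noncomputable section

open TripleProduct
open scoped Matrix.Norms.L2Operator

namespace Pattern

/-- Combinatorial data for a morphism `X ↦ ∑ ω κ • H κ * X * (H (τ κ))ᴴ` between triples of patterned
matrices. For every `κ` in the finite set `K`, the partial isometry `H κ` carries the block `src κ`
of `P` into the block `tgt κ` of `Q`, as prescribed by the injection `emb`. The involution `τ` and the
signs `ω` make the morphism compatible with the involutions. -/
structure Amplification (P Q : Pattern.{u}) where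
  K : Type
  [fintypeK : Fintype K]
  [decK : DecidableEq K]
  src : K → P.ι
  tgt : K → Q.ι
  τ : K → K
  τ_τ : ∀ κ, τ (τ κ) = κ
  src_τ : ∀ κ, src (τ κ) = P.swap (src κ)
  tgt_τ : ∀ κ, tgt (τ κ) = Q.swap (tgt κ)
  ω : K → ℂ
  star_ω : ∀ κ, star (ω κ) = ω κ
  ω_mul_self : ∀ κ, ω κ * ω κ = 1
  ω_τ : ∀ κ, ω (τ κ) = Q.sign (tgt κ) * P.sign (src κ) * ω κ
  emb : K → P.R → Q.R
  blk_emb : ∀ κ a, Q.blk (emb κ a) = tgt κ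
  emb_injective : ∀ κ κ' a a', P.blk a = src κ → P.blk a' = src κ' → emb κ a = emb κ' a' →
    κ = κ' ∧ a = a'

namespace Amplification

attribute [instance] Amplification.fintypeK Amplification.decK

variable {P Q : Pattern.{u}} (F : Amplification P Q)

/-- The partial isometry which carries a block of `P` into a block of `Q`. -/
def H (κ : F.K) : Matrix Q.R P.R ℂ :=
  Matrix.of fun p a => if P.blk a = F.src κ ∧ p = F.emb κ a then 1 else 0

theorem H_apply (κ : F.K) (p : Q.R) (a : P.R) :
    F.H κ p a = if P.blk a = F.src κ ∧ p = F.emb κ a then 1 else 0 := rfl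

theorem conjTranspose_H (κ : F.K) : (F.H κ)ᴴ = (F.H κ)ᵀ := by
  ext a p
  rw [Matrix.conjTranspose_apply, Matrix.transpose_apply, H_apply]
  split_ifs <;> simp

theorem H_apply_of_blk_ne {κ : F.K} {p : Q.R} {a : P.R} (h : Q.blk p ≠ F.tgt κ) :
    F.H κ p a = 0 := by
  rw [H_apply, if_neg]
  rintro ⟨-, rfl⟩
  exact h (F.blk_emb κ a)

theorem conjTranspose_H_mul_H (κ κ' : F.K) :
    (F.H κ)ᴴ * F.H κ' = if κ = κ' then Matrix.blockProj P.blk (F.src κ) else 0 := by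
  ext a a'
  rw [conjTranspose_H, Matrix.mul_apply]
  simp only [Matrix.transpose_apply, H_apply]
  by_cases h : P.blk a = F.src κ ∧ P.blk a' = F.src κ'
  · by_cases h' : κ = κ' ∧ a = a'
    · obtain ⟨rfl, rfl⟩ := h'
      simp [h.1, Matrix.blockProj]
    · have h1 : F.emb κ a ≠ F.emb κ' a' := fun e => h' (F.emb_injective κ κ' a a' h.1 h.2 e)
      rw [Finset.sum_eq_zero]
      · split_ifs with h2
        · subst h2
          rw [Matrix.blockProj, Matrix.diagonal_apply_ne _ fun e => h' ⟨rfl, e⟩]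
        · rfl
      · intro p _
        by_cases h2 : p = F.emb κ a
        · have h3 : p ≠ F.emb κ' a' := fun e => h1 (h2.symm.trans e)
          simp [h3]
        · simp [h2]
  · rw [Finset.sum_eq_zero]
    · split_ifs with h2
      · subst h2
        rw [Matrix.blockProj, Matrix.diagonal_apply]
        split_ifs with h3 h4
        · subst h3; exact absurd ⟨h4, h4⟩ h
        · rfl
        · rfl
      · rfl
    · intro p _
      by_cases h2 : P.blk a = F.src κ
      · have h3 : P.blk a' ≠ F.src κ' := fun e => h ⟨h2, e⟩
        simp [h3]
      · simp [h2]

theorem H_mul_apply (κ : F.K) (X : Matrix P.R P.R ℂ) (p : Q.R) (b : P.R) :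
    (F.H κ * X) p b = ∑ a, if P.blk a = F.src κ ∧ p = F.emb κ a then X a b else 0 := by
  rw [Matrix.mul_apply]
  refine Finset.sum_congr rfl fun a _ => ?_
  rw [H_apply]
  split_ifs <;> simp

/-- The initial space of `H (τ κ)` is the block of columns which `H κ * X` meets. -/
theorem H_mul_mul_blockProj (κ : F.K) {X : Matrix P.R P.R ℂ} (hX : X ∈ P.tro.toSubmodule) :
    F.H κ * X * Matrix.blockProj P.blk (P.swap (F.src κ)) = F.H κ * X := by
  ext p b
  rw [Matrix.blockProj, Matrix.mul_diagonal]
  split_ifs with h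
  · rw [mul_one]
  · rw [mul_zero, H_mul_apply, Finset.sum_eq_zero]
    intro a _
    split_ifs with h1
    · exact hX a b fun e => h (e.trans (by rw [h1.1]))
    · rfl

theorem H_mul_mul_blockProj_of_isBlockDiag (κ : F.K) {X : Matrix P.R P.R ℂ}
    (hX : Matrix.IsBlockDiag P.blk P.blk X) :
    F.H κ * X * Matrix.blockProj P.blk (F.src κ) = F.H κ * X := by
  ext p b
  rw [Matrix.blockProj, Matrix.mul_diagonal]
  split_ifs with h
  · rw [mul_one]
  · rw [mul_zero, H_mul_apply, Finset.sum_eq_zero]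
    intro a _
    split_ifs with h1
    · exact hX a b fun e => h (e.symm.trans h1.1)
    · rfl

/-- The morphism defined by an amplification. -/
def θ (X : Matrix P.R P.R ℂ) : Matrix Q.R Q.R ℂ := ∑ κ, F.ω κ • (F.H κ * X * (F.H (F.τ κ))ᴴ)

theorem θ_add (X Y : Matrix P.R P.R ℂ) : F.θ (X + Y) = F.θ X + F.θ Y := by
  simp [θ, Matrix.mul_add, Matrix.add_mul, Finset.sum_add_distrib]

theorem θ_smul (c : ℂ) (X : Matrix P.R P.R ℂ) : F.θ (c • X) = c • F.θ X := by
  simp only [θ, Matrix.mul_smul, Matrix.smul_mul, Finset.smul_sum]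
  exact Finset.sum_congr rfl fun κ _ => smul_comm _ _ _

theorem θ_mem (X : Matrix P.R P.R ℂ) : F.θ X ∈ Q.tro.toSubmodule := by
  refine sum_mem fun κ _ => Q.tro.toSubmodule.smul_mem _ fun p q hpq => ?_
  rw [Matrix.mul_apply]
  refine Finset.sum_eq_zero fun b _ => ?_
  by_cases hp : Q.blk p = F.tgt κ
  · have hq : Q.blk q ≠ F.tgt (F.τ κ) := fun e => hpq (by rw [Adj, e, hp, F.tgt_τ])
    rw [Matrix.conjTranspose_apply, F.H_apply_of_blk_ne hq, star_zero, mul_zero]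
  · rw [Matrix.mul_apply, Finset.sum_eq_zero, zero_mul]
    intro a _
    rw [F.H_apply_of_blk_ne hp, zero_mul]

theorem τ_injective : Function.Injective F.τ := Function.LeftInverse.injective F.τ_τ

theorem θ_mul_star {X : Matrix P.R P.R ℂ} (hX : X ∈ P.tro.toSubmodule) (Y : Matrix P.R P.R ℂ) :
    F.θ X * star (F.θ Y) = ∑ κ, F.H κ * (X * star Y) * (F.H κ)ᴴ := by
  rw [θ, θ, star_sum, Finset.sum_mul]
  refine Finset.sum_congr rfl fun κ _ => ?_
  rw [Finset.mul_sum, Finset.sum_eq_single κ]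
  · rw [star_smul, F.star_ω, smul_mul_smul_comm, F.ω_mul_self, one_smul, Matrix.star_eq_conjTranspose,
      Matrix.conjTranspose_mul, Matrix.conjTranspose_mul, Matrix.conjTranspose_conjTranspose]
    calc _ = F.H κ * X * ((F.H (F.τ κ))ᴴ * F.H (F.τ κ)) * (Yᴴ * (F.H κ)ᴴ) := by
          simp only [Matrix.mul_assoc]
      _ = _ := by
          rw [conjTranspose_H_mul_H, if_pos rfl, F.src_τ, H_mul_mul_blockProj F κ hX]
          simp only [Matrix.mul_assoc]
          rfl
  · intro κ' _ hκ
    rw [star_smul, smul_mul_smul_comm, Matrix.star_eq_conjTranspose,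
      Matrix.conjTranspose_mul, Matrix.conjTranspose_mul, Matrix.conjTranspose_conjTranspose,
      Matrix.mul_assoc (F.H κ * X), ← Matrix.mul_assoc (F.H (F.τ κ))ᴴ, conjTranspose_H_mul_H,
      if_neg fun e => hκ (F.τ_injective e).symm, Matrix.zero_mul, Matrix.mul_zero, smul_zero]
  · simp

theorem θ_tern {X Y : Matrix P.R P.R ℂ} (hX : X ∈ P.tro.toSubmodule) (hY : Y ∈ P.tro.toSubmodule)
    (Z : Matrix P.R P.R ℂ) :
    F.θ (X * star Y * Z) = F.θ X * star (F.θ Y) * F.θ Z := by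
  rw [F.θ_mul_star hX, Finset.sum_mul, θ]
  refine Finset.sum_congr rfl fun κ _ => ?_
  rw [θ, Finset.mul_sum, Finset.sum_eq_single κ]
  · have h := F.H_mul_mul_blockProj_of_isBlockDiag κ
      (P.mem_left_iff.mp (P.tro.mul_star_mem_left hX hY))
    rw [Matrix.mul_smul]
    congr 1
    symm
    calc _ = F.H κ * (X * star Y) * ((F.H κ)ᴴ * F.H κ) * (Z * (F.H (F.τ κ))ᴴ) := by
          simp only [Matrix.mul_assoc]
      _ = _ := by
          rw [conjTranspose_H_mul_H, if_pos rfl, h]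
          simp only [Matrix.mul_assoc]
  · intro κ' _ hκ
    rw [Matrix.mul_smul, Matrix.mul_assoc (F.H κ'), Matrix.mul_assoc (F.H κ * _),
      ← Matrix.mul_assoc (F.H κ)ᴴ, conjTranspose_H_mul_H, if_neg hκ.symm, Matrix.zero_mul,
      Matrix.mul_zero, smul_zero]
  · simp

/-- The morphism intertwines the canonical involutions. -/
theorem anti_θ {X : Matrix P.R P.R ℂ} : Q.anti (F.θ X) = F.θ (P.anti X) := by
  have h1 : Q.anti (F.θ X) =
      ∑ κ, F.ω κ • Matrix.diagonal (fun p => Q.sign (Q.blk p)) * (F.H (F.τ κ) * Xᵀ * (F.H κ)ᴴ) := by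
    rw [anti_eq, θ, Matrix.transpose_sum, Finset.mul_sum]
    refine Finset.sum_congr rfl fun κ _ => ?_
    rw [Matrix.transpose_smul, Matrix.mul_smul, Matrix.smul_mul, conjTranspose_H, conjTranspose_H,
      Matrix.transpose_mul, Matrix.transpose_mul, Matrix.transpose_transpose, Matrix.mul_assoc (F.H _)]
  have h2 : ∀ κ, Matrix.diagonal (fun p => Q.sign (Q.blk p)) * F.H κ = Q.sign (F.tgt κ) • F.H κ := by
    intro κ
    ext p a
    rw [Matrix.diagonal_mul, Matrix.smul_apply, smul_eq_mul]
    by_cases h : Q.blk p = F.tgt κ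
    · rw [h]
    · rw [F.H_apply_of_blk_ne h, mul_zero, mul_zero]
  have h3 : ∀ κ, F.H κ * Matrix.diagonal (fun a => P.sign (P.blk a)) = P.sign (F.src κ) • F.H κ := by
    intro κ
    ext p a
    rw [Matrix.mul_diagonal, Matrix.smul_apply, smul_eq_mul, mul_comm, H_apply]
    split_ifs with h
    · rw [h.1]
    · rw [mul_zero, mul_zero]
  rw [h1, θ, ← Equiv.sum_comp ⟨F.τ, F.τ, F.τ_τ, F.τ_τ⟩]
  refine Finset.sum_congr rfl fun κ _ => ?_
  change F.ω (F.τ κ) • _ * (F.H (F.τ (F.τ κ)) * Xᵀ * (F.H (F.τ κ))ᴴ) = _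
  rw [F.τ_τ, anti_eq, ← Matrix.mul_assoc (F.H κ), h3, Matrix.smul_mul, Matrix.smul_mul,
    ← Matrix.mul_assoc, ← Matrix.mul_assoc, Matrix.smul_mul, h2, F.ω_τ]
  simp only [Matrix.smul_mul, smul_smul]
  congr 1
  have e := Q.sign_mul_self (F.tgt κ)
  linear_combination (P.sign (F.src κ) * F.ω κ) * e

theorem θ_mem_fixed {X : Matrix P.R P.R ℂ} (hX : X ∈ P.fixed) : F.θ X ∈ Q.fixed :=
  ⟨F.θ_mem X, by rw [anti_θ, hX.2]⟩

/-- The ranks of the image of a matrix unit. -/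
theorem blockTrace_θ {a b : P.R} (h : P.Adj a b) (j : Q.ι) :
    Matrix.blockTrace Q.blk j (F.θ (Matrix.single a b 1) * star (F.θ (Matrix.single a b 1))) =
      (Finset.univ.filter fun κ => F.tgt κ = j ∧ F.src κ = P.blk a).card := by
  rw [F.θ_mul_star (P.single_mem_tro h 1), star_single, Matrix.single_mul_single_same, one_mul,
    ← Matrix.trace_mul_blockProj, Finset.sum_mul, Matrix.trace_sum, Finset.card_filter, Nat.cast_sum]
  refine Finset.sum_congr rfl fun κ _ => ?_
  have h1 : (F.H κ)ᴴ * Matrix.blockProj Q.blk j = if F.tgt κ = j then (F.H κ)ᴴ else 0 := by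
    ext c p
    rw [Matrix.blockProj, Matrix.mul_diagonal, Matrix.conjTranspose_apply]
    by_cases hp : Q.blk p = F.tgt κ
    · rw [hp]; split_ifs <;> simp
    · rw [F.H_apply_of_blk_ne hp]
      split_ifs <;> simp [F.H_apply_of_blk_ne hp]
  rw [Matrix.mul_assoc, h1]
  by_cases hj : F.tgt κ = j
  · rw [if_pos hj, Matrix.mul_assoc, Matrix.trace_mul_comm, Matrix.mul_assoc, conjTranspose_H_mul_H,
      if_pos rfl, Matrix.trace_single_mul]
    simp [Matrix.blockProj, hj, eq_comm]
  · rw [if_neg hj]; simp [hj]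

/-- The morphism of an amplification as a TRO-morphism. -/
def hom : TROHom P.tro Q.tro where
  toContinuousLinearMap := LinearMap.toContinuousLinearMap
    { toFun := fun X => ⟨F.θ X, F.θ_mem X⟩
      map_add' := fun X Y => Subtype.ext (F.θ_add X Y)
      map_smul' := fun c X => Subtype.ext (F.θ_smul c X) }
  map_tern' X Y Z := Subtype.ext (F.θ_tern X.2 Y.2 Z)

theorem coe_hom (X : P.tro) : (F.hom X : Matrix Q.R Q.R ℂ) = F.θ X := rfl

end Amplification

namespace Model

variable {P Q : Pattern.{u}} {Z : Type v} [NormedAddCommGroup Z] [NormedSpace ℂ Z]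
  [TripleProduct Z] {W : Type w} [NormedAddCommGroup W] [NormedSpace ℂ W] [TripleProduct W]
  (M : P.Model Z) (N : Q.Model W) (U : UniversalTRO.{u} Z) (V : UniversalTRO.{u} W)

/-- An equivariant TRO-morphism between patterned matrices restricts to the triples. -/
theorem exists_jbHom (φ : TROHom P.tro Q.tro)
    (hφ : ∀ X (hX : X ∈ P.fixed), (φ ⟨X, hX.1⟩ : Matrix Q.R Q.R ℂ) ∈ Q.fixed) :
    ∃ Φ : JBHom Z W, ∀ z, N.ρ (Φ.toFun z) = φ ⟨M.ρ z, (M.mem_fixed z).1⟩ := by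
  have := M.finiteDimensional
  obtain ⟨g, hg⟩ := LinearMap.exists_leftInverse_of_injective N.ρ
    (LinearMap.ker_eq_bot.mpr N.injective)
  let f : Z →ₗ[ℂ] W := g ∘ₗ Q.tro.toSubmodule.subtype ∘ₗ
    (φ.toContinuousLinearMap : P.tro →ₗ[ℂ] Q.tro) ∘ₗ
    M.ρ.codRestrict P.tro.toSubmodule fun z => (M.mem_fixed z).1
  have hf : ∀ z, N.ρ (f z) = φ ⟨M.ρ z, (M.mem_fixed z).1⟩ := fun z => by
    obtain ⟨w, hw⟩ := N.exists_eq _ (hφ (M.ρ z) (M.mem_fixed z))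
    have h1 : f z = g (φ ⟨M.ρ z, (M.mem_fixed z).1⟩ : Matrix Q.R Q.R ℂ) := rfl
    rw [h1, ← hw]
    exact congrArg N.ρ (LinearMap.congr_fun hg w)
  refine ⟨⟨LinearMap.toContinuousLinearMap f, fun x y z => N.injective ?_⟩, hf⟩
  change N.ρ (f _) = N.ρ (triple (f x) (f y) (f z))
  rw [hf, N.map_triple, hf, hf, hf]
  have h := φ.map_triple (M.toJBHom.toFun x) (M.toJBHom.toFun y) (M.toJBHom.toFun z)
  rw [← M.toJBHom.map_triple'] at h
  exact congrArg Subtype.val h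

/-- In coordinates, the extension of a morphism of triples is the TRO-morphism which induces it. -/
theorem iso_map_inv {Φ : JBHom Z W} {φ : TROHom P.tro Q.tro}
    (h : ∀ z, N.ρ (Φ.toFun z) = φ ⟨M.ρ z, (M.mem_fixed z).1⟩) (x : U.tro) :
    N.iso V (U.map V Φ x) = φ (M.iso U x) := by
  have : (N.iso V).comp (U.map V Φ) = φ.comp (M.iso U) := UniversalTRO.hom_ext fun z => by
    apply Subtype.ext
    have h1 : U.map V Φ (U.ρ.toFun z) = V.ρ.toFun (Φ.toFun z) := U.lift_ρ _ z
    change (N.iso V (U.map V Φ (U.ρ.toFun z)) : Matrix Q.R Q.R ℂ) = φ (M.iso U (U.ρ.toFun z))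
    rw [h1, iso_ρ, h]
    exact congrArg (fun t : P.tro => (φ t : Matrix Q.R Q.R ℂ)) (Subtype.ext (M.iso_ρ U z).symm)
  exact congrArg (fun t : TROHom U.tro Q.tro => t x) this

end Model

end Pattern
end

noncomputable section

open TripleProduct
open scoped Matrix.Norms.L2Operator

namespace Pattern

/-- For an involution without fixed points on the set where the invariant function `η` is `-1`, there
is a choice of signs with coboundary `η`. -/
theorem exists_sign {K : Type*} [Fintype K] {τ : K → K} (hτ : ∀ κ, τ (τ κ) = κ) {η : K → ℂ}
    (hη : ∀ κ, η κ = 1 ∨ η κ = -1) (hητ : ∀ κ, η (τ κ) = η κ) (hfix : ∀ κ, η κ = -1 → τ κ ≠ κ) :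
    ∃ ω : K → ℂ, (∀ κ, ω κ = 1 ∨ ω κ = -1) ∧ ∀ κ, ω (τ κ) = η κ * ω κ := by
  -- of every two elements exchanged by `τ` where `η` is `-1`, one gets the sign `-1`
  let e := Fintype.equivFin K
  refine ⟨fun κ => if η κ = -1 ∧ e (τ κ) < e κ then -1 else 1, fun κ => ?_, fun κ => ?_⟩
  · dsimp only
    split_ifs
    · exact Or.inr rfl
    · exact Or.inl rfl
  · dsimp only
    rw [hτ, hητ]
    rcases hη κ with h | h
    · have : (1 : ℂ) ≠ -1 := by norm_num
      simp [h, this]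
    · have h1 : e (τ κ) ≠ e κ := fun h2 => hfix κ h (e.injective h2)
      rcases lt_or_gt_of_ne h1 with h2 | h2
      · simp [h, h2, h2.le]
      · simp [h, h2, h2.le]

variable {P Q : Pattern.{u}}

/-- A matrix of multiplicities which respects the sizes, the involutions and the parities is realized
by an amplification. -/
theorem exists_amplification (c : Q.ι → P.ι → ℕ)
    (hswap : ∀ j i, c (Q.swap j) (P.swap i) = c j i)
    (hsum : ∀ j, ∑ i, c j i * (Finset.univ.filter (P.blk · = i)).card ≤
      (Finset.univ.filter (Q.blk · = j)).card)
    (heven : ∀ j i, Q.swap j = j → P.swap i = i → Q.sign j * P.sign i = -1 → Even (c j i)) :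
    ∃ F : Amplification P Q, ∀ j i,
      (Finset.univ.filter fun κ => F.tgt κ = j ∧ F.src κ = i).card = c j i := by
  classical
  let C : Q.ι → P.ι → Prop := fun j i => Q.swap j = j ∧ P.swap i = i ∧ Q.sign j * P.sign i = -1
  have hC : ∀ j i, C (Q.swap j) (P.swap i) ↔ C j i := fun j i => by
    simp only [C, Q.swap_swap, P.swap_swap, Q.sign_swap, P.sign_swap]
    exact ⟨fun h => ⟨h.1.symm, h.2.1.symm, h.2.2⟩, fun h => ⟨h.1.symm, h.2.1.symm, h.2.2⟩⟩
  -- where the multiplicity has to be even, the involution exchanges `2 * m` and `2 * m + 1`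
  let f : Q.ι → P.ι → ℕ → ℕ := fun j i k => if C j i then (if k % 2 = 0 then k + 1 else k - 1) else k
  have hf_lt : ∀ j i k, k < c j i → f j i k < c (Q.swap j) (P.swap i) := by
    intro j i k hk
    rw [hswap]
    simp only [f]
    split_ifs with h1 h2
    · obtain ⟨m, hm⟩ := heven j i h1.1 h1.2.1 h1.2.2
      omega
    · omega
    · exact hk
  have hf_f : ∀ j i k, f (Q.swap j) (P.swap i) (f j i k) = k := by
    intro j i k
    simp only [f, hC]
    split_ifs <;> omega
  have hf_ne : ∀ j i k, C j i → f j i k ≠ k := by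
    intro j i k h
    simp only [f, if_pos h]
    split_ifs <;> omega
  -- the copies of the blocks of `P` in the blocks of `Q`
  let K := Σ x : Q.ι × P.ι, Fin (c x.1 x.2)
  have hK : ∀ {κ κ' : K}, κ.1 = κ'.1 → (κ.2 : ℕ) = κ'.2 → κ = κ' := by
    rintro ⟨x, k⟩ ⟨y, l⟩ h h'
    dsimp only at h
    subst h
    exact congrArg _ (Fin.ext h')
  let τ : K → K := fun κ => ⟨(Q.swap κ.1.1, P.swap κ.1.2), ⟨f κ.1.1 κ.1.2 κ.2, hf_lt _ _ _ κ.2.2⟩⟩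
  have hτ : ∀ κ, τ (τ κ) = κ := fun κ =>
    hK (Prod.ext (Q.swap_swap _) (P.swap_swap _)) (hf_f _ _ _)
  obtain ⟨ω, hω, hωτ⟩ := exists_sign hτ (η := fun κ => Q.sign κ.1.1 * P.sign κ.1.2)
    (fun κ => by
      rcases Q.sign_eq κ.1.1 with h | h <;> rcases P.sign_eq κ.1.2 with h' | h' <;>
        simp [h, h'])
    (fun κ => congrArg₂ (· * ·) (Q.sign_swap _) (P.sign_swap _))
    (fun κ h1 h2 => by
      have h3 : Q.swap κ.1.1 = κ.1.1 := congrArg (fun κ : K => κ.1.1) h2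
      have h4 : P.swap κ.1.2 = κ.1.2 := congrArg (fun κ : K => κ.1.2) h2
      exact hf_ne _ _ _ ⟨h3, h4, h1⟩ (congrArg (fun κ : K => (κ.2 : ℕ)) h2))
  have hemb : ∀ j, Nonempty ((Σ i, Fin (c j i) × {a // P.blk a = i}) ↪ {p // Q.blk p = j}) := by
    intro j
    refine Function.Embedding.nonempty_of_card_le ?_
    simp only [Fintype.card_sigma, Fintype.card_prod, Fintype.card_fin, Fintype.card_subtype]
    exact hsum j
  let e := fun j => (hemb j).some
  -- outside of the block `κ.1.2`, the value of `g κ` does not matter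
  let g : K → P.R → Q.R := fun κ a =>
    if h : P.blk a = κ.1.2 then (e κ.1.1 ⟨κ.1.2, κ.2, a, h⟩).1 else (Q.exists_blk_eq κ.1.1).choose
  have hg : ∀ κ a, Q.blk (g κ a) = κ.1.1 := fun κ a => by
    simp only [g]
    split_ifs with h
    · exact (e κ.1.1 ⟨κ.1.2, κ.2, a, h⟩).2
    · exact (Q.exists_blk_eq κ.1.1).choose_spec
  refine ⟨{
    K := K
    src := fun κ => κ.1.2
    tgt := fun κ => κ.1.1
    τ := τ
    τ_τ := hτ
    src_τ := fun κ => rfl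
    tgt_τ := fun κ => rfl
    ω := ω
    star_ω := fun κ => by rcases hω κ with h | h <;> simp [h]
    ω_mul_self := fun κ => by rcases hω κ with h | h <;> simp [h]
    ω_τ := hωτ
    emb := g
    blk_emb := hg
    emb_injective := ?_ }, fun j i => ?_⟩
  · rintro ⟨⟨j, i⟩, k⟩ ⟨⟨j', i'⟩, k'⟩ a a' ha ha' h
    have hj : j = j' := by
      have := congrArg Q.blk h
      rwa [hg, hg] at this
    subst hj
    dsimp only at ha ha'
    simp only [g, dif_pos ha, dif_pos ha'] at h
    have h1 := (e j).injective (Subtype.ext h)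
    have h2 : a = a' := congrArg (fun x : Σ i, Fin (c j i) × {a // P.blk a = i} => x.2.2.1) h1
    have h3 : (k : ℕ) = k' :=
      congrArg (fun x : Σ i, Fin (c j i) × {a // P.blk a = i} => (x.2.1 : ℕ)) h1
    exact ⟨hK (Prod.ext rfl (ha.symm.trans ((congrArg P.blk h2).trans ha'))) h3, h2⟩
  · change (Finset.univ.filter fun κ : K => κ.1.1 = j ∧ κ.1.2 = i).card = c j i
    have : (Finset.univ.filter fun κ : K => κ.1.1 = j ∧ κ.1.2 = i) =
        Finset.univ.map ⟨fun k : Fin (c j i) => (⟨(j, i), k⟩ : K), fun k k' h => by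
          exact Fin.ext (congrArg (fun κ : K => (κ.2 : ℕ)) h)⟩ := by
      ext ⟨⟨j', i'⟩, k⟩
      simp only [Finset.mem_filter, Finset.mem_univ, true_and, Finset.mem_map]
      constructor
      · rintro ⟨rfl, rfl⟩; exact ⟨k, rfl⟩
      · rintro ⟨k', h⟩
        have := congrArg Sigma.fst h
        exact ⟨(congrArg Prod.fst this).symm, (congrArg Prod.snd this).symm⟩
    rw [this, Finset.card_map, Finset.card_univ, Fintype.card_fin]

namespace Model

open TRO

variable {Z : Type v} [NormedAddCommGroup Z] [NormedSpace ℂ Z]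
  [TripleProduct Z] {W : Type w} [NormedAddCommGroup W] [NormedSpace ℂ W] [TripleProduct W]
  (M : P.Model Z) (N : Q.Model W) (U : UniversalTRO.{u} Z) (V : UniversalTRO.{u} W)

include M N in
/-- A homomorphism which preserves the invariants is induced by a JB*-morphism. -/
theorem exists_mapK_eq {γ : U.K →+ V.K} (h1 : Set.MapsTo γ U.scale V.scale)
    (h2 : Set.MapsTo γ U.deltaPlus V.deltaPlus) (h3 : Set.MapsTo γ U.deltaMinus V.deltaMinus)
    (h4 : ∀ x, γ (U.σ x) = V.σ (γ x)) : ∃ Φ : JBHom Z W, U.mapK V Φ = γ := by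
  obtain ⟨c, hc, hc1, hc2, hc3⟩ := M.exists_multiplicity N U V h1 h2 h3 h4
  obtain ⟨F, hF⟩ := exists_amplification c hc1 hc2 hc3
  obtain ⟨Φ, hΦ⟩ := M.exists_jbHom N F.hom fun X hX => F.θ_mem_fixed hX
  refine ⟨Φ, ?_⟩
  choose a ha using P.exists_blk_eq
  have hadj : ∀ i, P.Adj (a i) (a (P.swap i)) := fun i => by rw [Adj, ha, ha]
  refine (M.leftCoord U).hom_ext
    (δ := fun i => (M.isTripotent_matrixUnit U (hadj i)).leftClass)
    (fun i j => by rw [dim_matrixUnit, ha]) fun i => (N.leftCoord V).eq_of_dim_eq fun j => ?_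
  rw [UniversalTRO.mapK, IsTripotent.map_leftClass, dim_leftClass, M.iso_map_inv N U V hΦ, hc, ← hF,
    ← F.blockTrace_θ (hadj i), F.coe_hom, iso_matrixUnit]

end Model

end Pattern
end

/-! ### Unitary equivalence of morphisms with the same multiplicities -/

noncomputable section

open TripleProduct
open scoped Matrix.Norms.L2Operator

namespace Matrix

variable {α ι : Type*} {f : α → ι}

theorem isBlockDiag_one [DecidableEq α] : IsBlockDiag f f (1 : Matrix α α ℂ) := fun _ _ h =>
  one_apply_ne fun e => h (by rw [e])

theorem IsBlockDiag.mul [Fintype α] {X Y : Matrix α α ℂ} (hX : IsBlockDiag f f X) (hY : IsBlockDiag f f Y) :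
    IsBlockDiag f f (X * Y) := fun a b h => by
  rw [mul_apply]
  refine Finset.sum_eq_zero fun c _ => ?_
  by_cases h1 : f a = f c
  · rw [hY c b (h1 ▸ h), mul_zero]
  · rw [hX a c h1, zero_mul]

theorem IsBlockDiag.conjTranspose {X : Matrix α α ℂ} (hX : IsBlockDiag f f X) :
    IsBlockDiag f f Xᴴ := fun a b h => by
  rw [conjTranspose_apply, hX b a (Ne.symm h), star_zero]

theorem IsBlockDiag.sub {X Y : Matrix α α ℂ} (hX : IsBlockDiag f f X) (hY : IsBlockDiag f f Y) :
    IsBlockDiag f f (X - Y) := fun a b h => by rw [sub_apply, hX a b h, hY a b h, sub_zero]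

theorem IsBlockDiag.add {X Y : Matrix α α ℂ} (hX : IsBlockDiag f f X) (hY : IsBlockDiag f f Y) :
    IsBlockDiag f f (X + Y) := fun a b h => by rw [add_apply, hX a b h, hY a b h, add_zero]

variable [Fintype α] [DecidableEq α] [Fintype ι] [DecidableEq ι]

/-- Block diagonal partial isometries extend to block diagonal unitaries, since the complements of
their supports have equal ranks in every block. -/
theorem exists_blockDiag_unitary {V₀ : Matrix α α ℂ} (hb : IsBlockDiag f f V₀)
    (h : V₀ * V₀ᴴ * V₀ = V₀) : ∃ V : Matrix α α ℂ, IsBlockDiag f f V ∧ V * Vᴴ = 1 ∧ Vᴴ * V = 1 ∧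
      V * (V₀ᴴ * V₀) = V₀ := by
  have h' : V₀ᴴ * V₀ * V₀ᴴ = V₀ᴴ := by
    simpa [Matrix.mul_assoc] using congrArg Matrix.conjTranspose h
  have hp : V₀ * V₀ᴴ * (V₀ * V₀ᴴ) = V₀ * V₀ᴴ := by rw [← Matrix.mul_assoc, h]
  have hq : V₀ᴴ * V₀ * (V₀ᴴ * V₀) = V₀ᴴ * V₀ := by rw [← Matrix.mul_assoc, h']
  obtain ⟨V₁, h1, h2, h3⟩ := exists_blockDiag_partialIsometry (f := f) (g := f)
    (P := 1 - V₀ * V₀ᴴ) (Q := 1 - V₀ᴴ * V₀)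
    (by rw [sub_mul, mul_sub, mul_sub, hp]; simp) (by simp)
    (by rw [sub_mul, mul_sub, mul_sub, hq]; simp) (by simp)
    (isBlockDiag_one.sub (hb.mul hb.conjTranspose)) (isBlockDiag_one.sub (hb.conjTranspose.mul hb))
    (fun i => by
      rw [← trace_mul_blockProj, ← trace_mul_blockProj, sub_mul, sub_mul, trace_sub, trace_sub,
        trace_mul_blockProj, trace_mul_blockProj, trace_mul_blockProj, blockTrace_mul_comm hb])
  have h4 : V₁ * (V₀ᴴ * V₀) = 0 := by
    have := mul_conjTranspose_mul_of_isProj (V := V₁) (by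
      rw [h1, sub_mul, mul_sub, mul_sub, hp]; simp)
    rw [Matrix.mul_assoc, h2, mul_sub, mul_one, sub_eq_self] at this
    exact this
  have h5 : V₀ * V₀ᴴ * V₁ = 0 := by
    have := mul_conjTranspose_mul_of_isProj (V := V₁) (by
      rw [h1, sub_mul, mul_sub, mul_sub, hp]; simp)
    rw [h1, sub_mul, one_mul, sub_eq_self] at this
    exact this
  have h6 : V₀ᴴ * V₁ = 0 := by
    rw [← h', Matrix.mul_assoc, Matrix.mul_assoc, ← Matrix.mul_assoc V₀, h5, Matrix.mul_zero]
  have h7 : V₁ * V₀ᴴ = 0 := by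
    rw [← h', ← Matrix.mul_assoc, h4, Matrix.zero_mul]
  have h8 : V₁ᴴ * V₀ = 0 := by simpa using congrArg Matrix.conjTranspose h6
  have h9 : V₀ * V₁ᴴ = 0 := by simpa using congrArg Matrix.conjTranspose h7
  refine ⟨V₀ + V₁, hb.add h3, ?_, ?_, ?_⟩
  · rw [conjTranspose_add, add_mul, mul_add, mul_add, h9, h7, h1]; simp
  · rw [conjTranspose_add, add_mul, mul_add, mul_add, h6, h8, h2]; simp
  · rw [add_mul, h4, add_zero, ← Matrix.mul_assoc, h]

/-- Two families of partial isometries with the same initial projections, each with pairwise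
orthogonal final projections, are unitarily equivalent. -/
theorem exists_blockDiag_unitary_mul_eq {β : Type*} [Fintype β] [DecidableEq β]
    {l l' k : β → Matrix α α ℂ} (hl : ∀ a c, (l a)ᴴ * l c = if a = c then k a else 0)
    (hl' : ∀ a c, (l' a)ᴴ * l' c = if a = c then k a else 0) (hk : ∀ a, l a * k a = l a)
    (hk' : ∀ a, l' a * k a = l' a) (hb : ∀ a, IsBlockDiag f f (l a * (l' a)ᴴ)) :
    ∃ V : Matrix α α ℂ, IsBlockDiag f f V ∧ V * Vᴴ = 1 ∧ Vᴴ * V = 1 ∧ ∀ a, V * l' a = l a := by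
  let V₀ := ∑ a, l a * (l' a)ᴴ
  have h1 : ∀ c, V₀ * l' c = l c := fun c => by
    rw [Finset.sum_mul, Finset.sum_eq_single c]
    · rw [Matrix.mul_assoc, hl', if_pos rfl, hk]
    · intro a _ ha; rw [Matrix.mul_assoc, hl', if_neg ha, Matrix.mul_zero]
    · simp
  have h2 : ∀ c, V₀ᴴ * l c = l' c := fun c => by
    rw [conjTranspose_sum, Finset.sum_mul, Finset.sum_eq_single c]
    · rw [conjTranspose_mul, conjTranspose_conjTranspose, Matrix.mul_assoc, hl, if_pos rfl, hk']
    · intro a _ ha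
      rw [conjTranspose_mul, conjTranspose_conjTranspose, Matrix.mul_assoc, hl, if_neg ha,
        Matrix.mul_zero]
    · simp
  have hb0 : IsBlockDiag f f V₀ := fun a b h => by
    change (∑ c, l c * (l' c)ᴴ) a b = 0
    rw [Matrix.sum_apply]
    exact Finset.sum_eq_zero fun c _ => hb c a b h
  obtain ⟨V, h3, h4, h5, h6⟩ := exists_blockDiag_unitary hb0 (by
    rw [Matrix.mul_assoc]
    change V₀ * (V₀ᴴ * ∑ a, l a * (l' a)ᴴ) = ∑ a, l a * (l' a)ᴴ
    rw [Finset.mul_sum, Finset.mul_sum]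
    refine Finset.sum_congr rfl fun a _ => ?_
    rw [← Matrix.mul_assoc V₀ᴴ, h2, ← Matrix.mul_assoc, h1])
  refine ⟨V, h3, h4, h5, fun a => ?_⟩
  have h7 := congrArg (· * l' a) h6
  simp only [Matrix.mul_assoc, h1, h2] at h7
  exact h7

end Matrix

namespace TROHom

variable {A B : Type*} [NonUnitalCStarAlgebra A] [NonUnitalCStarAlgebra B] {T : TRO A} {S : TRO B}

theorem mul_star_congr (φ : TROHom T S) {x y x' y' : T}
    (h : (x : A) * star (y : A) = x' * star (y' : A)) :
    (φ x : B) * star (φ y : B) = φ x' * star (φ y' : B) := by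
  rw [← left_mul_star, ← left_mul_star]
  exact congrArg (fun t : T.left => (φ.left t : B)) (Subtype.ext h)

theorem star_mul_congr (φ : TROHom T S) {x y x' y' : T}
    (h : star (x : A) * (y : A) = star (x' : A) * (y' : A)) :
    star (φ x : B) * (φ y : B) = star (φ x' : B) * (φ y' : B) := by
  rw [← right_star_mul, ← right_star_mul]
  exact congrArg (fun t : T.right => (φ.right t : B)) (Subtype.ext h)

end TROHom

namespace Pattern

variable {P Q : Pattern.{u}}

/-- The matrix unit at an admissible position as an element of the TRO. -/
def basic {a b : P.R} (h : P.Adj a b) : P.tro := ⟨Matrix.single a b 1, P.single_mem_tro h 1⟩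

/-- The images of the matrix units under a TRO-morphism are again a system of matrix units. -/
theorem hom_relations (φ : TROHom P.tro Q.tro) :
    ∃ f : P.R → P.R → Matrix Q.R Q.R ℂ,
      (∀ a b (h : P.Adj a b), (φ (basic h) : Matrix Q.R Q.R ℂ) = f a b) ∧
      (∀ X : P.tro, (φ X : Matrix Q.R Q.R ℂ) = ∑ a, ∑ b, (X : Matrix P.R P.R ℂ) a b • f a b) ∧
      (∀ a b c d, P.Adj a b → P.Adj c b → P.Adj c d → f a b * (f c b)ᴴ * f c d = f a d) ∧
      (∀ a b c d, P.Adj a b → P.Adj c d → a ≠ c → (f a b)ᴴ * f c d = 0) ∧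
      (∀ a b c d, P.Adj a b → P.Adj c d → b ≠ d → f a b * (f c d)ᴴ = 0) ∧
      (∀ a b c, P.Adj a b → P.Adj a c → f a b * (f a b)ᴴ = f a c * (f a c)ᴴ) ∧
      (∀ a b c, P.Adj a b → P.Adj c b → (f a b)ᴴ * f a b = (f c b)ᴴ * f c b) := by
  obtain ⟨q, hq⟩ := LinearMap.exists_extend
    (Q.tro.toSubmodule.subtype ∘ₗ (φ.toContinuousLinearMap : P.tro →ₗ[ℂ] Q.tro))
  have hq' : ∀ X : P.tro, q X = (φ X : Matrix Q.R Q.R ℂ) := LinearMap.congr_fun hq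
  have hf : ∀ a b (h : P.Adj a b), (φ (basic h) : Matrix Q.R Q.R ℂ) = q (Matrix.single a b 1) :=
    fun a b h => (hq' (basic h)).symm
  have h0 : (φ 0 : Matrix Q.R Q.R ℂ) = 0 := congrArg Subtype.val (map_zero φ.toContinuousLinearMap)
  refine ⟨fun a b => q (Matrix.single a b 1), hf, fun X => ?_, ?_, ?_, ?_, ?_, ?_⟩
  · rw [← hq']
    conv_lhs => rw [Matrix.matrix_eq_sum_single (X : Matrix P.R P.R ℂ)]
    simp only [map_sum]
    refine Finset.sum_congr rfl fun a _ => Finset.sum_congr rfl fun b _ => ?_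
    rw [← map_smul, Matrix.smul_single, smul_eq_mul, mul_one]
  · intro a b c d h h' h''
    beta_reduce
    have had : P.Adj a d := adj_of_blk_eq h'' (blk_eq_of_adj h h')
    rw [← hf a b h, ← hf c b h', ← hf c d h'', ← hf a d had]
    refine (φ.coe_map_tern _ _ _).symm.trans (congrArg (fun t : P.tro => (φ t : Matrix Q.R Q.R ℂ))
      (Subtype.ext ?_))
    change Matrix.single a b (1 : ℂ) * star (Matrix.single c b (1 : ℂ)) * Matrix.single c d 1 = _
    simp [star_single, basic]
  · intro a b c d h h' hac
    beta_reduce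
    rw [← hf a b h, ← hf c d h']
    refine (φ.star_mul_congr (x' := 0) (y' := 0) ?_).trans ?_
    · change star (Matrix.single a b (1 : ℂ)) * Matrix.single c d 1 = star 0 * 0
      simp [star_single, hac]
    · rw [h0, star_zero, zero_mul]
  · intro a b c d h h' hbd
    beta_reduce
    rw [← hf a b h, ← hf c d h']
    refine (φ.mul_star_congr (x' := 0) (y' := 0) ?_).trans ?_
    · change Matrix.single a b (1 : ℂ) * star (Matrix.single c d 1) = 0 * star 0
      simp [star_single, hbd]
    · rw [h0, star_zero, zero_mul]
  · intro a b c h h'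
    beta_reduce
    rw [← hf a b h, ← hf a c h']
    refine φ.mul_star_congr ?_
    change Matrix.single a b (1 : ℂ) * star (Matrix.single a b 1) =
      Matrix.single a c (1 : ℂ) * star (Matrix.single a c 1)
    simp [star_single]
  · intro a b c h h'
    beta_reduce
    rw [← hf a b h, ← hf c b h']
    refine φ.star_mul_congr ?_
    change star (Matrix.single a b (1 : ℂ)) * Matrix.single a b 1 =
      star (Matrix.single c b (1 : ℂ)) * Matrix.single c b 1
    simp [star_single]

/-- TRO-morphisms for which the images of the matrix units have the same ranks are unitarily
equivalent. -/
theorem exists_unitary_of_blockTrace_eq (φ ψ : TROHom P.tro Q.tro)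
    (h : ∀ a b (h : P.Adj a b) j,
      Matrix.blockTrace Q.blk j ((φ (basic h) : Matrix Q.R Q.R ℂ) * star (φ (basic h) : Matrix Q.R Q.R ℂ)) =
      Matrix.blockTrace Q.blk j ((ψ (basic h) : Matrix Q.R Q.R ℂ) * star (ψ (basic h) : Matrix Q.R Q.R ℂ))) :
    ∃ V W : Matrix Q.R Q.R ℂ, Matrix.IsBlockDiag Q.blk Q.blk V ∧ Matrix.IsBlockDiag Q.blk Q.blk W ∧
      V * Vᴴ = 1 ∧ Vᴴ * V = 1 ∧ W * Wᴴ = 1 ∧ Wᴴ * W = 1 ∧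
      ∀ X : P.tro, (φ X : Matrix Q.R Q.R ℂ) = V * ψ X * W := by
  obtain ⟨f, hf0, hf1, hf2, hf3, hf4, hf5, hf6⟩ := hom_relations φ
  obtain ⟨g, hg0, hg1, hg2, hg3, hg4, hg5, hg6⟩ := hom_relations ψ
  choose o ho using P.exists_blk_eq
  have hoo : ∀ i, P.Adj (o i) (o (P.swap i)) := fun i => by rw [Adj, ho, ho]
  have hao : ∀ a, P.Adj a (o (P.swap (P.blk a))) := fun a => by rw [Adj, ho]
  have hob : ∀ b, P.Adj (o (P.swap (P.blk b))) b := fun b => by rw [Adj, ho, P.swap_swap]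
  have hfm : ∀ a b, P.Adj a b → f a b ∈ Q.tro.toSubmodule := fun a b hab => by
    rw [← hf0 a b hab]; exact (φ _).2
  have hgm : ∀ a b, P.Adj a b → g a b ∈ Q.tro.toSubmodule := fun a b hab => by
    rw [← hg0 a b hab]; exact (ψ _).2
  have hleft : ∀ {X Y : Matrix Q.R Q.R ℂ}, X ∈ Q.tro.toSubmodule → Y ∈ Q.tro.toSubmodule →
      Matrix.IsBlockDiag Q.blk Q.blk (X * Yᴴ) := fun hX hY =>
    Q.mem_left_iff.mp (Q.tro.mul_star_mem_left hX hY)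
  have hright : ∀ {X Y : Matrix Q.R Q.R ℂ}, X ∈ Q.tro.toSubmodule → Y ∈ Q.tro.toSubmodule →
      Matrix.IsBlockDiag Q.blk Q.blk (Xᴴ * Y) := fun hX hY =>
    Q.mem_right_iff.mp (Q.tro.star_mul_mem_right hX hY)
  -- the images of one matrix unit in each block, with their left supports identified by `v`
  let e : P.ι → Matrix Q.R Q.R ℂ := fun i => f (o i) (o (P.swap i))
  let e' : P.ι → Matrix Q.R Q.R ℂ := fun i => g (o i) (o (P.swap i))
  have he : ∀ i, e i * (e i)ᴴ * e i = e i := fun i => hf2 _ _ _ _ (hoo i) (hoo i) (hoo i)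
  have he' : ∀ i, e' i * (e' i)ᴴ * e' i = e' i := fun i => hg2 _ _ _ _ (hoo i) (hoo i) (hoo i)
  have hv : ∀ i, ∃ v : Matrix Q.R Q.R ℂ, v * vᴴ = e i * (e i)ᴴ ∧ vᴴ * v = e' i * (e' i)ᴴ ∧
      Matrix.IsBlockDiag Q.blk Q.blk v := fun i => by
    refine Matrix.exists_blockDiag_partialIsometry ?_ ?_ ?_ ?_ (hleft (hfm _ _ (hoo i)) (hfm _ _ (hoo i)))
      (hleft (hgm _ _ (hoo i)) (hgm _ _ (hoo i))) fun j => ?_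
    · rw [← Matrix.mul_assoc, he]
    · rw [Matrix.conjTranspose_mul, Matrix.conjTranspose_conjTranspose]
    · rw [← Matrix.mul_assoc, he']
    · rw [Matrix.conjTranspose_mul, Matrix.conjTranspose_conjTranspose]
    · have := h _ _ (hoo i) j
      rw [hf0, hg0] at this
      exact this
  choose v hv1 hv2 hv3 using hv
  have hvv : ∀ i, v i * (v i)ᴴ * v i = v i := fun i =>
    Matrix.mul_conjTranspose_mul_of_isProj (by rw [hv1, ← Matrix.mul_assoc, he])
  have hvv' : ∀ i, (v i)ᴴ * v i * (v i)ᴴ = (v i)ᴴ := fun i => by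
    simpa [Matrix.mul_assoc] using congrArg Matrix.conjTranspose (hvv i)
  have hee' : ∀ i, (e' i)ᴴ * e' i * (e' i)ᴴ = (e' i)ᴴ := fun i => by
    simpa [Matrix.mul_assoc] using congrArg Matrix.conjTranspose (he' i)
  -- columns and rows with `l a * r b = f a b` and `l' a * r' b = g a b` and with the same supports
  let l : P.R → Matrix Q.R Q.R ℂ := fun a =>
    f a (o (P.swap (P.blk a))) * (e (P.blk a))ᴴ * v (P.blk a)
  let l' : P.R → Matrix Q.R Q.R ℂ := fun a => g a (o (P.swap (P.blk a))) * (e' (P.blk a))ᴴ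
  let r : P.R → Matrix Q.R Q.R ℂ := fun b =>
    (v (P.swap (P.blk b)))ᴴ * f (o (P.swap (P.blk b))) b
  let r' : P.R → Matrix Q.R Q.R ℂ := fun b => g (o (P.swap (P.blk b))) b
  let k : P.ι → Matrix Q.R Q.R ℂ := fun i => (v i)ᴴ * v i
  have hlr : ∀ a b, P.Adj a b → l a * r b = f a b := fun a b hab => by
    have hi : P.swap (P.blk b) = P.blk a := by rw [hab, P.swap_swap]
    have hob' : P.Adj (o (P.blk a)) b := hi ▸ hob b
    simp only [l, r, hi]
    calc _ = f a (o (P.swap (P.blk a))) * (e (P.blk a))ᴴ * (v (P.blk a) * (v (P.blk a))ᴴ) *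
          f (o (P.blk a)) b := by simp only [Matrix.mul_assoc]
      _ = f a (o (P.swap (P.blk a))) * (e (P.blk a) * (e (P.blk a))ᴴ * e (P.blk a))ᴴ *
          f (o (P.blk a)) b := by
        rw [hv1, Matrix.conjTranspose_mul (_ * _), Matrix.conjTranspose_mul,
          Matrix.conjTranspose_conjTranspose]
        simp only [Matrix.mul_assoc]
      _ = _ := by rw [he]; exact hf2 _ _ _ _ (hao a) (hoo _) hob'
  have hlr' : ∀ a b, P.Adj a b → l' a * r' b = g a b := fun a b hab => by
    have hi : P.swap (P.blk b) = P.blk a := by rw [hab, P.swap_swap]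
    have hob' : P.Adj (o (P.blk a)) b := hi ▸ hob b
    simp only [l', r', hi]
    exact hg2 _ _ _ _ (hao a) (hoo _) hob'
  obtain ⟨V, hV1, hV2, hV3, hV4⟩ := Matrix.exists_blockDiag_unitary_mul_eq (f := Q.blk) (l := l)
    (l' := l') (k := fun a => k (P.blk a)) (fun a c => by
      simp only [l, Matrix.conjTranspose_mul, Matrix.conjTranspose_conjTranspose]
      split_ifs with hac
      · subst hac
        calc _ = (v (P.blk a))ᴴ * (e (P.blk a) * ((f a (o (P.swap (P.blk a))))ᴴ *
              f a (o (P.swap (P.blk a)))) * (e (P.blk a))ᴴ) * v (P.blk a) := by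
              simp only [Matrix.mul_assoc]
          _ = (v (P.blk a))ᴴ * ((e (P.blk a) * (e (P.blk a))ᴴ * e (P.blk a)) * (e (P.blk a))ᴴ) *
              v (P.blk a) := by
              rw [hf6 _ _ _ (hao a) (hoo (P.blk a))]; simp only [e, Matrix.mul_assoc]
          _ = _ := by
              rw [he, ← hv1, ← Matrix.mul_assoc, hvv']
      · calc _ = (v (P.blk a))ᴴ * (e (P.blk a) * ((f a (o (P.swap (P.blk a))))ᴴ *
              f c (o (P.swap (P.blk c)))) * (e (P.blk c))ᴴ) * v (P.blk c) := by
              simp only [Matrix.mul_assoc]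
          _ = _ := by rw [hf3 _ _ _ _ (hao a) (hao c) hac]; simp)
    (fun a c => by
      simp only [l', Matrix.conjTranspose_mul, Matrix.conjTranspose_conjTranspose]
      split_ifs with hac
      · subst hac
        calc _ = e' (P.blk a) * ((g a (o (P.swap (P.blk a))))ᴴ *
              g a (o (P.swap (P.blk a)))) * (e' (P.blk a))ᴴ := by
              simp only [Matrix.mul_assoc]
          _ = (e' (P.blk a) * (e' (P.blk a))ᴴ * e' (P.blk a)) * (e' (P.blk a))ᴴ := by
              rw [hg6 _ _ _ (hao a) (hoo (P.blk a))]; simp only [e', Matrix.mul_assoc]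
          _ = _ := by rw [he', ← hv2]
      · calc _ = e' (P.blk a) * ((g a (o (P.swap (P.blk a))))ᴴ *
              g c (o (P.swap (P.blk c)))) * (e' (P.blk c))ᴴ := by
              simp only [Matrix.mul_assoc]
          _ = _ := by rw [hg3 _ _ _ _ (hao a) (hao c) hac]; simp)
    (fun a => by
      simp only [l, k]
      rw [Matrix.mul_assoc, ← Matrix.mul_assoc (v _), hvv])
    (fun a => by
      simp only [l', k]
      rw [hv2, Matrix.mul_assoc, ← Matrix.mul_assoc (e' _)ᴴ, hee'])
    (fun a => ((hleft (hfm _ _ (hao a)) (hfm _ _ (hoo _))).mul (hv3 _)).mul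
      (hleft (hgm _ _ (hao a)) (hgm _ _ (hoo _))).conjTranspose)
  obtain ⟨W, hW1, hW2, hW3, hW4⟩ := Matrix.exists_blockDiag_unitary_mul_eq (f := Q.blk)
    (l := fun b => (r b)ᴴ) (l' := fun b => (r' b)ᴴ) (k := fun b => k (P.swap (P.blk b)))
    (fun b d => by
      simp only [r, Matrix.conjTranspose_mul, Matrix.conjTranspose_conjTranspose]
      split_ifs with hbd
      · subst hbd
        calc _ = (v (P.swap (P.blk b)))ᴴ * (f (o (P.swap (P.blk b))) b *
              (f (o (P.swap (P.blk b))) b)ᴴ) * v (P.swap (P.blk b)) := by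
              simp only [Matrix.mul_assoc]
          _ = _ := by
              rw [hf5 _ _ _ (hob b) (hoo _)]
              change _ * (e _ * (e _)ᴴ) * _ = _
              rw [← hv1, ← Matrix.mul_assoc, hvv']
      · calc _ = (v (P.swap (P.blk b)))ᴴ * (f (o (P.swap (P.blk b))) b *
              (f (o (P.swap (P.blk d))) d)ᴴ) * v (P.swap (P.blk d)) := by
              simp only [Matrix.mul_assoc]
          _ = _ := by rw [hf4 _ _ _ _ (hob b) (hob d) hbd]; simp)
    (fun b d => by
      simp only [r', Matrix.conjTranspose_conjTranspose]
      split_ifs with hbd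
      · subst hbd
        rw [hg5 _ _ _ (hob b) (hoo _)]
        exact (hv2 _).symm
      · exact hg4 _ _ _ _ (hob b) (hob d) hbd)
    (fun b => by
      simp only [r, k, Matrix.conjTranspose_mul, Matrix.conjTranspose_conjTranspose]
      rw [Matrix.mul_assoc, ← Matrix.mul_assoc (v _), hvv])
    (fun b => by
      simp only [r', k]
      rw [hv2]
      change _ * (g _ _ * (g _ _)ᴴ) = _
      rw [hg5 _ _ _ (hoo _) (hob b)]
      have := hg2 _ _ _ _ (hob b) (hob b) (hob b)
      simpa [Matrix.mul_assoc] using congrArg Matrix.conjTranspose this)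
    (fun b => by
      simp only [r, r', Matrix.conjTranspose_mul, Matrix.conjTranspose_conjTranspose]
      rw [Matrix.mul_assoc]
      exact hright (hfm _ _ (hob b))
        (Q.tro.left_mul_mem (Q.mem_left_iff.mpr (hv3 _)) (hgm _ _ (hob b))))
  refine ⟨V, Wᴴ, hV1, hW1.conjTranspose, hV2, hV3, by simpa using hW3, by simpa using hW2,
    fun X => ?_⟩
  rw [hf1, hg1, Finset.mul_sum, Finset.sum_mul]
  refine Finset.sum_congr rfl fun a _ => ?_
  rw [Finset.mul_sum, Finset.sum_mul]
  refine Finset.sum_congr rfl fun b _ => ?_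
  rw [Matrix.mul_smul, Matrix.smul_mul]
  by_cases hab : P.Adj a b
  · have hW5 : r' b * Wᴴ = r b := by simpa using congrArg Matrix.conjTranspose (hW4 b)
    have : f a b = V * g a b * Wᴴ := by
      rw [← hlr' a b hab, ← Matrix.mul_assoc, hV4, Matrix.mul_assoc, hW5, hlr a b hab]
    rw [this]
  · rw [X.2 a b hab, zero_smul, zero_smul]

namespace Model

open TRO

variable {Z : Type v} [NormedAddCommGroup Z] [NormedSpace ℂ Z]
  [TripleProduct Z] {W : Type w} [NormedAddCommGroup W] [NormedSpace ℂ W] [TripleProduct W]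
  (M : P.Model Z) (N : Q.Model W) (U : UniversalTRO.{u} Z) (V : UniversalTRO.{u} W)

/-- A unitary in coordinates is a unitary of the algebra. -/
theorem _root_.BlockCoordinates.isUnitaryElement {R α ι : Type*} [NonUnitalRing R] [StarRing R]
    [Module ℂ R] [Fintype α] [DecidableEq α] {f : α → ι} (c : BlockCoordinates R f) {u : R}
    (h1 : c.ψ u * (c.ψ u)ᴴ = 1) (h2 : (c.ψ u)ᴴ * c.ψ u = 1) : IsUnitaryElement u := by
  have h3 : c.ψ (star u) = (c.ψ u)ᴴ := map_star c.ψ u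
  intro b
  refine ⟨c.injective ?_, c.injective ?_, c.injective ?_, c.injective ?_⟩ <;>
    simp only [map_mul, h3, h1, h2, one_mul, mul_one]

include M N in
/-- JB*-morphisms with the same `K₀`-map are unitarily equivalent. -/
theorem unitarilyEquivalent {Φ Ψ : JBHom Z W} (h : U.mapK V Φ = U.mapK V Ψ) :
    (U.map V Φ).UnitarilyEquivalent (U.map V Ψ) := by
  obtain ⟨X, Y, hX, hY, hX1, hX2, hY1, hY2, hXY⟩ := exists_unitary_of_blockTrace_eq
    ((N.iso V).comp ((U.map V Φ).comp (M.inv U))) ((N.iso V).comp ((U.map V Ψ).comp (M.inv U)))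
    fun a b hab j => by
      have h1 := M.isTripotent_matrixUnit U hab
      have h2 := congrArg ((N.leftCoord V).dim j) (DFunLike.congr_fun h h1.leftClass)
      rw [UniversalTRO.mapK, UniversalTRO.mapK, h1.map_leftClass, h1.map_leftClass, dim_leftClass,
        dim_leftClass] at h2
      exact h2
  obtain ⟨x, rfl⟩ := (N.leftCoord V).exists_eq X hX
  obtain ⟨y, rfl⟩ := (N.rightCoord V).exists_eq Y hY
  refine ⟨y, x, (N.rightCoord V).isUnitaryElement hY1 hY2,
    (N.leftCoord V).isUnitaryElement hX1 hX2, fun z => ?_⟩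
  have h1 := hXY (M.iso U z)
  have h2 : ∀ Ω : JBHom Z W, (N.iso V).comp ((U.map V Ω).comp (M.inv U)) (M.iso U z) =
      N.iso V (U.map V Ω z) := fun Ω => congrArg (fun t => N.iso V (U.map V Ω t)) (M.inv_iso U z)
  rw [h2, h2] at h1
  have h3 := V.tro.left_mul_mem x.2 (U.map V Ψ z).2
  refine congrArg Subtype.val ((N.iso_bijective V).1 (a₁ := U.map V Φ z)
    (a₂ := ⟨_, V.tro.mul_right_mem h3 y.2⟩) (Subtype.ext ?_))
  rw [h1]
  exact (((N.iso V).mul_right ⟨_, h3⟩ y).trans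
    (congrArg (· * ((N.iso V).right y : Matrix Q.R Q.R ℂ)) ((N.iso V).left_mul x _))).symm

end Model

end Pattern
end

/-! ### Principal triples as patterned matrices -/

noncomputable section

open TripleProduct
open scoped Matrix.Norms.L2Operator

namespace Pattern

/-- The direct sum of finitely many patterns. -/
def sigma {k : ℕ} (P : Fin k → Pattern.{u}) : Pattern.{u} where
  R := Σ i, (P i).R
  ι := Σ i, (P i).ι
  blk a := ⟨a.1, (P a.1).blk a.2⟩
  swap a := ⟨a.1, (P a.1).swap a.2⟩
  sign a := (P a.1).sign a.2
  swap_swap a := by rw [swap_swap]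
  sign_eq a := (P a.1).sign_eq a.2
  sign_swap a := (P a.1).sign_swap a.2
  exists_blk_eq := fun ⟨i, a⟩ => by
    obtain ⟨b, rfl⟩ := (P i).exists_blk_eq a
    exact ⟨⟨i, b⟩, rfl⟩
  kind := fun ⟨i, a⟩ => by
    have hcard : (Finset.univ.filter ((P i).blk · = a)).card ≤ (Finset.univ.filter
        fun b : Σ i, (P i).R => (⟨b.1, (P b.1).blk b.2⟩ : Σ i, (P i).ι) = ⟨i, a⟩).card := by
      refine Finset.card_le_card_of_injOn (fun b => ⟨i, b⟩) (fun b hb => ?_)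
        fun b _ c _ h => eq_of_heq (Sigma.mk.inj h).2
      have : (P i).blk b = a := by simpa using hb
      simp [this]
    have hswap : ∀ c : (P i).ι, (⟨i, c⟩ : Σ i, (P i).ι) = ⟨i, a⟩ ↔ c = a := fun c =>
      sigma_mk_injective.eq_iff
    rcases (P i).kind a with ⟨h1, h2⟩ | ⟨h1, h2, h3⟩ | ⟨h1, h2, h3⟩
    · exact Or.inl ⟨(hswap _).mpr h1, h2⟩
    · exact Or.inr (Or.inl ⟨(hswap _).mpr h1, h2, h3.trans hcard⟩)
    · exact Or.inr (Or.inr ⟨fun h => h1 ((hswap _).mp h), h2, h3.trans hcard⟩)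

theorem mem_fixed_iff {P : Pattern.{u}} {X : Matrix P.R P.R ℂ} : X ∈ P.fixed ↔
    (∀ a b, ¬ P.Adj a b → X a b = 0) ∧ ∀ a b, P.sign (P.blk a) * X b a = X a b :=
  and_congr Iff.rfl ⟨fun h a b => congrFun (congrFun h a) b, fun h => Matrix.ext h⟩

/-- A linear isomorphism of a space of matrices with the triple of patterned matrices that respects
the triple products. -/
structure IsRealization (P : Pattern.{u}) {m n : ℕ} {S : Submodule ℂ (Matrix (Fin m) (Fin n) ℂ)}
    (e : S →ₗ[ℂ] Matrix P.R P.R ℂ) : Prop where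
  injective : Function.Injective e
  mem_fixed : ∀ x, e x ∈ P.fixed
  exists_eq : ∀ X ∈ P.fixed, ∃ x, e x = X
  map_triple : ∀ x y z t : S, (t : Matrix (Fin m) (Fin n) ℂ) = matrixTriple x.1 y.1 z.1 →
    e t = (1 / 2 : ℂ) • (e x * (e y)ᴴ * e z + e z * (e y)ᴴ * e x)

/-- A rectangular factor consists of the corners of the symmetric matrices with vanishing diagonal
blocks. -/
theorem exists_isRealization_rect {m n : ℕ} (hm : 2 ≤ m) (hn : 2 ≤ n) :
    ∃ (P : Pattern.{u}) (e : (⊤ : Submodule ℂ (Matrix (Fin m) (Fin n) ℂ)) →ₗ[ℂ] Matrix P.R P.R ℂ),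
      P.IsRealization e := by
  let P : Pattern.{u} :=
    { R := ULift (Fin m ⊕ Fin n)
      ι := Bool
      blk := fun a => a.down.isLeft
      swap := not
      sign := fun _ => 1
      swap_swap := by decide
      sign_eq := fun _ => Or.inl rfl
      sign_swap := fun _ => rfl
      exists_blk_eq := by
        rintro (_ | _)
        · exact ⟨⟨Sum.inr ⟨0, by omega⟩⟩, rfl⟩
        · exact ⟨⟨Sum.inl ⟨0, by omega⟩⟩, rfl⟩
      kind := fun i => by
        refine Or.inr (Or.inr ⟨by revert i; decide, rfl, ?_⟩)
        cases i
        · refine hn.trans ?_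
          conv_lhs => rw [← Fintype.card_fin n, ← Finset.card_univ]
          exact Finset.card_le_card_of_injOn (fun b => ⟨Sum.inr b⟩) (fun b _ => by simp)
            fun b _ c _ h => Sum.inr_injective (ULift.up_injective h)
        · refine hm.trans ?_
          conv_lhs => rw [← Fintype.card_fin m, ← Finset.card_univ]
          exact Finset.card_le_card_of_injOn (fun b => ⟨Sum.inl b⟩) (fun b _ => by simp)
            fun b _ c _ h => Sum.inl_injective (ULift.up_injective h) }
  let e : (⊤ : Submodule ℂ (Matrix (Fin m) (Fin n) ℂ)) →ₗ[ℂ] Matrix P.R P.R ℂ :=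
    { toFun := fun x => (Matrix.fromBlocks 0 x.1 x.1ᵀ 0).submatrix ULift.down ULift.down
      map_add' := fun x y => by
        ext ⟨a | a⟩ ⟨b | b⟩ <;> simp
      map_smul' := fun c x => by
        ext ⟨a | a⟩ ⟨b | b⟩ <;> simp }
  refine ⟨P, e, ?_, fun x => mem_fixed_iff.mpr ⟨?_, ?_⟩, fun X hX => ?_, fun x y z t h => ?_⟩
  · intro x y h
    refine Subtype.ext (Matrix.ext fun a b => ?_)
    exact congrFun (congrFun h ⟨Sum.inl a⟩) ⟨Sum.inr b⟩
  · rintro ⟨a | a⟩ ⟨b | b⟩ h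
    · rfl
    · exact absurd rfl h
    · exact absurd rfl h
    · rfl
  · rintro ⟨a | a⟩ ⟨b | b⟩ <;> exact one_mul _
  · obtain ⟨h1, h2⟩ := mem_fixed_iff.mp hX
    refine ⟨⟨Matrix.of fun a b => X ⟨Sum.inl a⟩ ⟨Sum.inr b⟩, trivial⟩, ?_⟩
    ext ⟨a | a⟩ ⟨b | b⟩
    · exact (h1 _ _ Bool.noConfusion).symm
    · rfl
    · exact (one_mul _).symm.trans (h2 ⟨Sum.inr a⟩ ⟨Sum.inl b⟩)
    · exact (h1 _ _ Bool.noConfusion).symm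
  · have key : ∀ x y z : (⊤ : Submodule ℂ (Matrix (Fin m) (Fin n) ℂ)), e x * (e y)ᴴ * e z =
        (Matrix.fromBlocks 0 (x.1 * y.1ᴴ * z.1) (z.1 * y.1ᴴ * x.1)ᵀ 0).submatrix
          ULift.down ULift.down := fun x y z => by
      change (Matrix.fromBlocks 0 x.1 x.1ᵀ 0).submatrix Equiv.ulift Equiv.ulift *
        ((Matrix.fromBlocks 0 y.1 y.1ᵀ 0).submatrix Equiv.ulift Equiv.ulift)ᴴ *
        (Matrix.fromBlocks 0 z.1 z.1ᵀ 0).submatrix Equiv.ulift Equiv.ulift = _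
      rw [Matrix.conjTranspose_submatrix, Matrix.submatrix_mul_equiv, Matrix.submatrix_mul_equiv,
        Matrix.fromBlocks_conjTranspose, Matrix.fromBlocks_multiply, Matrix.fromBlocks_multiply]
      simp only [Matrix.conjTranspose_zero, Matrix.zero_mul, Matrix.mul_zero, add_zero, zero_add,
        Matrix.transpose_mul, Matrix.mul_assoc]
      rfl
    rw [key, key]
    change (Matrix.fromBlocks 0 t.1 t.1ᵀ 0).submatrix ULift.down ULift.down = _
    rw [h, matrixTriple]
    ext ⟨a | a⟩ ⟨b | b⟩ <;> simp [mul_add, add_comm]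

theorem exists_isRealization_symp {n : ℕ} (hn : 5 ≤ n) :
    ∃ (P : Pattern.{u}) (e : skewMatrices n →ₗ[ℂ] Matrix P.R P.R ℂ), P.IsRealization e := by
  let P : Pattern.{u} :=
    { R := ULift (Fin n)
      ι := Unit
      blk := fun _ => ()
      swap := id
      sign := fun _ => -1
      swap_swap := fun _ => rfl
      sign_eq := fun _ => Or.inr rfl
      sign_swap := fun _ => rfl
      exists_blk_eq := fun _ => ⟨⟨0, by omega⟩, rfl⟩
      kind := fun _ => Or.inr (Or.inl ⟨rfl, rfl, by simpa using hn⟩) }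
  let e : skewMatrices n →ₗ[ℂ] Matrix P.R P.R ℂ :=
    { toFun := fun x => x.1.submatrix ULift.down ULift.down
      map_add' := fun _ _ => rfl
      map_smul' := fun _ _ => rfl }
  refine ⟨P, e, ?_, fun x => mem_fixed_iff.mpr ⟨fun _ _ h => absurd rfl h, fun a b => ?_⟩,
    fun X hX => ?_, fun x y z t h => ?_⟩
  · intro x y h
    exact Subtype.ext (Matrix.ext fun a b => congrFun (congrFun h ⟨a⟩) ⟨b⟩)
  · have h := congrFun (congrFun x.2 a.down) b.down
    change -1 * x.1 b.down a.down = x.1 a.down b.down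
    change x.1 b.down a.down = -x.1 a.down b.down at h
    rw [h]; ring
  · obtain ⟨-, h2⟩ := mem_fixed_iff.mp hX
    refine ⟨⟨X.submatrix ULift.up ULift.up, Matrix.ext fun a b => ?_⟩, rfl⟩
    change X ⟨b⟩ ⟨a⟩ = -X ⟨a⟩ ⟨b⟩
    rw [← h2 ⟨a⟩ ⟨b⟩]
    change _ = -(-1 * _)
    ring
  · have key : ∀ x y z : skewMatrices n, e x * (e y)ᴴ * e z =
        (x.1 * y.1ᴴ * z.1).submatrix ULift.down ULift.down := fun x y z => by
      change x.1.submatrix Equiv.ulift Equiv.ulift * (y.1.submatrix Equiv.ulift Equiv.ulift)ᴴ *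
        z.1.submatrix Equiv.ulift Equiv.ulift = _
      rw [Matrix.conjTranspose_submatrix, Matrix.submatrix_mul_equiv, Matrix.submatrix_mul_equiv]
      rfl
    rw [key, key]
    change t.1.submatrix ULift.down ULift.down = _
    rw [h]
    rfl

theorem exists_isRealization_herm {n : ℕ} (hn : 2 ≤ n) :
    ∃ (P : Pattern.{u}) (e : symmetricMatrices n →ₗ[ℂ] Matrix P.R P.R ℂ), P.IsRealization e := by
  let P : Pattern.{u} :=
    { R := ULift (Fin n)
      ι := Unit
      blk := fun _ => ()
      swap := id
      sign := fun _ => 1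
      swap_swap := fun _ => rfl
      sign_eq := fun _ => Or.inl rfl
      sign_swap := fun _ => rfl
      exists_blk_eq := fun _ => ⟨⟨0, by omega⟩, rfl⟩
      kind := fun _ => Or.inl ⟨rfl, rfl⟩ }
  let e : symmetricMatrices n →ₗ[ℂ] Matrix P.R P.R ℂ :=
    { toFun := fun x => x.1.submatrix ULift.down ULift.down
      map_add' := fun _ _ => rfl
      map_smul' := fun _ _ => rfl }
  refine ⟨P, e, ?_, fun x => mem_fixed_iff.mpr ⟨fun _ _ h => absurd rfl h, fun a b => ?_⟩,
    fun X hX => ?_, fun x y z t h => ?_⟩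
  · intro x y h
    exact Subtype.ext (Matrix.ext fun a b => congrFun (congrFun h ⟨a⟩) ⟨b⟩)
  · exact (one_mul _).trans (congrFun (congrFun x.2 a.down) b.down)
  · obtain ⟨-, h2⟩ := mem_fixed_iff.mp hX
    exact ⟨⟨X.submatrix ULift.up ULift.up, Matrix.ext fun a b =>
      (one_mul _).symm.trans (h2 ⟨a⟩ ⟨b⟩)⟩, rfl⟩
  · have key : ∀ x y z : symmetricMatrices n, e x * (e y)ᴴ * e z =
        (x.1 * y.1ᴴ * z.1).submatrix ULift.down ULift.down := fun x y z => by
      change x.1.submatrix Equiv.ulift Equiv.ulift * (y.1.submatrix Equiv.ulift Equiv.ulift)ᴴ *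
        z.1.submatrix Equiv.ulift Equiv.ulift = _
      rw [Matrix.conjTranspose_submatrix, Matrix.submatrix_mul_equiv, Matrix.submatrix_mul_equiv]
      rfl
    rw [key, key]
    change t.1.submatrix ULift.down ULift.down = _
    rw [h]
    rfl

theorem exists_isRealization : ∀ F : PrincipalFactor,
    ∃ (P : Pattern.{u}) (e : F.space →ₗ[ℂ] Matrix P.R P.R ℂ), P.IsRealization e
  | .rect _ _ hm hn => exists_isRealization_rect hm hn
  | .symp _ hn => exists_isRealization_symp hn
  | .herm _ hn => exists_isRealization_herm hn

/-- Principal triples are triples of patterned matrices. -/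
theorem exists_model {Z : Type v} [NormedAddCommGroup Z] [NormedSpace ℂ Z] [JBStarTriple Z]
    (hZ : IsPrincipal Z) : ∃ P : Pattern.{u}, Nonempty (P.Model Z) := by
  obtain ⟨k, F, e, he⟩ := hZ
  choose P f hf using fun i => exists_isRealization.{u} (F i)
  let ρ : Z →ₗ[ℂ] Matrix (Σ i, (P i).R) (Σ i, (P i).R) ℂ :=
    { toFun := fun z => Matrix.blockDiagonal' fun i => f i (e z i)
      map_add' := fun x y => by
        rw [← Matrix.blockDiagonal'_add, map_add]
        exact congrArg Matrix.blockDiagonal' (funext fun i => map_add (f i) _ _)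
      map_smul' := fun c x => by
        rw [RingHom.id_apply, ← Matrix.blockDiagonal'_smul, map_smul]
        exact congrArg Matrix.blockDiagonal' (funext fun i => map_smul (f i) c _) }
  have hadj : ∀ i (a b : (P i).R), (sigma P).Adj ⟨i, a⟩ ⟨i, b⟩ ↔ (P i).Adj a b := fun i a b =>
    sigma_mk_injective.eq_iff
  have hρ : ∀ z i a b, ρ z ⟨i, a⟩ ⟨i, b⟩ = f i (e z i) a b := fun z i a b =>
    Matrix.blockDiagonal'_apply_eq (fun i => f i (e z i)) _ _ _
  have hρ' : ∀ z i j a b, i ≠ j → ρ z ⟨i, a⟩ ⟨j, b⟩ = 0 := fun z i j a b h =>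
    Matrix.blockDiagonal'_apply_ne (fun i => f i (e z i)) _ _ h
  refine ⟨sigma P, ⟨{
    ρ := ρ
    injective := fun x y h => e.injective (funext fun i => (hf i).injective ?_)
    mem_fixed := fun z => mem_fixed_iff.mpr ⟨?_, ?_⟩
    exists_eq := fun X hX => ?_
    map_triple := fun x y z => ?_ }⟩⟩
  · ext a b
    exact (hρ x i a b).symm.trans ((congrFun (congrFun h ⟨i, a⟩) ⟨i, b⟩).trans (hρ y i a b))
  · rintro ⟨i, a⟩ ⟨j, b⟩ h
    by_cases hij : i = j
    · subst hij
      exact (hρ z i a b).trans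
        ((mem_fixed_iff.mp ((hf i).mem_fixed _)).1 a b fun h' => h ((hadj i a b).mpr h'))
    · exact hρ' z i j a b hij
  · rintro ⟨i, a⟩ ⟨j, b⟩
    change (P i).sign ((P i).blk a) * ρ z ⟨j, b⟩ ⟨i, a⟩ = ρ z ⟨i, a⟩ ⟨j, b⟩
    by_cases hij : i = j
    · subst hij
      rw [hρ, hρ]
      exact (mem_fixed_iff.mp ((hf i).mem_fixed _)).2 a b
    · rw [hρ' _ _ _ _ _ hij, hρ' _ _ _ _ _ (Ne.symm hij), mul_zero]
  · obtain ⟨h1, h2⟩ := mem_fixed_iff.mp hX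
    have h3 : ∀ i, ∃ x, f i x = Matrix.of fun a b => X ⟨i, a⟩ ⟨i, b⟩ := fun i =>
      (hf i).exists_eq _ (mem_fixed_iff.mpr
        ⟨fun a b h => h1 _ _ fun h' => h ((hadj i a b).mp h'), fun a b => h2 ⟨i, a⟩ ⟨i, b⟩⟩)
    choose x hx using h3
    refine ⟨e.symm x, ?_⟩
    ext ⟨i, a⟩ ⟨j, b⟩
    by_cases hij : i = j
    · subst hij
      refine (hρ _ i a b).trans ?_
      rw [e.apply_symm_apply, hx]
      rfl
    · exact (hρ' _ i j a b hij).trans (h1 ⟨i, a⟩ ⟨j, b⟩ fun h => hij (congrArg Sigma.fst h).symm).symm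
  · change Matrix.blockDiagonal' (fun i => f i (e (triple x y z) i)) = (1 / 2 : ℂ) •
      (Matrix.blockDiagonal' (fun i => f i (e x i)) *
        (Matrix.blockDiagonal' (fun i => f i (e y i)))ᴴ * Matrix.blockDiagonal' (fun i => f i (e z i)) +
      Matrix.blockDiagonal' (fun i => f i (e z i)) *
        (Matrix.blockDiagonal' (fun i => f i (e y i)))ᴴ * Matrix.blockDiagonal' (fun i => f i (e x i)))
    rw [Matrix.blockDiagonal'_conjTranspose, ← Matrix.blockDiagonal'_mul,
      ← Matrix.blockDiagonal'_mul, ← Matrix.blockDiagonal'_mul, ← Matrix.blockDiagonal'_mul,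
      ← Matrix.blockDiagonal'_add, ← Matrix.blockDiagonal'_smul]
    exact congrArg Matrix.blockDiagonal' (funext fun i => (hf i).map_triple _ _ _ _ (he x y z i))

end Pattern
end

theorem mainTheorem3
    {Z₁ : Type v} [NormedAddCommGroup Z₁] [NormedSpace ℂ Z₁] [JBStarTriple Z₁]
    {Z₂ : Type w} [NormedAddCommGroup Z₂] [NormedSpace ℂ Z₂] [JBStarTriple Z₂]
    (h₁ : IsPrincipal Z₁) (h₂ : IsPrincipal Z₂) :
    Nonempty (UniversalTRO.{u} Z₁) ∧ Nonempty (UniversalTRO.{u} Z₂) ∧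
    ∀ (U₁ : UniversalTRO.{u} Z₁) (U₂ : UniversalTRO.{u} Z₂) (γ : U₁.K →+ U₂.K),
      Set.MapsTo γ U₁.scale U₂.scale →
      Set.MapsTo γ U₁.deltaPlus U₂.deltaPlus →
      Set.MapsTo γ U₁.deltaMinus U₂.deltaMinus →
      (∀ x : U₁.K, γ (U₁.σ x) = U₂.σ (γ x)) →
      (∃ Φ : JBHom Z₁ Z₂, U₁.mapK U₂ Φ = γ) ∧
        ∀ Φ Ψ : JBHom Z₁ Z₂, U₁.mapK U₂ Φ = γ → U₁.mapK U₂ Ψ = γ →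
          (U₁.map U₂ Φ).UnitarilyEquivalent (U₁.map U₂ Ψ) := by
  obtain ⟨P, ⟨M⟩⟩ := Pattern.exists_model.{u} h₁
  obtain ⟨Q, ⟨N⟩⟩ := Pattern.exists_model.{u} h₂
  refine ⟨⟨M.universal⟩, ⟨N.universal⟩, fun U V γ hγ hp hm hσ =>
    ⟨M.exists_mapK_eq N U V hγ hp hm hσ, fun Φ Ψ hΦ hΨ => ?_⟩⟩
  exact M.unitarilyEquivalent N U V (hΦ.trans hΨ.symm)
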